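/- **Setting.** Let $(\mathsf X,\mathcal X)$, $(\mathsf Y,\mathcal Y)$ be measurable spaces, $\mu$ a probability measure on $\mathsf X$ and $\lambda$ a measure on $\mathsf Y$. For $\theta\in\Theta$ let $Q_\theta$ be a Markov kernel on $\mathsf X$ with jointly measurable densities $Q_\theta(x,dx')=q_\theta(x,x')\,\mu(dx')$, and let $g_\theta(x,\cdot)$ be (jointly measurable) probability densities with respect to $\lambda$. Let $\nu$ be a probability measure on $\mathsf X$ with $\nu\ll\mu$ and a version of the density with $(d\nu/d\mu)_-:=\inf_{x}\frac{d\nu}{d\mu}(x)>0$. The joint smoothing distribution $\phi_{\nu,0:n|n}[y_{0:n}](\cdot\,;\theta)$ is the probability measure on $\mathsf X^{n+1}$ with $\mu^{\otimes(n+1)}$-density proportional to $\frac{d\nu}{d\mu}(x_0)g_\theta(x_0,y_0)\prod_{k=1}^n q_\theta(x_{k-1},x_k)g_\theta(x_k,y_k)$. Let $t_n(x_{0:n})=\sum_{k=0}^{n-1}s_k(x_k,x_{k+1})$, where the real functions $s_k$ are measurable and may also depend (jointly measurably) on $Y_{0:n}$, and let $\gamma_{\theta,n}=\phi_{\nu,0:n|n}[Y_{0:n}](t_n;\theta)$,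 i.e. $\mathbb E_\theta[t_n(X_{0:n})\mid Y_{0:n}]$. The observations $(Y_k)$ are generated by a state space model with initial law $\bar\nu$, Markov kernel $\bar Q$ and observation densities $\bar g$ with respect to $\lambda$, not assumed to belong to the family above. **Particle filter.** Let $N\ge1$, let $\varsigma$ be a probability measure with $\nu\ll\varsigma$, and let $R_{\theta,k}(y_{k+1};x,\cdot)$ be Markov proposal kernels (which may depend on the new observation) with $Q_\theta(x,\cdot)\ll R_{\theta,k}(y;x,\cdot)$. Put $W_0(x)=g_\theta(x,Y_0)\frac{d\nu}{d\varsigma}(x)$ and $W_{k}(x,x')=g_\theta(x',Y_{k})\frac{dQ_\theta(x,\cdot)}{dR_{\theta,k-1}(Y_{k};x,\cdot)}(x')$ for $k\ge1$, for fixed finite-valued (jointly) measurable versions of the derivatives. At time $0$ the particles $\xi_0^{N,1},\dots,\xi_0^{N,N}$ are i.i.d. from $\varsigma$. At each time $k$, given the particle paths $\xi_{0:k}^{N,j}$, indices $I^{N,1}_k,\dots,I_k^{N,N}$ are drawn i.i.d. with probabilities proportional to $W_0(\xi_0^{N,j})$ if $k=0$, or $W_k(\xi^{N,j}_{0:k}(k-1),\xi^{N,j}_{0:k}(k))$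 if $k\ge1$ (uniform if all these weights vanish), and $\hat\xi^{N,i}_{0:k}=\xi_{0:k}^{N,I_k^{N,i}}$. Then, independently over $i$, $\xi^{N,i}_{0:k+1}$ is $\hat\xi^{N,i}_{0:k}$ extended by a draw from $R_{\theta,k}(Y_{k+1};\hat\xi^{N,i}_{0:k}(k),\cdot)$. Let $\bar{\mathbb E}^N_\theta$ be the expectation for the joint law of this system and the data model, $\|\cdot\|_p$ the corresponding $L^p$ norm and $\bar{\mathbb E}$ the expectation for the law of the observations. For a lag $\Delta_n\ge1$, with $k(\Delta_n)=(k+\Delta_n)\wedge n$, the fixed-lag estimator is $$\hat\gamma^{N,\Delta_n}_{\theta,n}=\frac1N\sum_{k=0}^{n-1}\sum_{j=1}^N s_k\big(\hat\xi^{N,j}_{0:k(\Delta_n)}(k),\hat\xi^{N,j}_{0:k(\Delta_n)}(k+1)\big).$$ **Assumptions.** Here $\|\cdot\|_\infty$ denotes the supremum norm in the state variables, $\mu g_\theta(y)=\int g_\theta(x,y)\,\mu(dx)$. * (A1) $\sigma_-:=\inf_{\theta,x,x'}q_\theta(x,x')>0$ and $\sigma_+:=\sup_{\theta,x,x'}q_\theta(x,x')<\infty$;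 for all $y$, $\sup_\theta\|g_\theta(\cdot,y)\|_\infty<\infty$ and $\inf_\theta\mu g_\theta(y)>0$. Put $\rho=1-\sigma_- /\sigma_+$. * (A2) $\|W_k(\cdot;\theta)\|_\infty<\infty$ for all $k\ge0$, all $\theta$ and all values of $Y_k$. * (A3) for $(p,\ell)$, $\theta$, with constant $a_{p,\ell}=a_{p,\ell}(t_n;\theta)\in[0,\infty)$: for all $0\le k\le n$, $0\le i\le n-1$, $$\bar{\mathbb E}\Big[\frac{\|W_k(\cdot;\theta)\|_\infty^p\|s_i\|_\infty^\ell}{\{\mu g_\theta(Y_k)\}^p}\Big]\le a_{p,\ell},\qquad \bar{\mathbb E}\big[\|s_i\|_\infty^\ell\big]\le a_{p,\ell}.$$ **Proposition.** There are universal constants $B_p$ (depending only on $p$) and $B$ such that, in every setting as above that satisfies (A1) and (A2), for all $N\ge1$, $n\ge0$, $\Delta_n\ge1$ and $\theta\in\Theta$, with $x^+=\max(x,0)$: (i) if (A3) holds with $\ell=p$ for an integer $p\ge2$, then $\hat\gamma^{N,\Delta_n}_{\theta,n}-\gamma_{\theta,n}\in L^p$ and $$\|\hat\gamma^{N,\Delta_n}_{\theta,n}-\gamma_{\theta,n}\|_p\le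 2a_{p,p}^{1/p}\rho^{\Delta_n}(n-\Delta_n+1)^+ +\frac{B_p\,a_{p,p}^{1/p}}{\sqrt N(1-\rho)}\Big\{\frac{\Delta_n(n+1)}{\sigma_-}+n\Big[\frac1{\sigma_-(1-\rho)}+\frac1{(d\nu/d\mu)_-^2}+1\Big]\Big\};$$ (ii) if (A3) holds with $p=2$, $\ell=1$, then $\hat\gamma^{N,\Delta_n}_{\theta,n}-\gamma_{\theta,n}$ is integrable and $$\big|\bar{\mathbb E}^N_\theta[\hat\gamma^{N,\Delta_n}_{\theta,n}-\gamma_{\theta,n}]\big|\le 2a_{2,1}\rho^{\Delta_n}(n-\Delta_n+1)^+ +\frac{B\,a_{2,1}}{N(1-\rho)^2}\Big\{\frac{\Delta_n(n+1)}{\sigma_-^2}+n\Big[\frac1{\sigma_-^2(1-\rho)}+\frac1{(d\nu/d\mu)_-^2}\Big]\Big\}.$$ -/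

import Mathlib

open MeasureTheory ProbabilityTheory
open scoped NNReal ENNReal

universe u v w

namespace FixedLag

noncomputable section

/-- `f` is a (measurable, finite-valued) version of the Radon-Nikodym derivative `dm/dm₀`. -/
def IsRNDensity {α : Type*} [MeasurableSpace α] (f : α → ℝ≥0) (m m₀ : Measure α) : Prop :=
  Measurable f ∧ m = m₀.withDensity (fun a => (f a : ℝ≥0∞))

/-- A parametric family of state space models: the hidden chain has initial distribution `ν` and
transition kernels `Q θ` dominated by the probability measure `μ`, with densities `q θ`; the
observation density with respect to `lam` is `g θ`. The initial law `ν` is dominated by `μ`, with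
density `dν`. -/
structure StateSpaceModel (Θ X 𝓨 : Type*) [MeasurableSpace X] [MeasurableSpace 𝓨] where
  μ : Measure X
  prob_μ : IsProbabilityMeasure μ
  lam : Measure 𝓨
  ν : Measure X
  prob_ν : IsProbabilityMeasure ν
  dν : X → ℝ≥0
  dν_density : IsRNDensity dν ν μ
  Q : Θ → Kernel X X
  markov_Q : ∀ θ, IsMarkovKernel (Q θ)
  q : Θ → X → X → ℝ≥0
  measurable_q : ∀ θ, Measurable (fun a : X × X => q θ a.1 a.2)
  q_density : ∀ θ x, IsRNDensity (q θ x) (Q θ x) μ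
  g : Θ → X → 𝓨 → ℝ≥0
  measurable_g : ∀ θ, Measurable (fun a : X × 𝓨 => g θ a.1 a.2)
  lintegral_g : ∀ θ x, ∫⁻ y, (g θ x y : ℝ≥0∞) ∂lam = 1

/-- The instrumental distributions of the particle filter. `ς` is the law of the initial
particles and `dς` is `dν/dς`. The proposal kernel `R θ k (y, x)` moves a particle from `x` at
time `k` to time `k + 1` and may depend on the new observation `y`; `dR θ k y x` is the density
`dQ_θ(x, ·)/dR_{θ,k}(x, ·)`. -/
structure Proposal {Θ X 𝓨 : Type*} [MeasurableSpace X] [MeasurableSpace 𝓨]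
    (M : StateSpaceModel Θ X 𝓨) where
  ς : Measure X
  prob_ς : IsProbabilityMeasure ς
  dς : X → ℝ≥0
  dς_density : IsRNDensity dς M.ν ς
  R : Θ → ℕ → Kernel (𝓨 × X) X
  markov_R : ∀ θ k, IsMarkovKernel (R θ k)
  dR : Θ → ℕ → 𝓨 → X → X → ℝ≥0
  measurable_dR : ∀ θ k, Measurable (fun a : 𝓨 × X × X => dR θ k a.1 a.2.1 a.2.2)
  dR_density : ∀ θ k y x, IsRNDensity (dR θ k y x) (M.Q θ x) (R θ k (y, x))

/-- The state space model that generates the observations: initial law `ν`, transition kernel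
`Q` and observation kernel `G` with density `g` with respect to `lam`. It is not related to the
parametric family. -/
structure DataModel (X : Type*) {𝓨 : Type*} [MeasurableSpace X] [MeasurableSpace 𝓨]
    (lam : Measure 𝓨) where
  ν : Measure X
  prob_ν : IsProbabilityMeasure ν
  Q : Kernel X X
  markov_Q : IsMarkovKernel Q
  g : X → 𝓨 → ℝ≥0
  measurable_g : Measurable (fun a : X × 𝓨 => g a.1 a.2)
  G : Kernel X 𝓨
  markov_G : IsMarkovKernel G
  g_density : ∀ x, IsRNDensity (g x) (G x) lam

attribute [instance] StateSpaceModel.prob_μ StateSpaceModel.prob_ν StateSpaceModel.markov_Q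
  Proposal.prob_ς Proposal.markov_R DataModel.prob_ν DataModel.markov_Q DataModel.markov_G

variable {Θ X 𝓨 : Type*} [MeasurableSpace X] [MeasurableSpace 𝓨]

/-! ### The smoothing distribution -/

namespace StateSpaceModel

variable (M : StateSpaceModel Θ X 𝓨)

/-- The joint density of `(X_{0:n}, Y_{0:n})` at `(x, y)` (with respect to `μ` and `lam`). -/
def pathDensity (θ : Θ) (n : ℕ) (y : Fin (n + 1) → 𝓨) (x : Fin (n + 1) → X) : ℝ≥0 :=
  M.dν (x 0) * M.g θ (x 0) (y 0) *
    ∏ k : Fin n, M.q θ (x k.castSucc) (x k.succ) * M.g θ (x k.succ) (y k.succ)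

/-- The likelihood of `y_{0:n}`. -/
def likelihood (θ : Θ) (n : ℕ) (y : Fin (n + 1) → 𝓨) : ℝ≥0∞ :=
  ∫⁻ x, (M.pathDensity θ n y x : ℝ≥0∞) ∂(Measure.pi fun _ : Fin (n + 1) => M.μ)

/-- The joint smoothing distribution `φ_{ν,0:n|n}[y_{0:n}](· ; θ)`, the conditional law of
`X_{0:n}` given `Y_{0:n} = y_{0:n}` under the parameter `θ`, in the version given by Bayes'
formula. -/
def smoothing (θ : Θ) (n : ℕ) (y : Fin (n + 1) → 𝓨) : Measure (Fin (n + 1) → X) :=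
  (M.likelihood θ n y)⁻¹ •
    (Measure.pi fun _ : Fin (n + 1) => M.μ).withDensity
      (fun x => (M.pathDensity θ n y x : ℝ≥0∞))

/-- `σ_- = inf_θ inf_{x,x'} q_θ(x, x')`. -/
def sigmaMinus : ℝ≥0∞ := ⨅ θ, ⨅ x, ⨅ x', (M.q θ x x' : ℝ≥0∞)

/-- `σ_+ = sup_θ sup_{x,x'} q_θ(x, x')`. -/
def sigmaPlus : ℝ≥0∞ := ⨆ θ, ⨆ x, ⨆ x', (M.q θ x x' : ℝ≥0∞)

/-- `ρ = 1 - σ_- / σ_+`. -/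
def rho : ℝ := 1 - M.sigmaMinus.toReal / M.sigmaPlus.toReal

/-- `(dν/dμ)_- = inf_x dν/dμ(x)`. -/
def dνMinus : ℝ≥0∞ := ⨅ x, (M.dν x : ℝ≥0∞)

/-- `μ g_θ(y) = ∫ g_θ(x, y) μ(dx)`. -/
def μg (θ : Θ) (y : 𝓨) : ℝ≥0∞ := ∫⁻ x, (M.g θ x y : ℝ≥0∞) ∂M.μ

/-- Assumption (A1). -/
def A1 : Prop :=
  (0 < M.sigmaMinus ∧ M.sigmaPlus < ∞) ∧
  ∀ y : 𝓨, (⨆ θ, ⨆ x, (M.g θ x y : ℝ≥0∞)) < ∞ ∧ 0 < ⨅ θ, M.μg θ y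

end StateSpaceModel

/-! ### Importance weights -/

namespace Proposal

variable {M : StateSpaceModel Θ X 𝓨} (S : Proposal M)

/-- The initial importance weight function `W_0`. -/
def W₀ (θ : Θ) (y : 𝓨) (x : X) : ℝ≥0 := M.g θ x y * S.dς x

/-- The importance weight function `W_{k+1}`. -/
def W (θ : Θ) (k : ℕ) (y : 𝓨) (x x' : X) : ℝ≥0 := M.g θ x' y * S.dR θ k y x x'

/-- The weight of a path `x_{0:k}` at time `k`, when the weights were reset at time `k - 1`. -/
def pathWeight (θ : Θ) : (k : ℕ) → 𝓨 → (Fin (k + 1) → X) → ℝ≥0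
  | 0, y, x => S.W₀ θ y (x 0)
  | k + 1, y, x => S.W θ k y (x (Fin.last k).castSucc) (x (Fin.last (k + 1)))

/-- The supremum norm of `W_k(· ; θ)`, as a function of the observation `y_k`. -/
def normW (θ : Θ) : ℕ → 𝓨 → ℝ≥0∞
  | 0, y => ⨆ x, (S.W₀ θ y x : ℝ≥0∞)
  | k + 1, y => ⨆ x, ⨆ x', (S.W θ k y x x' : ℝ≥0∞)

/-- Assumption (A2). -/
def A2 : Prop := ∀ (k : ℕ) (θ : Θ) (y : 𝓨), S.normW θ k y < ∞

lemma measurable_pathWeight (θ : Θ) (k : ℕ) :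
    Measurable (fun a : 𝓨 × (Fin (k + 1) → X) => S.pathWeight θ k a.1 a.2) := by
  have hg := M.measurable_g θ
  cases k with
  | zero =>
    have h1 := S.dς_density.1
    have h2 : Measurable (fun a : 𝓨 × (Fin (0 + 1) → X) => (a.2 0, a.1)) := by fun_prop
    have h3 : Measurable (fun a : 𝓨 × (Fin (0 + 1) → X) => a.2 0) := by fun_prop
    exact (hg.comp h2).mul (h1.comp h3)
  | succ k =>
    have h1 := S.measurable_dR θ k
    have h2 : Measurable (fun a : 𝓨 × (Fin (k + 1 + 1) → X) => (a.2 (Fin.last (k + 1)), a.1)) := by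
      fun_prop
    have h3 : Measurable (fun a : 𝓨 × (Fin (k + 1 + 1) → X) =>
        (a.1, a.2 (Fin.last k).castSucc, a.2 (Fin.last (k + 1)))) := by fun_prop
    exact (hg.comp h2).mul (h1.comp h3)

end Proposal

/-! ### Independent draws and multinomial selection -/

/-- Finitely many independent draws from Markov kernels. -/
def kernelPi {ι α β : Type*} [Fintype ι] [MeasurableSpace α] [MeasurableSpace β]
    (κ : ι → Kernel α β) [∀ i, IsMarkovKernel (κ i)] : Kernel α (ι → β) where
  toFun a := Measure.pi fun i => κ i a
  measurable' := by
    refine Measurable.measure_of_isPiSystem_of_isProbabilityMeasure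
      (S := Set.pi Set.univ '' Set.pi Set.univ fun _ : ι => {s : Set β | MeasurableSet s})
      generateFrom_pi.symm isPiSystem_pi ?_
    rintro _ ⟨s, hs, rfl⟩
    simp only [Measure.pi_pi]
    exact Finset.measurable_prod _ fun i _ => (κ i).measurable_coe (hs i (Set.mem_univ i))

instance {ι α β : Type*} [Fintype ι] [MeasurableSpace α] [MeasurableSpace β]
    (κ : ι → Kernel α β) [∀ i, IsMarkovKernel (κ i)] : IsMarkovKernel (kernelPi κ) :=
  ⟨fun a => inferInstanceAs (IsProbabilityMeasure (Measure.pi fun i => κ i a))⟩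

/-- The normalized weights. If all weights vanish then the normalized weights are not defined,
and the uniform weights are used. -/
def normalized {N : ℕ} (w : Fin N → ℝ≥0) (j : Fin N) : ℝ≥0 :=
  if ∑ i, w i = 0 then (N : ℝ≥0)⁻¹ else w j / ∑ i, w i

lemma sum_normalized {N : ℕ} [NeZero N] (w : Fin N → ℝ≥0) : ∑ j, normalized w j = 1 := by
  unfold normalized
  split_ifs with h
  · simp [NeZero.ne N]
  · rw [← Finset.sum_div, div_self h]

/-- The law of one index drawn with the normalized weights. -/
def indexLaw {N : ℕ} (w : Fin N → ℝ≥0) : Measure (Fin N) :=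
  ∑ j, (normalized w j : ℝ≥0∞) • Measure.dirac j

lemma indexLaw_apply {N : ℕ} (w : Fin N → ℝ≥0) (A : Set (Fin N)) :
    indexLaw w A = ∑ j, (normalized w j : ℝ≥0∞) * A.indicator 1 j := by
  simp [indexLaw, -Measure.coe_nnreal_smul, -Measure.coe_nnreal_smul_apply]

instance {N : ℕ} [NeZero N] (w : Fin N → ℝ≥0) : IsProbabilityMeasure (indexLaw w) := by
  constructor
  rw [indexLaw_apply]
  simp only [Set.indicator_univ, Pi.one_apply, mul_one]
  rw [← ENNReal.ofNNReal_finsetSum, sum_normalized, ENNReal.coe_one]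

lemma measurable_normalized {N : ℕ} (j : Fin N) :
    Measurable (fun w : Fin N → ℝ≥0 => normalized w j) := by
  have h : Measurable (fun w : Fin N → ℝ≥0 => ∑ i, w i) := by fun_prop
  exact Measurable.ite (h (measurableSet_singleton 0)) measurable_const
    ((measurable_pi_apply j).div h)

lemma measurable_indexLaw {N : ℕ} : Measurable (indexLaw (N := N)) := by
  refine Measure.measurable_of_measurable_coe _ fun A _ => ?_
  simp only [indexLaw_apply]
  exact Finset.measurable_sum _ fun j _ =>
    (measurable_normalized j).coe_nnreal_ennreal.mul measurable_const

/-! ### The particle filter -/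

/-- The state of the chain at time `k`: the hidden state and the observation generated by the data
model, the particle paths `ξ_{0:k}^{N,i}`, and the indices `I_k^{N,i}` drawn in the selection
step. -/
abbrev ChainState (X 𝓨 : Type*) (N k : ℕ) : Type _ :=
  (X × 𝓨) × ((Fin N → Fin (k + 1) → X) × (Fin N → Fin N))

/-- The observation `Y_k`. -/
def ChainState.obs {N k : ℕ} (z : ChainState X 𝓨 N k) : 𝓨 := z.1.2

/-- The resampled path with number `i`, i.e. the path with number `I_k^{N,i}`. -/
def ChainState.resampled {N k : ℕ} (z : ChainState X 𝓨 N k) (i : Fin N) : Fin (k + 1) → X :=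
  z.2.1 (z.2.2 i)

lemma ChainState.measurable_resampled {N k : ℕ} (i : Fin N) :
    Measurable (fun z : ChainState X 𝓨 N k => z.resampled i) := by
  have h : Measurable (fun a : (Fin N → Fin (k + 1) → X) × Fin N => a.1 a.2) :=
    measurable_from_prod_countable_left fun j => measurable_pi_apply j
  have h2 : Measurable (fun z : ChainState X 𝓨 N k => (z.2.1, z.2.2 i)) := by fun_prop
  exact h.comp h2

section Filter

variable {M : StateSpaceModel Θ X 𝓨} (S : Proposal M) (D : DataModel X M.lam)
  (N : ℕ) [NeZero N] (θ : Θ)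

/-- The mutation kernel: the path `x_{0:k}` is kept, and a new component is drawn from
`R_k(x_k, ·)`, given the new observation. -/
def mutation (k : ℕ) : Kernel (𝓨 × (Fin (k + 1) → X)) (Fin (k + 2) → X) :=
  ((Kernel.deterministic (fun a : 𝓨 × (Fin (k + 1) → X) => a.2) measurable_snd) ×ₖ
    ((S.R θ k).comap (fun a : 𝓨 × (Fin (k + 1) → X) => (a.1, a.2 (Fin.last k)))
      (by fun_prop))).map
    (fun b : (Fin (k + 1) → X) × X => (Fin.snoc b.1 b.2 : Fin (k + 2) → X))

lemma measurable_snoc_pair (k : ℕ) :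
    Measurable (fun b : (Fin (k + 1) → X) × X => (Fin.snoc b.1 b.2 : Fin (k + 2) → X)) := by
  refine measurable_pi_lambda _ fun i => ?_
  refine Fin.lastCases ?_ (fun j => ?_) i
  · simpa using measurable_snd
  · simp only [Fin.snoc_castSucc]
    fun_prop

instance (k : ℕ) : IsMarkovKernel (mutation S θ k) :=
  Kernel.IsMarkovKernel.map _ (measurable_snoc_pair k)

/-- Multinomial selection: given the observation and the particle paths at time `k`, the `N`
indices are independent draws with the normalized importance weights. -/
def selection (k : ℕ) : Kernel (𝓨 × (Fin N → Fin (k + 1) → X)) (Fin N → Fin N) where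
  toFun a := Measure.pi fun _ : Fin N => indexLaw fun j => S.pathWeight θ k a.1 (a.2 j)
  measurable' := by
    have h : Measurable (fun a : 𝓨 × (Fin N → Fin (k + 1) → X) =>
        indexLaw fun j => S.pathWeight θ k a.1 (a.2 j)) := by
      refine measurable_indexLaw.comp (measurable_pi_lambda _ fun j => ?_)
      have h2 : Measurable (fun a : 𝓨 × (Fin N → Fin (k + 1) → X) => (a.1, a.2 j)) := by
        fun_prop
      exact (S.measurable_pathWeight θ k).comp h2
    let κ : Kernel (𝓨 × (Fin N → Fin (k + 1) → X)) (Fin N) := ⟨_, h⟩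
    have : IsMarkovKernel κ := ⟨fun a => inferInstanceAs (IsProbabilityMeasure (indexLaw _))⟩
    exact (kernelPi fun _ : Fin N => κ).measurable

instance (k : ℕ) : IsMarkovKernel (selection S N θ k) :=
  ⟨fun a => inferInstanceAs (IsProbabilityMeasure
    (Measure.pi fun _ : Fin N => indexLaw fun j => S.pathWeight θ k a.1 (a.2 j)))⟩

/-- The law of the chain at time `0`: `X_0 ~ ν̄`, `Y_0 ~ Ḡ(X_0, ·)`, the `N` particles are
independent draws from `ς`, and they are selected according to their weights. -/
def initialLaw : Measure (ChainState X 𝓨 N 0) :=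
  (D.ν ⊗ₘ D.G) ⊗ₘ
    (Kernel.const (X × 𝓨)
        (Measure.pi fun _ : Fin N => Measure.pi fun _ : Fin (0 + 1) => S.ς) ⊗ₖ
      (selection S N θ 0).comap (fun a : (X × 𝓨) × (Fin N → Fin (0 + 1) → X) => (a.1.2, a.2))
        (by fun_prop))

instance : IsProbabilityMeasure (initialLaw S D N θ) := by
  unfold initialLaw; infer_instance

/-- One step of the chain: `(X_{k+1}, Y_{k+1})` is drawn from the data model, the resampled paths
are mutated independently of each other, and then the indices of the next selection are drawn. -/
def step (k : ℕ) : Kernel (ChainState X 𝓨 N k) (ChainState X 𝓨 N (k + 1)) :=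
  ((D.Q ⊗ₖ Kernel.prodMkLeft X D.G).comap (fun z : ChainState X 𝓨 N k => z.1.1)
      (by fun_prop)) ⊗ₖ
    ((kernelPi fun i : Fin N => (mutation S θ k).comap
        (fun a : ChainState X 𝓨 N k × (X × 𝓨) => (a.2.2, a.1.resampled i))
        ((measurable_snd.comp measurable_snd).prodMk
          ((ChainState.measurable_resampled i).comp measurable_fst))) ⊗ₖ
      (selection S N θ (k + 1)).comap
        (fun a : (ChainState X 𝓨 N k × (X × 𝓨)) × (Fin N → Fin (k + 1 + 1) → X) =>
          (a.1.2.2, a.2)) (by fun_prop))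

instance (k : ℕ) : IsMarkovKernel (step S D N θ k) := by
  unfold step; infer_instance

/-- The space of trajectories of the chain. -/
abbrev Traj (X 𝓨 : Type*) (N : ℕ) : Type _ := (k : ℕ) → ChainState X 𝓨 N k

/-- The law of the Markov chain formed by the data model and the particle filter. -/
def chainLaw : Measure (Traj X 𝓨 N) :=
  Kernel.trajMeasure (X := fun k => ChainState X 𝓨 N k) (initialLaw S D N θ)
    (fun k => (step S D N θ k).comap
      (fun h : (i : Finset.Iic k) → ChainState X 𝓨 N i => h ⟨k, Finset.mem_Iic.2 le_rfl⟩)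
      (by fun_prop))

/-- The observations `Y_{0:n}`. -/
def observations {N : ℕ} (n : ℕ) (z : Traj X 𝓨 N) : Fin (n + 1) → 𝓨 :=
  fun i => (z i).obs

/-- The law of the observations `Y_{0:n}`. -/
def obsLaw (n : ℕ) : Measure (Fin (n + 1) → 𝓨) :=
  (chainLaw S D N θ).map (observations n)

end Filter

/-! ### Additive functionals and the fixed-lag estimator -/

/-- The additive functional `t_n(x_{0:n}) = ∑_{k<n} s_k(x_{k:k+1})`. The functions `s_k` may depend
on the observations `y_{0:n}`. -/
def additive {n : ℕ} (s : Fin n → (Fin (n + 1) → 𝓨) → X → X → ℝ) (y : Fin (n + 1) → 𝓨)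
    (x : Fin (n + 1) → X) : ℝ :=
  ∑ k : Fin n, s k y (x k.castSucc) (x k.succ)

/-- The smoothed functional `γ_{θ,n} = E_θ[t_n(X_{0:n}) | Y_{0:n} = y]`. -/
def gammaExact (M : StateSpaceModel Θ X 𝓨) (θ : Θ) {n : ℕ}
    (s : Fin n → (Fin (n + 1) → 𝓨) → X → X → ℝ) (y : Fin (n + 1) → 𝓨) : ℝ :=
  ∫ x, additive s y x ∂(M.smoothing θ n y)

/-- The fixed-lag estimator with lag `Δ`, evaluated along a trajectory of the chain. With
`m = (k + Δ) ∧ n` the function `s_k` is averaged over the components `k, k + 1` of the resampled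
paths at time `m`. -/
def gammaHat {N n : ℕ} (s : Fin n → (Fin (n + 1) → 𝓨) → X → X → ℝ) (Δ : ℕ) (hΔ : 1 ≤ Δ)
    (z : Traj X 𝓨 N) : ℝ :=
  (N : ℝ)⁻¹ * ∑ k : Fin n, ∑ j : Fin N,
    s k (observations n z)
      ((z (min (k + Δ) n)).resampled j ⟨k, by have := k.2; omega⟩)
      ((z (min (k + Δ) n)).resampled j ⟨k + 1, by have := k.2; omega⟩)

/-- The supremum norm of `s_k`, for given observations. -/
def normS (f : X → X → ℝ) : ℝ≥0∞ := ⨆ x, ⨆ x', ‖f x x'‖ₑ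

/-- The expectation of `F` under `m` exists (`F` is measurable up to null sets) and is at
most `a`. -/
def ExpectationLE {α : Type*} [MeasurableSpace α] (m : Measure α) (F : α → ℝ≥0∞) (a : ℝ) : Prop :=
  AEMeasurable F m ∧ ∫⁻ y, F y ∂m ≤ ENNReal.ofReal a

/-- Assumption (A3) for the exponents `p`, `ℓ`, the parameter `θ` and the constant `a`. -/
def A3 {M : StateSpaceModel Θ X 𝓨} (S : Proposal M) (D : DataModel X M.lam) (N : ℕ) [NeZero N]
    (θ : Θ) {n : ℕ} (s : Fin n → (Fin (n + 1) → 𝓨) → X → X → ℝ) (p ℓ : ℕ) (a : ℝ) : Prop :=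
  0 ≤ a ∧
  (∀ (k : Fin (n + 1)) (i : Fin n), ExpectationLE (obsLaw S D N θ n)
    (fun y => S.normW θ k (y k) ^ p * normS (s i y) ^ ℓ / M.μg θ (y k) ^ p) a) ∧
  ∀ i : Fin n, ExpectationLE (obsLaw S D N θ n) (fun y => normS (s i y) ^ ℓ) a

end

end FixedLag

open FixedLag

/-!
The error splits into one term for each summand `s_i(X_i, X_{i+1})` of the additive functional, and
each of these into three parts. With `m = (i + Δ) ∧ n`, the estimator of the `i`-th term is an
average over the resampled paths at time `m`; given the particles, its mean is the weighted particle
mean, which approximates the smoothed value given `Y_{0:m}`, which in turn approximates the smoothed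
value given `Y_{0:n}`.

*The lag.* Given `Y_{0:k}`, the hidden chain run backwards in time from `X_k` is a Markov chain whose
kernels all dominate `σ_- / σ_+` times a common probability measure, so that the conditional mean of
`s_i` given `X_k` has a range that contracts by `ρ = 1 - σ_- / σ_+` per step. The law of `X_m` given
`Y_{0:m}` and its law given `Y_{0:n}` share a component of mass `1 - ρ`, and together this gives
`2 ρ ^ Δ ‖s_i‖` (`StrongMixing.abs_tiltedMean_edge_sub_le`).

*The particles.* For fixed observations the particle paths at time `k + 1` are independent draws from
a mixture over the particles at time `k`. The weighted particle mean at time `k + 1` is therefore a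
self-normalized importance sampling estimator, and its target is the weighted particle mean at time
`k` of a backward conditional mean, where the weights are multiplied by the likelihood `β` of the
future. Iterating (`StrongMixing.eLpNorm_particleMean_sub_le`,
`StrongMixing.abs_integral_particleMean_sub_le`), the total error is a sum of one-step errors. The
one at time `l` concerns a function whose range is at most `ρ ^ (i - l) * 2 ‖s_i‖`, since for `l < i`
the conditional means of `s_i` given the present contract as well. A one-step error is of order
`N ^ (-1/2)` in `L^p`, and its bias is of order `1 / N` because the first order term of the ratio is
centred (`RatioEstimator.eLpNorm_sub_le`, `RatioEstimator.abs_integral_sub_le`); both are controlled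
by the ratio of the maximal weight to the mean weight, at most
`‖W_l‖ / (μ g(Y_l) σ_- (1 - ρ))` for `l ≥ 1`, with `(dν/dμ)_-` in place of `σ_-` for `l = 0`. Summing
the powers of `ρ` over `l ≤ i` gives `1 / (1 - ρ)`, and there are at most `Δ` times `l` in `(i, m]`.

*The resampling.* This part has mean zero given the particles, and is of order `N ^ (-1/2)`.

These bounds hold for fixed observations. Since the data model does not use the particles, the
particle system at time `m ≤ n` has, given `Y_{0:n}`, the law of the particle filter run with these
observations (`map_observations_system`). The bounds are integrated with respect to the law of the
observations, by Minkowski's inequality in the case of the `L^p` norm.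
-/

namespace FixedLag

open scoped Nat

/-! ### Empirical means of independent bounded variables -/

/-- The constant in the moment bound for empirical means of independent bounded centred
variables. -/
noncomputable def momentConst (p : ℕ) : ℝ := 2 * Real.exp 1 * p !

lemma one_le_momentConst (p : ℕ) : 1 ≤ momentConst p := by
  unfold momentConst
  have h1 : (1 : ℝ) ≤ Real.exp 1 := Real.one_le_exp (by norm_num)
  have h2 : (1 : ℝ) ≤ (p ! : ℝ) := by exact_mod_cast Nat.succ_le_of_lt (Nat.factorial_pos p)
  nlinarith

lemma eLpNorm_natCast_eq {α : Type*} [MeasurableSpace α] {m : Measure α} (f : α → ℝ) {p : ℕ}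
    (hp : p ≠ 0) : eLpNorm f p m = (∫⁻ x, ‖f x‖ₑ ^ p ∂m) ^ (1 / (p : ℝ)) := by
  rw [eLpNorm_eq_lintegral_rpow_enorm_toReal (by exact_mod_cast hp) (by simp)]
  simp

section Empirical

variable {E : Type*} [MeasurableSpace E] {π : Measure E} [IsProbabilityMeasure π]
  {N : ℕ} [NeZero N]

/-- A Khintchine-type inequality: by Hoeffding's lemma the normalized sum is sub-Gaussian with
parameter `1`, so that all its moments are bounded by universal constants. -/
lemma eLpNorm_average_le {h : E → ℝ} (hm : Measurable h) {c : ℝ} (hc : 0 ≤ c)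
    (hb : ∀ x, |h x| ≤ c) (h0 : ∫ x, h x ∂π = 0) {p : ℕ} (hp : p ≠ 0) :
    eLpNorm (fun x : Fin N → E => (N : ℝ)⁻¹ * ∑ j, h (x j)) p (Measure.pi fun _ => π) ≤
      ENNReal.ofReal (momentConst p * c / √N) := by
  rcases hc.eq_or_lt with rfl | hc
  · have : h = 0 := by ext x; simpa using hb x
    simp [this]
  have hN : (0 : ℝ) < N := by exact_mod_cast Nat.pos_of_ne_zero (NeZero.ne N)
  set P : Measure (Fin N → E) := Measure.pi fun _ => π with hP
  have hsub : HasSubgaussianMGF h (c.toNNReal ^ 2) π := by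
    have := hasSubgaussianMGF_of_mem_Icc_of_integral_eq_zero (μ := π) (X := h) (a := -c) (b := c)
      hm.aemeasurable (ae_of_all _ fun x => abs_le.1 (hb x)) h0
    convert this using 1
    ext
    simp only [NNReal.coe_pow, NNReal.coe_div, coe_nnnorm, Real.norm_eq_abs,
      NNReal.coe_ofNat, Real.coe_toNNReal _ hc.le]
    rw [show c - -c = 2 * c by ring, abs_of_pos (by positivity)]
    ring
  have hind : iIndepFun (fun (j : Fin N) (x : Fin N → E) => h (x j)) P :=
    iIndepFun_pi fun _ => hm.aemeasurable
  have hj (j : Fin N) : HasSubgaussianMGF (fun x : Fin N → E => h (x j)) (c.toNNReal ^ 2) P := by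
    refine HasSubgaussianMGF.of_map (Y := fun x : Fin N → E => x j) (X := h)
      (measurable_pi_apply j).aemeasurable ?_
    rwa [(measurePreserving_eval (fun _ : Fin N => π) j).map_eq]
  have hsum := HasSubgaussianMGF.sum_of_iIndepFun hind (s := Finset.univ) fun j _ => hj j
  set S : (Fin N → E) → ℝ := fun x => ∑ j, h (x j) with hS
  have hSm : Measurable S := by fun_prop
  have hsN : 0 < √(N : ℝ) := Real.sqrt_pos.2 hN
  -- With this `t` the sub-Gaussian bound for `exp (±t S)` does not depend on `N` and `c`.
  set t : ℝ := 1 / (c * √N) with ht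
  have htpos : 0 < t := by positivity
  have hmgf (u : ℝ) (hu : u ^ 2 = t ^ 2) : ∫⁻ x, ENNReal.ofReal (Real.exp (u * S x)) ∂P ≤
      ENNReal.ofReal (Real.exp 1) := by
    rw [← ofReal_integral_eq_lintegral_ofReal (hsum.integrable_exp_mul u)
      (ae_of_all _ fun _ => (Real.exp_pos _).le)]
    refine ENNReal.ofReal_le_ofReal ((hsum.mgf_le u).trans (Real.exp_le_exp.2 ?_))
    rw [hu, ht]
    simp only [Finset.sum_const, Finset.card_univ, Fintype.card_fin, nsmul_eq_mul,
      NNReal.coe_mul, NNReal.coe_natCast, NNReal.coe_pow, Real.coe_toNNReal _ hc.le]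
    rw [div_pow, mul_pow, Real.sq_sqrt hN.le]
    field_simp
    norm_num
  have hmom : ∫⁻ x, ‖t * S x‖ₑ ^ p ∂P ≤ ENNReal.ofReal (momentConst p) := by
    calc ∫⁻ x, ‖t * S x‖ₑ ^ p ∂P
        ≤ ∫⁻ x, ENNReal.ofReal (p !) * (ENNReal.ofReal (Real.exp (t * S x)) +
            ENNReal.ofReal (Real.exp (-t * S x))) ∂P := by
          refine lintegral_mono fun x => ?_
          rw [Real.enorm_eq_ofReal_abs, ← ENNReal.ofReal_pow (abs_nonneg _),
            ← ENNReal.ofReal_add (Real.exp_pos _).le (Real.exp_pos _).le,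
            ← ENNReal.ofReal_mul (by positivity)]
          refine ENNReal.ofReal_le_ofReal ?_
          have h1 := Real.pow_div_factorial_le_exp _ (abs_nonneg (t * S x)) p
          have h2 : Real.exp |t * S x| ≤ Real.exp (t * S x) + Real.exp (-t * S x) := by
            rw [neg_mul]
            exact Real.exp_abs_le _
          rw [div_le_iff₀ (by positivity)] at h1
          calc _ ≤ Real.exp |t * S x| * p ! := h1
            _ ≤ _ := by rw [mul_comm]; gcongr
      _ = ENNReal.ofReal (p !) * (∫⁻ x, ENNReal.ofReal (Real.exp (t * S x)) ∂P +
            ∫⁻ x, ENNReal.ofReal (Real.exp (-t * S x)) ∂P) := by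
          rw [lintegral_const_mul _ (by fun_prop), lintegral_add_left (by fun_prop)]
      _ ≤ ENNReal.ofReal (p !) * (ENNReal.ofReal (Real.exp 1) + ENNReal.ofReal (Real.exp 1)) := by
          gcongr
          · exact hmgf t rfl
          · exact hmgf (-t) (by ring)
      _ = ENNReal.ofReal (momentConst p) := by
          rw [← ENNReal.ofReal_add (by positivity) (by positivity),
            ← ENNReal.ofReal_mul (by positivity)]
          congr 1
          unfold momentConst
          ring
  have h1 : (fun x : Fin N → E => (N : ℝ)⁻¹ * ∑ j, h (x j)) =
      (c / √N) • fun x => t * S x := by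
    ext x
    simp only [Pi.smul_apply, smul_eq_mul, ht, hS]
    have : (√(N : ℝ)) ^ 2 = N := Real.sq_sqrt hN.le
    field_simp
    rw [this, mul_comm]
  rw [h1, eLpNorm_const_smul, eLpNorm_natCast_eq _ hp, Real.enorm_eq_ofReal (by positivity)]
  have h2 : (∫⁻ x, ‖t * S x‖ₑ ^ p ∂P) ^ (1 / (p : ℝ)) ≤ ENNReal.ofReal (momentConst p) := by
    refine (ENNReal.rpow_le_rpow hmom (by positivity)).trans ?_
    refine (ENNReal.rpow_le_rpow_of_exponent_le (y := 1 / (p : ℝ)) (z := 1)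
      (ENNReal.one_le_ofReal.2 (one_le_momentConst p)) ?_).trans (ENNReal.rpow_one _).le
    · rw [div_le_one (by positivity)]
      exact_mod_cast Nat.one_le_iff_ne_zero.2 hp
  calc _ ≤ ENNReal.ofReal (c / √N) * ENNReal.ofReal (momentConst p) := by gcongr
    _ = _ := by
      rw [← ENNReal.ofReal_mul (by positivity)]
      congr 1
      ring

lemma integrable_of_bdd {α : Type*} [MeasurableSpace α] {m : Measure α} [IsFiniteMeasure m]
    {f : α → ℝ} (hf : Measurable f) {c : ℝ} (hc : ∀ x, |f x| ≤ c) : Integrable f m :=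
  Integrable.of_bound hf.aestronglyMeasurable c (ae_of_all _ hc)

lemma integral_pi_average {h : E → ℝ} (hi : Integrable h π) :
    ∫ x, (N : ℝ)⁻¹ * ∑ j, h (x j) ∂(Measure.pi fun _ : Fin N => π) = ∫ x, h x ∂π := by
  have hj (j : Fin N) : ∫ x, h (x j) ∂(Measure.pi fun _ : Fin N => π) = ∫ x, h x ∂π :=
    integral_comp_eval (μ := fun _ : Fin N => π) (i := j) hi.aestronglyMeasurable
  rw [integral_const_mul, integral_finsetSum]
  · simp only [hj, Finset.sum_const, Finset.card_univ, Fintype.card_fin, nsmul_eq_mul]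
    rw [← mul_assoc, inv_mul_cancel₀ (by exact_mod_cast NeZero.ne N), one_mul]
  · exact fun j _ => integrable_comp_eval (μ := fun _ : Fin N => π) (i := j) hi

lemma integral_sq_average_le {h : E → ℝ} (hm : Measurable h) {c : ℝ} (hc : 0 ≤ c)
    (hb : ∀ x, |h x| ≤ c) (h0 : ∫ x, h x ∂π = 0) :
    ∫ x, ((N : ℝ)⁻¹ * ∑ j, h (x j)) ^ 2 ∂(Measure.pi fun _ : Fin N => π) ≤
      momentConst 2 ^ 2 * c ^ 2 / N := by
  have hN : (0 : ℝ) < N := by exact_mod_cast Nat.pos_of_ne_zero (NeZero.ne N)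
  have h1 := eLpNorm_average_le (N := N) hm hc hb h0 (p := 2) two_ne_zero
  have hK := one_le_momentConst 2
  rw [eLpNorm_natCast_eq _ two_ne_zero] at h1
  have h2 := ENNReal.rpow_le_rpow h1 (z := 2) (by norm_num)
  rw [← ENNReal.rpow_mul, ENNReal.ofReal_rpow_of_nonneg (by positivity) (by norm_num)] at h2
  rw [show (1 / ((2 : ℕ) : ℝ) * 2 = 1) by norm_num, ENNReal.rpow_one, Real.rpow_two] at h2
  rw [integral_eq_lintegral_of_nonneg_ae (ae_of_all _ fun _ => by positivity)
    (Measurable.aestronglyMeasurable (by fun_prop))]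
  refine ENNReal.toReal_le_of_le_ofReal (by positivity) ?_
  refine le_trans (le_of_eq (lintegral_congr fun x => ?_)) (h2.trans (le_of_eq ?_))
  · rw [← enorm_pow, Real.enorm_eq_ofReal (by positivity)]
  · rw [div_pow, Real.sq_sqrt hN.le, mul_pow]

end Empirical

/-! ### Weighted means and the Doeblin contraction -/

section WeightedMean

variable {E : Type*} [MeasurableSpace E] {m : Measure E} {w v : E → ℝ} {lo δ : ℝ}

lemma integrable_mul_of_mem_Icc (hw : Integrable w m) (hv : Measurable v) {lo hi : ℝ}
    (hvm : ∀ x, v x ∈ Set.Icc lo hi) : Integrable (fun x => w x * v x) m :=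
  hw.mul_bdd (c := max |lo| |hi|) hv.aestronglyMeasurable
    (ae_of_all _ fun x => abs_le_max_abs_abs (hvm x).1 (hvm x).2)

lemma weighted_mean_mem_Icc (hw : Integrable w m) (hw0 : ∀ x, 0 ≤ w x) (hpos : 0 < ∫ x, w x ∂m)
    (hv : Measurable v) {lo hi : ℝ} (hvm : ∀ x, v x ∈ Set.Icc lo hi) :
    (∫ x, w x * v x ∂m) / (∫ x, w x ∂m) ∈ Set.Icc lo hi := by
  have hi1 := integrable_mul_of_mem_Icc hw hv hvm
  constructor
  · rw [le_div_iff₀ hpos, ← integral_const_mul]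
    refine integral_mono (hw.const_mul _) hi1 fun x => ?_
    simpa [mul_comm] using mul_le_mul_of_nonneg_left (hvm x).1 (hw0 x)
  · rw [div_le_iff₀ hpos, ← integral_const_mul]
    refine integral_mono hi1 (hw.const_mul _) fun x => ?_
    simpa [mul_comm] using mul_le_mul_of_nonneg_left (hvm x).2 (hw0 x)

/-- Doeblin contraction: the means of `v` under weights which are all comparable with the same
function `h` lie in an interval that is shorter than the range of `v` by the factor
`1 - σm / σp`. -/
lemma exists_weighted_mean_mem_Icc {h : E → ℝ} (hh : Integrable h m) (hh0 : ∀ x, 0 ≤ h x)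
    (hpos : 0 < ∫ x, h x ∂m) (hv : Measurable v) (hvm : ∀ x, v x ∈ Set.Icc lo (lo + δ))
    {σm σp : ℝ} (hσm : 0 < σm) (hσp : 0 < σp) :
    ∃ lo', ∀ w : E → ℝ, Measurable w → (∀ x, σm * h x ≤ w x ∧ w x ≤ σp * h x) →
      (∫ x, w x * v x ∂m) / (∫ x, w x ∂m) ∈ Set.Icc lo' (lo' + (1 - σm / σp) * δ) := by
  set H := ∫ x, h x ∂m with hH
  set A := ∫ x, h x * v x ∂m with hA
  -- The mean under `h / H` enters every weighted mean with mass at least `σm / σp`.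
  refine ⟨lo + σm / σp * (A / H - lo), fun w hw hwb => ?_⟩
  have hw0 (x : E) : 0 ≤ w x := (mul_nonneg hσm.le (hh0 x)).trans (hwb x).1
  have hwi : Integrable w m := (hh.const_mul σp).mono' hw.aestronglyMeasurable
    (ae_of_all _ fun x => by rw [Real.norm_of_nonneg (hw0 x)]; exact (hwb x).2)
  have hwv := integrable_mul_of_mem_Icc hwi hv hvm
  have hhv := integrable_mul_of_mem_Icc hh hv hvm
  set W := ∫ x, w x ∂m with hW
  set C := ∫ x, w x * v x ∂m with hC
  have hWpos : 0 < W := by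
    refine lt_of_lt_of_le (mul_pos hσm hpos) ?_
    rw [hH, ← integral_const_mul]
    exact integral_mono (hh.const_mul _) hwi fun x => (hwb x).1
  have hWle : W ≤ σp * H := by
    rw [hH, ← integral_const_mul]
    exact integral_mono hwi (hh.const_mul _) fun x => (hwb x).2
  have h1 : σm * (A - lo * H) ≤ C - lo * W := by
    have e1 : σm * (A - lo * H) = ∫ x, σm * (h x * v x - lo * h x) ∂m := by
      rw [integral_const_mul, integral_sub hhv (hh.const_mul _), integral_const_mul]
    have e2 : C - lo * W = ∫ x, (w x * v x - lo * w x) ∂m := by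
      rw [integral_sub hwv (hwi.const_mul _), integral_const_mul]
    rw [e1, e2]
    refine integral_mono ((hhv.sub (hh.const_mul _)).const_mul _) (hwv.sub (hwi.const_mul _))
      fun x => ?_
    have := mul_le_mul_of_nonneg_right (hwb x).1 (sub_nonneg.2 (hvm x).1)
    simp only
    linarith
  have h2 : σm * ((lo + δ) * H - A) ≤ (lo + δ) * W - C := by
    have e1 : σm * ((lo + δ) * H - A) = ∫ x, σm * ((lo + δ) * h x - h x * v x) ∂m := by
      rw [integral_const_mul, integral_sub (hh.const_mul _) hhv, integral_const_mul]
    have e2 : (lo + δ) * W - C = ∫ x, ((lo + δ) * w x - w x * v x) ∂m := by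
      rw [integral_sub (hwi.const_mul _) hwv, integral_const_mul]
    rw [e1, e2]
    refine integral_mono (((hh.const_mul _).sub hhv).const_mul _) ((hwi.const_mul _).sub hwv)
      fun x => ?_
    have := mul_le_mul_of_nonneg_right (hwb x).1 (sub_nonneg.2 (hvm x).2)
    simp only
    linarith
  have hAm := weighted_mean_mem_Icc hh hh0 hpos hv hvm
  rw [← hA, ← hH] at hAm
  have hAlo : 0 ≤ A / H - lo := sub_nonneg.2 hAm.1
  have hAhi : 0 ≤ lo + δ - A / H := sub_nonneg.2 hAm.2
  have hAH : A = A / H * H := (div_mul_cancel₀ _ hpos.ne').symm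
  set a := A / H with ha
  have hbase (t : ℝ) (ht : 0 ≤ t) : σm / σp * t * W ≤ σm * (t * H) := by
    have : σm / σp * t * W ≤ σm / σp * t * (σp * H) := by gcongr
    refine this.trans (le_of_eq ?_)
    field_simp
  have b1 := hbase _ hAlo
  have b2 := hbase _ hAhi
  constructor
  · rw [le_div_iff₀ hWpos]
    rw [hAH] at h1
    linarith
  · rw [div_le_iff₀ hWpos]
    rw [hAH] at h2
    linarith

end WeightedMean

/-! ### Self-normalized importance sampling -/

section Ratio

variable {E : Type*} [MeasurableSpace E] {π : Measure E} {N : ℕ}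

/-- The data of a self-normalized importance sampling estimator `T` of the mean of `r` under the
density proportional to `w`. The identity `mean` determines `T` only where not all weights vanish;
the values of `r` and of `T` lie in an interval of length `δ`. -/
structure RatioEstimator (π : Measure E) (N : ℕ) (w r : E → ℝ) (T : (Fin N → E) → ℝ)
    (lo δ M : ℝ) : Prop where
  measurable_w : Measurable w
  measurable_r : Measurable r
  measurable_T : Measurable T
  nonneg : ∀ x, 0 ≤ w x
  le : ∀ x, w x ≤ M
  pos : 0 < ∫ x, w x ∂π
  mem_r : ∀ x, r x ∈ Set.Icc lo (lo + δ)
  mem_T : ∀ x, T x ∈ Set.Icc lo (lo + δ)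
  mean : ∀ x, T x * ∑ j, w (x j) = ∑ j, w (x j) * r (x j)

namespace RatioEstimator

variable {w r : E → ℝ} {T : (Fin N → E) → ℝ} {lo δ M c : ℝ}

section

variable (h : RatioEstimator π N w r T lo δ M) (hc : ∫ x, w x * r x ∂π = c * ∫ x, w x ∂π)

include h

lemma measurable_den (b : ℝ) : Measurable fun x => w x - b := h.measurable_w.sub_const b

lemma measurable_num (c : ℝ) : Measurable fun x => w x * (r x - c) :=
  h.measurable_w.mul (h.measurable_r.sub_const c)

variable [IsProbabilityMeasure π]

lemma integrable_w : Integrable w π :=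
  integrable_of_bdd h.measurable_w (c := M) fun x => by
    rw [abs_of_nonneg (h.nonneg x)]; exact h.le x

lemma nonneg_δ : 0 ≤ δ := by
  obtain ⟨x⟩ : Nonempty E := nonempty_of_isProbabilityMeasure π
  have := (h.mem_r x)
  linarith [this.1, this.2]

lemma nonneg_M : 0 ≤ M := by
  obtain ⟨x⟩ : Nonempty E := nonempty_of_isProbabilityMeasure π
  exact (h.nonneg x).trans (h.le x)

include hc

lemma mem_c : c ∈ Set.Icc lo (lo + δ) := by
  have := weighted_mean_mem_Icc h.integrable_w h.nonneg h.pos h.measurable_r h.mem_r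
  rwa [hc, mul_div_cancel_right₀ _ h.pos.ne'] at this

lemma abs_T_sub_le (x : Fin N → E) : |T x - c| ≤ δ := by
  have h1 := h.mem_T x
  have h2 := h.mem_c hc
  rw [abs_le]
  constructor <;> linarith [h1.1, h1.2, h2.1, h2.2]

lemma abs_num_le (x : E) : |w x * (r x - c)| ≤ M * δ := by
  have h1 := h.mem_r x
  have h2 := h.mem_c hc
  rw [abs_mul, abs_of_nonneg (h.nonneg x)]
  refine mul_le_mul (h.le x) ?_ (abs_nonneg _) h.nonneg_M
  rw [abs_le]
  constructor <;> linarith [h1.1, h1.2, h2.1, h2.2]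

lemma integral_num : ∫ x, w x * (r x - c) ∂π = 0 := by
  have h1 := integrable_mul_of_mem_Icc h.integrable_w h.measurable_r h.mem_r
  have : (fun x => w x * (r x - c)) = fun x => w x * r x - c * w x := by ext x; ring
  rw [this, integral_sub h1 (h.integrable_w.const_mul _), integral_const_mul, hc, sub_self]

omit hc

lemma abs_den_le (x : E) : |w x - ∫ x, w x ∂π| ≤ M := by
  have h1 : 0 ≤ ∫ x, w x ∂π := h.pos.le
  have h2 : ∫ x, w x ∂π ≤ M := by
    have := integral_mono h.integrable_w (integrable_const M) h.le
    simpa using this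
  rw [abs_le]
  constructor <;> linarith [h.nonneg x, h.le x]

lemma integral_den : ∫ x, (w x - ∫ x, w x ∂π) ∂π = 0 := by
  rw [integral_sub h.integrable_w (integrable_const _)]
  simp

end

/-- The error times the mean weight, expressed through the centred numerator `D` and the centred
denominator `U`. It holds also where all weights vanish: there `D = 0` and `U = -∫ w`. -/
lemma sub_mul_eq [NeZero N] (h : RatioEstimator π N w r T lo δ M) (x : Fin N → E) :
    (T x - c) * ∫ x, w x ∂π =
      (N : ℝ)⁻¹ * ∑ j, w (x j) * (r (x j) - c) -
        (T x - c) * ((N : ℝ)⁻¹ * ∑ j, (w (x j) - ∫ x, w x ∂π)) := by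
  have hN : (N : ℝ) ≠ 0 := by exact_mod_cast NeZero.ne N
  have h1 : ∑ j, w (x j) * (r (x j) - c) = (T x - c) * ∑ j, w (x j) := by
    simp_rw [mul_sub, Finset.sum_sub_distrib]
    rw [← h.mean x, ← Finset.sum_mul]
    ring
  rw [h1]
  simp only [Finset.sum_sub_distrib, Finset.sum_const, Finset.card_univ, Fintype.card_fin,
    nsmul_eq_mul]
  field_simp
  ring

variable [IsProbabilityMeasure π] [NeZero N]

lemma eLpNorm_sub_le (h : RatioEstimator π N w r T lo δ M)
    (hc : ∫ x, w x * r x ∂π = c * ∫ x, w x ∂π) {p : ℕ} (hp : p ≠ 0) :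
    eLpNorm (fun x => T x - c) p (Measure.pi fun _ : Fin N => π) ≤
      ENNReal.ofReal (2 * momentConst p * (δ * (M / ∫ x, w x ∂π)) / √N) := by
  set b := ∫ x, w x ∂π with hb
  have hbpos : 0 < b := h.pos
  have hδ := h.nonneg_δ
  have hM := h.nonneg_M
  have hK : 0 ≤ momentConst p := zero_le_one.trans (one_le_momentConst p)
  set D : (Fin N → E) → ℝ := fun x => (N : ℝ)⁻¹ * ∑ j, w (x j) * (r (x j) - c) with hD
  set U : (Fin N → E) → ℝ := fun x => (N : ℝ)⁻¹ * ∑ j, (w (x j) - b) with hU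
  have hDm : Measurable D := by
    have := h.measurable_num c
    exact (Finset.measurable_sum _ fun j _ => this.comp (measurable_pi_apply j)).const_mul _
  have hUm : Measurable U := by
    have := h.measurable_den b
    exact (Finset.measurable_sum _ fun j _ => this.comp (measurable_pi_apply j)).const_mul _
  have e1 := eLpNorm_average_le (N := N) (h.measurable_num c) (by positivity)
    (h.abs_num_le hc) (h.integral_num hc) hp
  have e2 := eLpNorm_average_le (N := N) (h.measurable_den b) hM h.abs_den_le
    h.integral_den hp
  have h1 : eLpNorm (fun x => T x - c) p (Measure.pi fun _ : Fin N => π) ≤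
      eLpNorm ((fun x => b⁻¹ * ‖D x‖) + fun x => b⁻¹ * δ * ‖U x‖) p
        (Measure.pi fun _ : Fin N => π) := by
    refine eLpNorm_mono_real fun x => ?_
    have h2 := h.sub_mul_eq (c := c) x
    rw [← hb] at h2
    have h3 : T x - c = b⁻¹ * (D x - (T x - c) * U x) := by
      rw [← h2]; field_simp
    calc ‖T x - c‖ = b⁻¹ * ‖D x - (T x - c) * U x‖ := by
          rw [h3, norm_mul, Real.norm_of_nonneg (by positivity : 0 ≤ b⁻¹), ← h3]
      _ ≤ b⁻¹ * (‖D x‖ + ‖(T x - c) * U x‖) := by gcongr; exact norm_sub_le _ _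
      _ ≤ b⁻¹ * (‖D x‖ + δ * ‖U x‖) := by
          rw [norm_mul (T x - c) (U x)]
          have := h.abs_T_sub_le hc x
          rw [← Real.norm_eq_abs] at this
          gcongr
      _ = _ := by simp only [Pi.add_apply]; ring
  refine h1.trans ((eLpNorm_add_le (by fun_prop) (by fun_prop)
    (by exact_mod_cast Nat.one_le_iff_ne_zero.2 hp)).trans ?_)
  have f1 : eLpNorm (fun x => b⁻¹ * ‖D x‖) p (Measure.pi fun _ : Fin N => π) ≤
      ENNReal.ofReal b⁻¹ * ENNReal.ofReal (momentConst p * (M * δ) / √N) := by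
    have := eLpNorm_const_smul b⁻¹ (fun x => ‖D x‖) p (Measure.pi fun _ : Fin N => π)
    rw [eLpNorm_norm, Real.enorm_eq_ofReal (by positivity)] at this
    exact this.le.trans (by gcongr)
  have f2 : eLpNorm (fun x => b⁻¹ * δ * ‖U x‖) p (Measure.pi fun _ : Fin N => π) ≤
      ENNReal.ofReal (b⁻¹ * δ) * ENNReal.ofReal (momentConst p * M / √N) := by
    have := eLpNorm_const_smul (b⁻¹ * δ) (fun x => ‖U x‖) p (Measure.pi fun _ : Fin N => π)
    rw [eLpNorm_norm, Real.enorm_eq_ofReal (by positivity)] at this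
    exact this.le.trans (by gcongr)
  refine (add_le_add f1 f2).trans ?_
  rw [← ENNReal.ofReal_mul (by positivity), ← ENNReal.ofReal_mul (by positivity),
    ← ENNReal.ofReal_add (by positivity) (by positivity)]
  refine ENNReal.ofReal_le_ofReal (le_of_eq ?_)
  field_simp
  ring

/-- The bias is of the order `1 / N`, since the first order term of the error is centred. -/
lemma abs_integral_sub_le (h : RatioEstimator π N w r T lo δ M)
    (hc : ∫ x, w x * r x ∂π = c * ∫ x, w x ∂π) :
    |∫ x, (T x - c) ∂(Measure.pi fun _ : Fin N => π)| ≤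
      3 * momentConst 2 ^ 2 * (δ * (M / ∫ x, w x ∂π) ^ 2) / N := by
  set b := ∫ x, w x ∂π with hb
  have hN : (0 : ℝ) < N := by exact_mod_cast Nat.pos_of_ne_zero (NeZero.ne N)
  have hbpos : 0 < b := h.pos
  have hδ := h.nonneg_δ
  have hM := h.nonneg_M
  set D : (Fin N → E) → ℝ := fun x => (N : ℝ)⁻¹ * ∑ j, w (x j) * (r (x j) - c) with hD
  set U : (Fin N → E) → ℝ := fun x => (N : ℝ)⁻¹ * ∑ j, (w (x j) - b) with hU
  have hDm : Measurable D := by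
    have := h.measurable_num c
    exact (Finset.measurable_sum _ fun j _ => this.comp (measurable_pi_apply j)).const_mul _
  have hUm : Measurable U := by
    have := h.measurable_den b
    exact (Finset.measurable_sum _ fun j _ => this.comp (measurable_pi_apply j)).const_mul _
  have havg (f : E → ℝ) (C : ℝ) (hf : ∀ x, |f x| ≤ C) (x : Fin N → E) :
      |(N : ℝ)⁻¹ * ∑ j, f (x j)| ≤ C := by
    rw [abs_mul, abs_of_pos (by positivity)]
    have : |∑ j, f (x j)| ≤ N * C := by
      refine (Finset.abs_sum_le_sum_abs _ _).trans ?_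
      refine (Finset.sum_le_sum fun j _ => hf (x j)).trans ?_
      simp
    calc (N : ℝ)⁻¹ * |∑ j, f (x j)| ≤ (N : ℝ)⁻¹ * (N * C) := by gcongr
      _ = C := by field_simp
  have hDb : ∀ x, |D x| ≤ M * δ := havg _ _ (h.abs_num_le hc)
  have hUb : ∀ x, |U x| ≤ M := havg _ _ h.abs_den_le
  have v1 := integral_sq_average_le (N := N) (h.measurable_num c) (by positivity)
    (h.abs_num_le hc) (h.integral_num hc)
  have v2 := integral_sq_average_le (N := N) (h.measurable_den b) hM h.abs_den_le
    h.integral_den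
  have m1 : ∫ x, D x ∂(Measure.pi fun _ : Fin N => π) = 0 := by
    exact (integral_pi_average (integrable_of_bdd (h.measurable_num c) (h.abs_num_le hc))).trans
      (h.integral_num hc)
  have hTm : Measurable fun x => T x - c := h.measurable_T.sub_const c
  have hTb : ∀ x, |T x - c| ≤ δ := h.abs_T_sub_le hc
  have iD : Integrable D (Measure.pi fun _ : Fin N => π) := integrable_of_bdd hDm hDb
  have iDU : Integrable (fun x => D x * U x) (Measure.pi fun _ : Fin N => π) :=
    integrable_of_bdd (c := M * δ * M) (hDm.mul hUm) fun x => by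
      rw [abs_mul]; exact mul_le_mul (hDb x) (hUb x) (abs_nonneg _) (by positivity)
  have iU2 : Integrable (fun x => U x ^ 2) (Measure.pi fun _ : Fin N => π) :=
    integrable_of_bdd (c := M ^ 2) (hUm.pow_const 2) fun x => by
      rw [abs_pow]; exact pow_le_pow_left₀ (abs_nonneg _) (hUb x) 2
  have iD2 : Integrable (fun x => D x ^ 2) (Measure.pi fun _ : Fin N => π) :=
    integrable_of_bdd (c := (M * δ) ^ 2) (hDm.pow_const 2) fun x => by
      rw [abs_pow]; exact pow_le_pow_left₀ (abs_nonneg _) (hDb x) 2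
  have iTU2 : Integrable (fun x => (T x - c) * U x ^ 2) (Measure.pi fun _ : Fin N => π) :=
    integrable_of_bdd (c := δ * M ^ 2) (hTm.mul (hUm.pow_const 2)) fun x => by
      rw [abs_mul, abs_pow]
      exact mul_le_mul (hTb x) (pow_le_pow_left₀ (abs_nonneg _) (hUb x) 2) (by positivity) hδ
  -- Iterating the identity `(T - c) b = D - (T - c) U` once leaves `D / b`, which is centred, and
  -- terms of second order.
  have key (x : Fin N → E) :
      T x - c = b⁻¹ * D x + b⁻¹ ^ 2 * ((T x - c) * U x ^ 2 - D x * U x) := by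
    have h2 := h.sub_mul_eq (c := c) x
    rw [← hb] at h2
    change (T x - c) * b = D x - (T x - c) * U x at h2
    have h3 : T x - c = b⁻¹ * (D x - (T x - c) * U x) := by
      rw [← h2]; field_simp
    calc T x - c = b⁻¹ * (D x - (b⁻¹ * (D x - (T x - c) * U x)) * U x) := by rw [← h3]; exact h3
      _ = _ := by ring
  have hint : ∫ x, (T x - c) ∂(Measure.pi fun _ : Fin N => π) =
      ∫ x, b⁻¹ ^ 2 * ((T x - c) * U x ^ 2 - D x * U x) ∂(Measure.pi fun _ : Fin N => π) := by
    have e : ∫ x, (T x - c) ∂(Measure.pi fun _ : Fin N => π) =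
        ∫ x, (b⁻¹ * D x + b⁻¹ ^ 2 * ((T x - c) * U x ^ 2 - D x * U x))
          ∂(Measure.pi fun _ : Fin N => π) := integral_congr_ae (ae_of_all _ key)
    have i : Integrable (fun x => b⁻¹ ^ 2 * ((T x - c) * U x ^ 2 - D x * U x))
        (Measure.pi fun _ : Fin N => π) := (iTU2.sub iDU).const_mul _
    rw [e, integral_add (iD.const_mul _) i, integral_const_mul, m1,
      mul_zero, zero_add]
  have hpt (x : Fin N → E) :
      |(T x - c) * U x ^ 2 - D x * U x| ≤ 2 * δ * U x ^ 2 + (if δ = 0 then 0 else δ⁻¹) * D x ^ 2 := by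
    have a1 : |(T x - c) * U x ^ 2| ≤ δ * U x ^ 2 := by
      rw [abs_mul, abs_of_nonneg (sq_nonneg (U x))]
      exact mul_le_mul_of_nonneg_right (hTb x) (sq_nonneg _)
    -- This is Young's inequality; for `δ = 0` the weight `δ⁻¹` is not needed, since then `D = 0`.
    have a2 : |D x * U x| ≤ δ * U x ^ 2 + (if δ = 0 then 0 else δ⁻¹) * D x ^ 2 := by
      split_ifs with h0
      · have : D x = 0 := by simpa [h0] using hDb x
        simp [this, h0]
      · have hδ' : 0 < δ := lt_of_le_of_ne hδ (Ne.symm h0)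
        have hs : 0 ≤ (δ * |U x| - |D x|) ^ 2 / δ := by positivity
        have e : (δ * |U x| - |D x|) ^ 2 / δ = δ * U x ^ 2 - 2 * |D x * U x| + δ⁻¹ * D x ^ 2 := by
          rw [abs_mul (D x) (U x), ← sq_abs (U x), ← sq_abs (D x)]
          generalize |U x| = u
          generalize |D x| = d
          field_simp
          ring
        have : 0 ≤ |D x * U x| := abs_nonneg _
        linarith
    calc _ ≤ |(T x - c) * U x ^ 2| + |D x * U x| := abs_sub _ _
      _ ≤ _ := by linarith
  rw [hint, integral_const_mul, abs_mul, abs_of_nonneg (by positivity)]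
  have hfin : |∫ x, ((T x - c) * U x ^ 2 - D x * U x) ∂(Measure.pi fun _ : Fin N => π)| ≤
      2 * δ * (momentConst 2 ^ 2 * M ^ 2 / N) +
        (if δ = 0 then 0 else δ⁻¹) * (momentConst 2 ^ 2 * (M * δ) ^ 2 / N) := by
    refine (abs_integral_le_integral_abs).trans ?_
    refine (integral_mono (iTU2.sub iDU).abs ((iU2.const_mul _).add (iD2.const_mul _)) hpt).trans ?_
    have e : ∫ x, (2 * δ * U x ^ 2 + (if δ = 0 then 0 else δ⁻¹) * D x ^ 2)
        ∂(Measure.pi fun _ : Fin N => π) =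
        2 * δ * ∫ x, U x ^ 2 ∂(Measure.pi fun _ : Fin N => π) +
        (if δ = 0 then 0 else δ⁻¹) * ∫ x, D x ^ 2 ∂(Measure.pi fun _ : Fin N => π) := by
      rw [integral_add (iU2.const_mul _) (iD2.const_mul _), integral_const_mul, integral_const_mul]
    refine (le_of_eq e).trans ?_
    have : 0 ≤ (if δ = 0 then 0 else δ⁻¹) := by split_ifs <;> positivity
    gcongr
  refine (mul_le_mul_of_nonneg_left hfin (by positivity)).trans ?_
  split_ifs with h0
  · simp [h0]
  · have hδ' : 0 < δ := lt_of_le_of_ne hδ (Ne.symm h0)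
    refine le_of_eq ?_
    field_simp
    ring

end RatioEstimator

end Ratio

/-! ### Unnormalized smoothing measures -/

section Smoothing

variable {Θ X 𝓨 : Type*} [MeasurableSpace X] [MeasurableSpace 𝓨]

lemma measurePreserving_snoc (m : Measure X) [SigmaFinite m] (k : ℕ) :
    MeasurePreserving (fun b : (Fin (k + 1) → X) × X => (Fin.snoc b.1 b.2 : Fin (k + 2) → X))
      ((Measure.pi fun _ => m).prod m) (Measure.pi fun _ => m) := by
  have h1 := (measurePreserving_piFinSuccAbove (fun _ : Fin (k + 2) => m) (Fin.last (k + 1))).symm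
  have h2 : MeasurePreserving (Prod.swap : (Fin (k + 1) → X) × X → X × (Fin (k + 1) → X))
      ((Measure.pi fun _ => m).prod m) (m.prod (Measure.pi fun _ => m)) :=
    Measure.measurePreserving_swap
  have e : (fun b : (Fin (k + 1) → X) × X => (Fin.snoc b.1 b.2 : Fin (k + 2) → X)) =
      (MeasurableEquiv.piFinSuccAbove (fun _ => X) (Fin.last (k + 1))).symm ∘ Prod.swap := by
    funext b
    exact (Fin.insertNth_last' b.2 b.1).symm
  rw [e]
  exact h1.comp h2

lemma measurePreserving_const_fin_one (m : Measure X) [SigmaFinite m] :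
    MeasurePreserving (fun (x : X) (_ : Fin (0 + 1)) => x) m (Measure.pi fun _ => m) :=
  (measurePreserving_funUnique m (Fin 1)).symm

variable (M : StateSpaceModel Θ X 𝓨) (θ : Θ)

lemma measurable_pathDensity (n : ℕ) :
    Measurable fun a : (Fin (n + 1) → 𝓨) × (Fin (n + 1) → X) => M.pathDensity θ n a.1 a.2 := by
  have hg (i : Fin (n + 1)) :
      Measurable fun a : (Fin (n + 1) → 𝓨) × (Fin (n + 1) → X) => M.g θ (a.2 i) (a.1 i) :=
    (M.measurable_g θ).comp (by fun_prop :
      Measurable fun a : (Fin (n + 1) → 𝓨) × (Fin (n + 1) → X) => (a.2 i, a.1 i))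
  have hq (i j : Fin (n + 1)) :
      Measurable fun a : (Fin (n + 1) → 𝓨) × (Fin (n + 1) → X) => M.q θ (a.2 i) (a.2 j) :=
    (M.measurable_q θ).comp (by fun_prop :
      Measurable fun a : (Fin (n + 1) → 𝓨) × (Fin (n + 1) → X) => (a.2 i, a.2 j))
  have hν : Measurable fun a : (Fin (n + 1) → 𝓨) × (Fin (n + 1) → X) => M.dν (a.2 0) :=
    M.dν_density.1.comp (by fun_prop)
  exact (hν.mul (hg 0)).mul (Finset.measurable_prod _ fun k _ => (hq _ _).mul (hg _))

lemma measurable_pathDensity_right (n : ℕ) (y : Fin (n + 1) → 𝓨) :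
    Measurable (M.pathDensity θ n y) :=
  (measurable_pathDensity M θ n).comp measurable_prodMk_left

variable (y : ℕ → 𝓨)

/-- The unnormalized joint smoothing distribution of `X_{0:k}` given `Y_{0:k} = y_{0:k}`. -/
noncomputable def pathMeasure (k : ℕ) : Measure (Fin (k + 1) → X) :=
  (Measure.pi fun _ => M.μ).withDensity fun x => (M.pathDensity θ k (fun i => y i) x : ℝ≥0∞)

/-- The unnormalized transition density `q(x, x') g(x', y)` of the filter. -/
noncomputable def filterDensity (y : 𝓨) (x x' : X) : ℝ≥0 := M.q θ x x' * M.g θ x' y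

lemma measurable_filterDensity (y : 𝓨) :
    Measurable fun b : X × X => filterDensity M θ y b.1 b.2 :=
  (M.measurable_q θ).mul ((M.measurable_g θ).comp (by fun_prop :
    Measurable fun b : X × X => (b.2, y)))

lemma measurable_filterDensity_last (k : ℕ) (y : 𝓨) :
    Measurable fun b : (Fin (k + 1) → X) × X => filterDensity M θ y (b.1 (Fin.last k)) b.2 :=
  (measurable_filterDensity M θ y).comp (by fun_prop :
    Measurable fun b : (Fin (k + 1) → X) × X => (b.1 (Fin.last k), b.2))

lemma pathDensity_snoc (k : ℕ) (x : Fin (k + 1) → X) (x' : X) :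
    M.pathDensity θ (k + 1) (fun i => y i) (Fin.snoc x x') =
      M.pathDensity θ k (fun i => y i) x * filterDensity M θ (y (k + 1)) (x (Fin.last k)) x' := by
  have h0 : (Fin.snoc x x' : Fin (k + 2) → X) 0 = x 0 := by
    have : (0 : Fin (k + 2)) = Fin.castSucc 0 := rfl
    rw [this, Fin.snoc_castSucc]
  have hs (i : Fin k) : (Fin.snoc x x' : Fin (k + 2) → X) i.castSucc.succ = x i.succ := by
    rw [← Fin.castSucc_succ, Fin.snoc_castSucc]
  have hc (i : Fin (k + 1)) : (Fin.snoc x x' : Fin (k + 2) → X) i.castSucc = x i :=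
    Fin.snoc_castSucc ..
  have hl : (Fin.snoc x x' : Fin (k + 2) → X) (Fin.last k).succ = x' := by
    rw [Fin.succ_last, Fin.snoc_last]
  unfold StateSpaceModel.pathDensity filterDensity
  rw [Fin.prod_univ_castSucc]
  simp only [h0, hs, hc, hl]
  simp [mul_assoc]

lemma pathMeasure_succ (k : ℕ) :
    pathMeasure M θ y (k + 1) =
      (((pathMeasure M θ y k).prod M.μ).withDensity fun b =>
        (filterDensity M θ (y (k + 1)) (b.1 (Fin.last k)) b.2 : ℝ≥0∞)).map
      (fun b : (Fin (k + 1) → X) × X => (Fin.snoc b.1 b.2 : Fin (k + 2) → X)) := by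
  have hd := measurable_pathDensity_right M θ k fun i => y i
  have hf := measurable_filterDensity_last M θ k (y (k + 1))
  ext s hs
  rw [Measure.map_apply (measurable_snoc_pair k) hs, pathMeasure, pathMeasure,
    prod_withDensity_left hd.coe_nnreal_ennreal,
    ← withDensity_mul _ (f := fun z : (Fin (k + 1) → X) × X =>
      (M.pathDensity θ k (fun i => y i) z.1 : ℝ≥0∞))
      (hd.coe_nnreal_ennreal.comp measurable_fst) hf.coe_nnreal_ennreal,
    withDensity_apply _ hs, withDensity_apply _ (measurable_snoc_pair k hs),
    ← (measurePreserving_snoc M.μ k).setLIntegral_comp_preimage hs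
      (measurable_pathDensity_right M θ (k + 1) fun i => y i).coe_nnreal_ennreal]
  simp only [pathDensity_snoc, Pi.mul_apply, ENNReal.coe_mul]

lemma integral_pathMeasure_succ (k : ℕ) {F : (Fin (k + 2) → X) → ℝ} (hF : Measurable F) :
    ∫ x, F x ∂(pathMeasure M θ y (k + 1)) =
      ∫ b, filterDensity M θ (y (k + 1)) (b.1 (Fin.last k)) b.2 * F (Fin.snoc b.1 b.2)
        ∂((pathMeasure M θ y k).prod M.μ) := by
  rw [pathMeasure_succ, integral_map (measurable_snoc_pair k).aemeasurable
    hF.aestronglyMeasurable,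
    integral_withDensity_eq_integral_smul (measurable_filterDensity_last M θ k (y (k + 1)))]
  rfl

lemma integral_pathMeasure_zero {F : (Fin (0 + 1) → X) → ℝ} (hF : Measurable F) :
    ∫ x, F x ∂(pathMeasure M θ y 0) =
      ∫ x, M.dν x * M.g θ x (y 0) * F (fun _ => x) ∂M.μ := by
  rw [pathMeasure, integral_withDensity_eq_integral_smul
    (measurable_pathDensity_right M θ 0 fun i => y i),
    ← (measurePreserving_const_fin_one M.μ).map_eq,
    integral_map (measurePreserving_const_fin_one M.μ).measurable.aemeasurable]
  · simp [StateSpaceModel.pathDensity, NNReal.smul_def]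
  · exact ((measurable_pathDensity_right M θ 0 fun i => y i).smul hF).aestronglyMeasurable

/-- The quantitative form of the strong mixing assumption for one parameter. -/
structure StrongMixing (σm σp : ℝ) : Prop where
  pos : 0 < σm
  q_mem : ∀ x x', (M.q θ x x' : ℝ) ∈ Set.Icc σm σp
  g_le : ∀ y, ∃ C : ℝ, ∀ x, (M.g θ x y : ℝ) ≤ C
  g_pos : ∀ y, 0 < ∫ x, (M.g θ x y : ℝ) ∂M.μ

variable {M θ} {σm σp : ℝ}

lemma measurable_g_right (y : 𝓨) : Measurable fun x => (M.g θ x y : ℝ) :=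
  (M.measurable_g θ).coe_nnreal_real.comp measurable_prodMk_right

variable (M θ) in
lemma integral_q (x : X) : ∫ x', (M.q θ x x' : ℝ) ∂M.μ = 1 := by
  have h1 := M.q_density θ x
  have h2 : ∫⁻ x', (M.q θ x x' : ℝ≥0∞) ∂M.μ = 1 := by
    have := measure_univ (μ := M.Q θ x)
    rwa [h1.2, withDensity_apply _ MeasurableSet.univ, Measure.restrict_univ] at this
  rw [integral_eq_lintegral_of_nonneg_ae (ae_of_all _ fun _ => NNReal.zero_le_coe)
    h1.1.coe_nnreal_real.aestronglyMeasurable]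
  simp [h2]

lemma integrable_q (x : X) : Integrable (fun x' => (M.q θ x x' : ℝ)) M.μ :=
  Integrable.of_integral_ne_zero (by rw [integral_q]; exact one_ne_zero)

namespace StrongMixing

variable (h : StrongMixing M θ σm σp)
include h

lemma integrable_g (y : 𝓨) : Integrable (fun x => (M.g θ x y : ℝ)) M.μ := by
  obtain ⟨C, hC⟩ := h.g_le y
  refine integrable_of_bdd (measurable_g_right y) (c := C) fun x => ?_
  rw [abs_of_nonneg NNReal.zero_le_coe]
  exact hC x

lemma le_one : σm ≤ 1 := by
  obtain ⟨x⟩ : Nonempty X := nonempty_of_isProbabilityMeasure M.μ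
  have := integral_mono (integrable_const σm) (integrable_q x) fun x' => (h.q_mem x x').1
  rw [integral_q M θ x] at this
  simpa using this

lemma one_le : 1 ≤ σp := by
  obtain ⟨x⟩ : Nonempty X := nonempty_of_isProbabilityMeasure M.μ
  have := integral_mono (integrable_q x) (integrable_const σp) fun x' => (h.q_mem x x').2
  rw [integral_q M θ x] at this
  simpa using this

lemma σp_pos : 0 < σp := zero_lt_one.trans_le h.one_le

lemma exists_filterDensity_le (y : 𝓨) : ∃ C : ℝ, ∀ x x', (filterDensity M θ y x x' : ℝ) ≤ C := by
  obtain ⟨C, hC⟩ := h.g_le y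
  refine ⟨σp * C, fun x x' => ?_⟩
  rw [filterDensity, NNReal.coe_mul]
  exact mul_le_mul (h.q_mem x x').2 (hC x') NNReal.zero_le_coe h.σp_pos.le

lemma isFiniteMeasure_pathMeasure (y : ℕ → 𝓨) (k : ℕ) :
    IsFiniteMeasure (pathMeasure M θ y k) := by
  induction k with
  | zero =>
    constructor
    obtain ⟨C, hC⟩ := h.g_le (y 0)
    have hν : ∫⁻ x, (M.dν x : ℝ≥0∞) ∂M.μ = 1 := by
      have := measure_univ (μ := M.ν)
      rwa [M.dν_density.2, withDensity_apply _ MeasurableSet.univ, Measure.restrict_univ] at this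
    rw [pathMeasure, withDensity_apply _ MeasurableSet.univ, Measure.restrict_univ,
      ← (measurePreserving_const_fin_one M.μ).lintegral_comp
      (measurable_pathDensity_right M θ 0 fun i => y i).coe_nnreal_ennreal]
    calc _ ≤ ∫⁻ x, ENNReal.ofReal C * (M.dν x : ℝ≥0∞) ∂M.μ := by
          refine lintegral_mono fun x => ?_
          simp only [StateSpaceModel.pathDensity, Finset.univ_eq_empty, Finset.prod_empty, mul_one,
            ENNReal.coe_mul]
          rw [mul_comm]
          gcongr
          · rw [← ENNReal.ofReal_coe_nnreal]
            exact ENNReal.ofReal_le_ofReal (hC _)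
      _ = ENNReal.ofReal C := by
          rw [lintegral_const_mul _ M.dν_density.1.coe_nnreal_ennreal, hν, mul_one]
      _ < ∞ := ENNReal.ofReal_lt_top
  | succ k ih =>
    constructor
    obtain ⟨C, hC⟩ := h.exists_filterDensity_le (y (k + 1))
    rw [pathMeasure_succ, Measure.map_apply (measurable_snoc_pair k) MeasurableSet.univ,
      Set.preimage_univ, withDensity_apply _ MeasurableSet.univ, Measure.restrict_univ]
    calc _ ≤ ∫⁻ _, ENNReal.ofReal C ∂((pathMeasure M θ y k).prod M.μ) := by
          refine lintegral_mono fun b => ?_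
          rw [← ENNReal.ofReal_coe_nnreal]
          exact ENNReal.ofReal_le_ofReal (hC _ _)
      _ < ∞ := by
          rw [lintegral_const]
          exact ENNReal.mul_lt_top ENNReal.ofReal_lt_top (measure_lt_top _ _)

end StrongMixing

end Smoothing

/-! ### The backward recursion -/

section Backward

variable {Θ X 𝓨 : Type*} [MeasurableSpace X] [MeasurableSpace 𝓨]
  (M : StateSpaceModel Θ X 𝓨) (θ : Θ)

/-- One step of the backward recursion for the likelihood of future observations. -/
noncomputable def backward (y : 𝓨) (β : X → ℝ) (x : X) : ℝ :=
  ∫ x', filterDensity M θ y x x' * β x' ∂M.μ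

/-- The conditional mean of `r(x_{0:k}, X_{k+1})` when `X_{k+1}` has the transition density
`q(x_k, ·)` tilted by the current observation density and by the likelihood `β` of the future. -/
noncomputable def backwardMean {k : ℕ} (y : 𝓨) (β : X → ℝ) (r : (Fin (k + 2) → X) → ℝ)
    (x : Fin (k + 1) → X) : ℝ :=
  (∫ x', filterDensity M θ y (x (Fin.last k)) x' * β x' * r (Fin.snoc x x') ∂M.μ) /
    backward M θ y β (x (Fin.last k))

/-- The mean of `r(X_{0:k})` under the smoothing distribution given `Y_{0:k} = y_{0:k}`, tilted by
a function `β` of the last component. -/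
noncomputable def tiltedMean (y : ℕ → 𝓨) {k : ℕ} (β : X → ℝ) (r : (Fin (k + 1) → X) → ℝ) : ℝ :=
  (∫ x, β (x (Fin.last k)) * r x ∂(pathMeasure M θ y k)) /
    ∫ x, β (x (Fin.last k)) ∂(pathMeasure M θ y k)

/-- The functions which are bounded above and below by multiples of a common constant with the
ratio of the bounds `σp / σm`; the future likelihoods are of this kind. -/
structure Comparable (σm σp : ℝ) (β : X → ℝ) : Prop where
  measurable : Measurable β
  exists_mem : ∃ c > 0, ∀ x, β x ∈ Set.Icc (σm * c) (σp * c)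

/-- `r(x_{0:k})` depends on `x_k` and on the components `x_l` with `i ≤ l` only. -/
def DependsFrom {k : ℕ} (i : ℕ) (r : (Fin (k + 1) → X) → ℝ) : Prop :=
  ∀ x x' : Fin (k + 1) → X, (∀ l, i ≤ l.val ∨ l = Fin.last k → x l = x' l) → r x = r x'

omit [MeasurableSpace X] in
lemma DependsFrom.apply_snoc_eq {k i : ℕ} (hk : k < i) {r : (Fin (k + 2) → X) → ℝ}
    (hr : DependsFrom i r) (x₁ x₂ : Fin (k + 1) → X) (x' : X) :
    r (Fin.snoc x₁ x') = r (Fin.snoc x₂ x') := by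
  refine hr _ _ fun l hl => ?_
  have : l = Fin.last (k + 1) := by
    rcases hl with hl | hl
    · ext; simp only [Fin.val_last]; omega
    · exact hl
  subst this
  simp

variable {M θ} {σm σp : ℝ}

lemma Comparable.pos (hσ : 0 < σm) {β : X → ℝ} (hβ : Comparable σm σp β) (x : X) : 0 < β x := by
  obtain ⟨c, hc, h⟩ := hβ.exists_mem
  exact (mul_pos hσ hc).trans_le (h x).1

lemma Comparable.integrable {α : Type*} [MeasurableSpace α] {m : Measure α} [IsFiniteMeasure m]
    (hσ : 0 < σm) {β : X → ℝ} (hβ : Comparable σm σp β) {e : α → X} (he : Measurable e) :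
    Integrable (fun a => β (e a)) m := by
  obtain ⟨c, _, h⟩ := hβ.exists_mem
  refine integrable_of_bdd (hβ.measurable.comp he) (c := σp * c) fun a => ?_
  rw [abs_of_pos (hβ.pos hσ _)]
  exact (h _).2

lemma measurable_snoc_right {k : ℕ} (x : Fin (k + 1) → X) :
    Measurable fun x' : X => (Fin.snoc x x' : Fin (k + 2) → X) :=
  (measurable_snoc_pair k).comp measurable_prodMk_left

lemma measurable_filterDensity_right (y : 𝓨) (x : X) :
    Measurable fun x' => (filterDensity M θ y x x' : ℝ) :=
  ((measurable_filterDensity M θ y).comp measurable_prodMk_left).coe_nnreal_real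

lemma measurable_backward (y : 𝓨) {β : X → ℝ} (hβ : Measurable β) :
    Measurable (backward M θ y β) := by
  have : StronglyMeasurable (Function.uncurry fun x x' => filterDensity M θ y x x' * β x') :=
    ((measurable_filterDensity M θ y).coe_nnreal_real.mul
      (hβ.comp measurable_snd)).stronglyMeasurable
  exact this.integral_prod_right.measurable

lemma measurable_backwardMean {k : ℕ} (y : 𝓨) {β : X → ℝ} (hβ : Measurable β)
    {r : (Fin (k + 2) → X) → ℝ} (hr : Measurable r) : Measurable (backwardMean M θ y β r) := by
  have : StronglyMeasurable (Function.uncurry fun (x : Fin (k + 1) → X) x' =>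
      filterDensity M θ y (x (Fin.last k)) x' * β x' * r (Fin.snoc x x')) :=
    (((measurable_filterDensity_last M θ k y).coe_nnreal_real.mul
      (hβ.comp measurable_snd)).mul (hr.comp (measurable_snoc_pair k))).stronglyMeasurable
  exact this.integral_prod_right.measurable.div
    ((measurable_backward y hβ).comp (measurable_pi_apply _))

namespace StrongMixing

variable (h : StrongMixing M θ σm σp)
include h

lemma comparable_one : Comparable σm σp (fun _ : X => (1 : ℝ)) :=
  ⟨measurable_const, 1, one_pos, fun _ => by simpa using ⟨h.le_one, h.one_le⟩⟩

lemma integrable_g_mul (y : 𝓨) {β : X → ℝ} (hβ : Comparable σm σp β) :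
    Integrable (fun x => M.g θ x y * β x) M.μ := by
  obtain ⟨c, _, hc⟩ := hβ.exists_mem
  exact integrable_mul_of_mem_Icc (h.integrable_g y) hβ.measurable hc

lemma le_integral_g_mul (y : 𝓨) {β : X → ℝ} (hβ : Comparable σm σp β) {c : ℝ}
    (hc : ∀ x, c ≤ β x) : c * ∫ x, (M.g θ x y : ℝ) ∂M.μ ≤ ∫ x, M.g θ x y * β x ∂M.μ := by
  rw [← integral_const_mul]
  refine integral_mono ((h.integrable_g y).const_mul _) (h.integrable_g_mul y hβ) fun x => ?_
  simpa only [mul_comm] using mul_le_mul_of_nonneg_right (hc x) NNReal.zero_le_coe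

lemma integral_g_mul_pos (y : 𝓨) {β : X → ℝ} (hβ : Comparable σm σp β) :
    0 < ∫ x, M.g θ x y * β x ∂M.μ := by
  obtain ⟨c, hc0, hc⟩ := hβ.exists_mem
  exact (mul_pos (mul_pos h.pos hc0) (h.g_pos y)).trans_le
    (h.le_integral_g_mul y hβ fun x => (hc x).1)

lemma filterDensity_mul_mem (y : 𝓨) {β : X → ℝ} (hβ : Comparable σm σp β) (x x' : X) :
    σm * (M.g θ x' y * β x') ≤ filterDensity M θ y x x' * β x' ∧
      filterDensity M θ y x x' * β x' ≤ σp * (M.g θ x' y * β x') := by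
  have h0 : 0 ≤ M.g θ x' y * β x' := mul_nonneg NNReal.zero_le_coe (hβ.pos h.pos x').le
  rw [filterDensity, NNReal.coe_mul, mul_assoc]
  exact ⟨mul_le_mul_of_nonneg_right (h.q_mem x x').1 h0,
    mul_le_mul_of_nonneg_right (h.q_mem x x').2 h0⟩

lemma integrable_filterDensity_mul (y : 𝓨) {β : X → ℝ} (hβ : Comparable σm σp β) (x : X) :
    Integrable (fun x' => filterDensity M θ y x x' * β x') M.μ := by
  refine ((h.integrable_g_mul y hβ).const_mul σp).mono'
    ((measurable_filterDensity_right y x).mul hβ.measurable).aestronglyMeasurable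
    (ae_of_all _ fun x' => ?_)
  rw [Real.norm_of_nonneg (mul_nonneg NNReal.zero_le_coe (hβ.pos h.pos x').le)]
  exact (h.filterDensity_mul_mem y hβ x x').2

lemma backward_mem (y : 𝓨) {β : X → ℝ} (hβ : Comparable σm σp β) (x : X) :
    backward M θ y β x ∈ Set.Icc (σm * ∫ x', M.g θ x' y * β x' ∂M.μ)
      (σp * ∫ x', M.g θ x' y * β x' ∂M.μ) := by
  have h1 := h.integrable_filterDensity_mul y hβ x
  have h2 := h.integrable_g_mul y hβ
  rw [← integral_const_mul, ← integral_const_mul]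
  exact ⟨integral_mono (h2.const_mul _) h1 fun x' => (h.filterDensity_mul_mem y hβ x x').1,
    integral_mono h1 (h2.const_mul _) fun x' => (h.filterDensity_mul_mem y hβ x x').2⟩

lemma comparable_backward (y : 𝓨) {β : X → ℝ} (hβ : Comparable σm σp β) :
    Comparable σm σp (backward M θ y β) :=
  ⟨measurable_backward y hβ.measurable, _, h.integral_g_mul_pos y hβ, h.backward_mem y hβ⟩

lemma backward_pos (y : 𝓨) {β : X → ℝ} (hβ : Comparable σm σp β) (x : X) :
    0 < backward M θ y β x := (h.comparable_backward y hβ).pos h.pos x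

lemma backwardMean_mem {k : ℕ} (y : 𝓨) {β : X → ℝ} (hβ : Comparable σm σp β)
    {r : (Fin (k + 2) → X) → ℝ} (hr : Measurable r) {lo hi : ℝ} (hrm : ∀ x, r x ∈ Set.Icc lo hi)
    (x : Fin (k + 1) → X) : backwardMean M θ y β r x ∈ Set.Icc lo hi :=
  weighted_mean_mem_Icc (h.integrable_filterDensity_mul y hβ _)
    (fun x' => mul_nonneg NNReal.zero_le_coe (hβ.pos h.pos x').le) (h.backward_pos y hβ _)
    (hr.comp (measurable_snoc_right x)) fun _ => hrm _

/-- A function of the next state alone has conditional means whose range is shorter by the factor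
`1 - σm / σp`. -/
lemma exists_backwardMean_mem {k i : ℕ} (hk : k < i) (y : 𝓨) {β : X → ℝ}
    (hβ : Comparable σm σp β) {r : (Fin (k + 2) → X) → ℝ} (hr : Measurable r)
    (hd : DependsFrom i r) {lo δ : ℝ} (hrm : ∀ x, r x ∈ Set.Icc lo (lo + δ)) :
    ∃ lo', ∀ x : Fin (k + 1) → X,
      backwardMean M θ y β r x ∈ Set.Icc lo' (lo' + (1 - σm / σp) * δ) := by
  obtain ⟨x₀⟩ : Nonempty X := nonempty_of_isProbabilityMeasure M.μ
  obtain ⟨lo', hlo⟩ := exists_weighted_mean_mem_Icc (m := M.μ)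
    (v := fun x' => r (Fin.snoc (fun _ : Fin (k + 1) => x₀) x')) (h.integrable_g_mul y hβ)
    (fun x => mul_nonneg NNReal.zero_le_coe (hβ.pos h.pos x).le) (h.integral_g_mul_pos y hβ)
    (hr.comp (measurable_snoc_right _)) (fun _ => hrm _) h.pos h.σp_pos
  refine ⟨lo', fun x => ?_⟩
  have := hlo (fun x' => filterDensity M θ y (x (Fin.last k)) x' * β x')
    ((measurable_filterDensity_right y _).mul hβ.measurable) fun x' =>
      h.filterDensity_mul_mem y hβ _ x'
  simpa only [backwardMean, backward, hd.apply_snoc_eq hk (fun _ => x₀) x] using this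

omit h in
lemma dependsFrom_backwardMean {k i : ℕ} (y : 𝓨) (β : X → ℝ) {r : (Fin (k + 2) → X) → ℝ}
    (hd : DependsFrom i r) : DependsFrom i (backwardMean M θ y β r) := by
  intro x₁ x₂ hx
  have h1 (x' : X) : r (Fin.snoc x₁ x') = r (Fin.snoc x₂ x') := by
    refine hd _ _ fun l => Fin.lastCases (fun _ => by simp) (fun l hl => ?_) l
    simp only [Fin.snoc_castSucc]
    rcases hl with hl | hl
    · exact hx l (Or.inl hl)
    · exact absurd hl (Fin.castSucc_lt_last l).ne
  simp only [backwardMean, h1, hx (Fin.last k) (Or.inr rfl)]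

lemma backward_mul_backwardMean {k : ℕ} (y : 𝓨) {β : X → ℝ} (hβ : Comparable σm σp β)
    (r : (Fin (k + 2) → X) → ℝ) (x : Fin (k + 1) → X) :
    backward M θ y β (x (Fin.last k)) * backwardMean M θ y β r x =
      ∫ x', filterDensity M θ y (x (Fin.last k)) x' * β x' * r (Fin.snoc x x') ∂M.μ :=
  mul_div_cancel₀ _ (h.backward_pos y hβ _).ne'

lemma integrable_filterDensity_mul_prod (y : ℕ → 𝓨) {k : ℕ} (y' : 𝓨)
    {F : (Fin (k + 1) → X) × X → ℝ} (hF : Measurable F) {C : ℝ} (hC : ∀ b, |F b| ≤ C) :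
    Integrable (fun b => filterDensity M θ y' (b.1 (Fin.last k)) b.2 * F b)
      ((pathMeasure M θ y k).prod M.μ) := by
  have := h.isFiniteMeasure_pathMeasure y k
  obtain ⟨D, hD⟩ := h.exists_filterDensity_le y'
  refine integrable_of_bdd ((measurable_filterDensity_last M θ k y').coe_nnreal_real.mul hF)
    (c := D * C) fun b => ?_
  rw [abs_mul, abs_of_nonneg NNReal.zero_le_coe]
  exact mul_le_mul (hD _ _) (hC b) (abs_nonneg _) (NNReal.zero_le_coe.trans (hD (b.1 0) b.2))

omit h in
lemma exists_abs_le_of_mem_Icc {α : Type*} {r : α → ℝ} {lo hi : ℝ}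
    (hr : ∀ x, r x ∈ Set.Icc lo hi) : ∃ C, ∀ x, |r x| ≤ C :=
  ⟨max |lo| |hi|, fun x => abs_le_max_abs_abs (hr x).1 (hr x).2⟩

lemma integral_backward (y : ℕ → 𝓨) {k : ℕ} {β : X → ℝ} (hβ : Comparable σm σp β)
    {r : (Fin (k + 2) → X) → ℝ} (hr : Measurable r) {lo hi : ℝ}
    (hrm : ∀ x, r x ∈ Set.Icc lo hi) :
    ∫ x, β (x (Fin.last (k + 1))) * r x ∂(pathMeasure M θ y (k + 1)) =
      ∫ x, backward M θ (y (k + 1)) β (x (Fin.last k)) * backwardMean M θ (y (k + 1)) β r x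
        ∂(pathMeasure M θ y k) := by
  have := h.isFiniteMeasure_pathMeasure y k
  obtain ⟨c, _, hc⟩ := hβ.exists_mem
  obtain ⟨B, hB⟩ := exists_abs_le_of_mem_Icc hc
  obtain ⟨C, hC⟩ := exists_abs_le_of_mem_Icc hrm
  have hβm := hβ.measurable
  have hFm : Measurable fun x : Fin (k + 2) → X => β (x (Fin.last (k + 1))) * r x := by fun_prop
  rw [integral_pathMeasure_succ M θ y k hFm, integral_prod]
  · refine integral_congr_ae (ae_of_all _ fun x => ?_)
    simp only [h.backward_mul_backwardMean (y (k + 1)) hβ r x, Fin.snoc_last, mul_assoc]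
  · refine h.integrable_filterDensity_mul_prod y (y (k + 1)) (C := B * C)
      (hFm.comp (measurable_snoc_pair k)) fun b => ?_
    rw [abs_mul]
    exact mul_le_mul (hB _) (hC _) (abs_nonneg _) ((abs_nonneg _).trans (hB b.2))

lemma integral_backward_one (y : ℕ → 𝓨) {k : ℕ} {β : X → ℝ} (hβ : Comparable σm σp β) :
    ∫ x, β (x (Fin.last (k + 1))) ∂(pathMeasure M θ y (k + 1)) =
      ∫ x, backward M θ (y (k + 1)) β (x (Fin.last k)) ∂(pathMeasure M θ y k) := by
  have h1 := h.integral_backward y hβ (k := k) (r := fun _ => 1) measurable_const (lo := 1)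
    (hi := 1) (by simp)
  simp only [mul_one] at h1
  rw [h1]
  refine integral_congr_ae (ae_of_all _ fun x => ?_)
  have h2 := h.backward_mul_backwardMean (k := k) (y (k + 1)) hβ (fun _ => 1) x
  simp only [mul_one] at h2
  exact h2

lemma tiltedMean_succ (y : ℕ → 𝓨) {k : ℕ} {β : X → ℝ} (hβ : Comparable σm σp β)
    {r : (Fin (k + 2) → X) → ℝ} (hr : Measurable r) {lo hi : ℝ}
    (hrm : ∀ x, r x ∈ Set.Icc lo hi) :
    tiltedMean M θ y β r =
      tiltedMean M θ y (backward M θ (y (k + 1)) β) (backwardMean M θ (y (k + 1)) β r) := by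
  rw [tiltedMean, tiltedMean, h.integral_backward y hβ hr hrm, h.integral_backward_one y hβ]

omit h in
lemma tiltedMean_zero (y : ℕ → 𝓨) {β : X → ℝ} (hβm : Measurable β)
    {r : (Fin (0 + 1) → X) → ℝ} (hr : Measurable r) :
    tiltedMean M θ y β r =
      (∫ x, M.dν x * M.g θ x (y 0) * β x * r (fun _ => x) ∂M.μ) /
        ∫ x, M.dν x * M.g θ x (y 0) * β x ∂M.μ := by
  rw [tiltedMean, integral_pathMeasure_zero M θ y (by fun_prop),
    integral_pathMeasure_zero M θ y (by fun_prop)]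
  simp only [mul_assoc]

/-- Positivity of the tilted mass, for an initial density that is bounded away from zero. -/
lemma integral_pathMeasure_pos {d : ℝ} (hd0 : 0 < d) (hd : ∀ x, d ≤ M.dν x) (y : ℕ → 𝓨) {k : ℕ} :
    ∀ {β : X → ℝ}, Comparable σm σp β →
      0 < ∫ x, β (x (Fin.last k)) ∂(pathMeasure M θ y k) := by
  induction k with
  | zero =>
    intro β hβ
    have hβm := hβ.measurable
    have hfin := h.isFiniteMeasure_pathMeasure y 0
    have hint := hβ.integrable (m := pathMeasure M θ y 0) h.pos
      (e := fun x : Fin (0 + 1) → X => x (Fin.last 0)) (measurable_pi_apply _)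
    have hF : Measurable fun x : Fin (0 + 1) → X => β (x (Fin.last 0)) := by fun_prop
    have hmp := measurePreserving_const_fin_one M.μ
    have hi : Integrable (fun x => M.dν x * M.g θ x (y 0) * β x) M.μ := by
      rw [pathMeasure, integrable_withDensity_iff_integrable_smul
        (measurable_pathDensity_right M θ 0 fun i => y i)] at hint
      refine (hmp.integrable_comp_of_integrable hint).congr (ae_of_all _ fun x => ?_)
      simp [StateSpaceModel.pathDensity, NNReal.smul_def]
    rw [integral_pathMeasure_zero M θ y hF]
    refine (mul_pos hd0 (h.integral_g_mul_pos (y 0) hβ)).trans_le ?_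
    rw [← integral_const_mul]
    refine integral_mono ((h.integrable_g_mul (y 0) hβ).const_mul _) hi fun x => ?_
    simp only
    rw [mul_assoc]
    exact mul_le_mul_of_nonneg_right (hd x)
      (mul_nonneg NNReal.zero_le_coe (hβ.pos h.pos x).le)
  | succ k ih =>
    intro β hβ
    rw [h.integral_backward_one y hβ]
    exact ih (h.comparable_backward _ hβ)

end StrongMixing

end Backward

/-! ### Forgetting of future observations -/

section Forgetting

variable {Θ X 𝓨 : Type*} [MeasurableSpace X] [MeasurableSpace 𝓨]

/-- The function `s(x_i, x_{i+1})` of a path `x_{0:k}`. -/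
def edge (s : X → X → ℝ) (i : ℕ) {k : ℕ} (h : i + 1 ≤ k) (x : Fin (k + 1) → X) : ℝ :=
  s (x ⟨i, by omega⟩) (x ⟨i + 1, by omega⟩)

section Edge

variable {s : X → X → ℝ} {i k : ℕ}

omit [MeasurableSpace X] in
lemma edge_snoc (h : i + 1 ≤ k) (x : Fin (k + 1) → X) (x' : X) :
    edge s i (h.trans k.le_succ) (Fin.snoc x x' : Fin (k + 2) → X) = edge s i h x := by
  have e1 : (⟨i, by omega⟩ : Fin (k + 2)) = Fin.castSucc ⟨i, by omega⟩ := rfl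
  have e2 : (⟨i + 1, by omega⟩ : Fin (k + 2)) = Fin.castSucc ⟨i + 1, by omega⟩ := rfl
  simp only [edge, e1, e2, Fin.snoc_castSucc]

omit [MeasurableSpace X] in
lemma edge_snoc_self (x : Fin (i + 1) → X) (x' : X) :
    edge s i le_rfl (Fin.snoc x x' : Fin (i + 2) → X) = s (x (Fin.last i)) x' := by
  have e1 : (⟨i, by omega⟩ : Fin (i + 2)) = Fin.castSucc (Fin.last i) := rfl
  have e2 : (⟨i + 1, by omega⟩ : Fin (i + 2)) = Fin.last (i + 1) := rfl
  simp only [edge, e1, e2, Fin.snoc_castSucc, Fin.snoc_last]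

lemma measurable_edge (hs : Measurable (Function.uncurry s)) (h : i + 1 ≤ k) :
    Measurable (edge s i h) :=
  Measurable.comp (g := Function.uncurry s)
    (f := fun x : Fin (k + 1) → X => (x ⟨i, by omega⟩, x ⟨i + 1, by omega⟩)) hs (by fun_prop)

omit [MeasurableSpace X] in
lemma dependsFrom_edge (h : i + 1 ≤ k) : DependsFrom i (edge s i h) := by
  intro x x' hx
  simp only [edge]
  rw [hx ⟨i, by omega⟩ (Or.inl le_rfl), hx ⟨i + 1, by omega⟩ (Or.inl (Nat.le_succ i))]

end Edge

variable (M : StateSpaceModel Θ X 𝓨) (θ : Θ)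

/-- The mean of `F(X_{0:k}, x')` under the law of `X_{0:k}` given `Y_{0:k}` and `X_{k+1} = x'`;
for `F` a function of `X_k` this is an integral against the backward kernel. -/
noncomputable def reverseMean (y : ℕ → 𝓨) (k : ℕ) (F : (Fin (k + 1) → X) × X → ℝ) (x' : X) : ℝ :=
  (∫ x, M.q θ (x (Fin.last k)) x' * F (x, x') ∂(pathMeasure M θ y k)) /
    ∫ x, (M.q θ (x (Fin.last k)) x' : ℝ) ∂(pathMeasure M θ y k)

variable {M θ} {σm σp d : ℝ}

lemma measurable_q_last (k : ℕ) :
    Measurable fun b : (Fin (k + 1) → X) × X => (M.q θ (b.1 (Fin.last k)) b.2 : ℝ) :=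
  ((M.measurable_q θ).comp (by fun_prop :
    Measurable fun b : (Fin (k + 1) → X) × X => (b.1 (Fin.last k), b.2))).coe_nnreal_real

namespace StrongMixing

variable (h : StrongMixing M θ σm σp) (hd0 : 0 < d) (hd : ∀ x, d ≤ M.dν x) (y : ℕ → 𝓨)
include h

lemma measurable_reverseMean {k : ℕ} {F : (Fin (k + 1) → X) × X → ℝ} (hF : Measurable F) :
    Measurable (reverseMean M θ y k F) := by
  have := h.isFiniteMeasure_pathMeasure y k
  have h1 : StronglyMeasurable (Function.uncurry fun (x : Fin (k + 1) → X) x' =>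
      M.q θ (x (Fin.last k)) x' * F (x, x')) :=
    ((measurable_q_last k).mul hF).stronglyMeasurable
  have h2 : StronglyMeasurable (Function.uncurry fun (x : Fin (k + 1) → X) x' =>
      (M.q θ (x (Fin.last k)) x' : ℝ)) := (measurable_q_last k).stronglyMeasurable
  exact h1.integral_prod_left.measurable.div h2.integral_prod_left.measurable

lemma integrable_q_last {k : ℕ} (x' : X) :
    Integrable (fun x : Fin (k + 1) → X => (M.q θ (x (Fin.last k)) x' : ℝ))
      (pathMeasure M θ y k) := by
  have := h.isFiniteMeasure_pathMeasure y k
  refine integrable_of_bdd ((measurable_q_last k).comp measurable_prodMk_right) (c := σp)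
    fun x => ?_
  rw [abs_of_nonneg NNReal.zero_le_coe]
  exact (h.q_mem _ _).2

include hd0 hd

lemma mass_pos (k : ℕ) : 0 < ∫ _, (1 : ℝ) ∂(pathMeasure M θ y k) :=
  h.integral_pathMeasure_pos hd0 hd y h.comparable_one

lemma integral_q_last_pos (k : ℕ) (x' : X) :
    0 < ∫ x, (M.q θ (x (Fin.last k)) x' : ℝ) ∂(pathMeasure M θ y k) := by
  have := h.isFiniteMeasure_pathMeasure y k
  refine (mul_pos h.pos (h.mass_pos hd0 hd y k)).trans_le ?_
  rw [← integral_const_mul]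
  refine integral_mono ((integrable_const _).const_mul _) (h.integrable_q_last y x') fun x => ?_
  simpa using (h.q_mem _ _).1

lemma reverseMean_mem {k : ℕ} {F : (Fin (k + 1) → X) × X → ℝ} (hF : Measurable F) {lo hi : ℝ}
    (hFm : ∀ b, F b ∈ Set.Icc lo hi) (x' : X) : reverseMean M θ y k F x' ∈ Set.Icc lo hi :=
  weighted_mean_mem_Icc (h.integrable_q_last y x') (fun _ => NNReal.zero_le_coe)
    (h.integral_q_last_pos hd0 hd y k x') (hF.comp measurable_prodMk_right) fun _ => hFm _

lemma integral_reverseMean {k : ℕ} {F : (Fin (k + 1) → X) × X → ℝ} (hF : Measurable F) {lo hi : ℝ}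
    (hFm : ∀ b, F b ∈ Set.Icc lo hi) {w : X → ℝ} (hw : Measurable w) {C : ℝ}
    (hC : ∀ x, |w x| ≤ C) :
    ∫ b, filterDensity M θ (y (k + 1)) (b.1 (Fin.last k)) b.2 * (w b.2 * F b)
        ∂((pathMeasure M θ y k).prod M.μ) =
      ∫ b, filterDensity M θ (y (k + 1)) (b.1 (Fin.last k)) b.2 *
          (w b.2 * reverseMean M θ y k F b.2) ∂((pathMeasure M θ y k).prod M.μ) := by
  have := h.isFiniteMeasure_pathMeasure y k
  have hv := h.measurable_reverseMean y hF
  have hvm := h.reverseMean_mem hd0 hd y hF hFm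
  obtain ⟨D, hD⟩ := exists_abs_le_of_mem_Icc hFm
  obtain ⟨D', hD'⟩ := exists_abs_le_of_mem_Icc hvm
  rw [integral_prod_symm, integral_prod_symm]
  · refine integral_congr_ae (ae_of_all _ fun x' => ?_)
    have e1 : ∀ x : Fin (k + 1) → X,
        (filterDensity M θ (y (k + 1)) (x (Fin.last k)) x' : ℝ) * (w x' * F (x, x')) =
          M.g θ x' (y (k + 1)) * w x' * (M.q θ (x (Fin.last k)) x' * F (x, x')) := fun x => by
      rw [filterDensity, NNReal.coe_mul]; ring
    have e2 : ∀ x : Fin (k + 1) → X,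
        (filterDensity M θ (y (k + 1)) (x (Fin.last k)) x' : ℝ) *
            (w x' * reverseMean M θ y k F x') =
          M.g θ x' (y (k + 1)) * w x' * reverseMean M θ y k F x' *
            M.q θ (x (Fin.last k)) x' := fun x => by
      rw [filterDensity, NNReal.coe_mul]; ring
    simp only [e1, e2]
    rw [integral_const_mul, integral_const_mul, mul_assoc (_ * _)]
    congr 1
    exact (div_mul_cancel₀ _ (h.integral_q_last_pos hd0 hd y k x').ne').symm
  · refine h.integrable_filterDensity_mul_prod y (y (k + 1)) (C := C * D')
      (by fun_prop) fun b => ?_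
    rw [abs_mul]
    exact mul_le_mul (hC _) (hD' _) (abs_nonneg _) ((abs_nonneg _).trans (hC b.2))
  · refine h.integrable_filterDensity_mul_prod y (y (k + 1)) (C := C * D)
      (by fun_prop) fun b => ?_
    rw [abs_mul]
    exact mul_le_mul (hC _) (hD _) (abs_nonneg _) ((abs_nonneg _).trans (hC b.2))

/-- The conditional mean `v(X_k)` of `s(X_i, X_{i+1})` given `X_k` and `Y_{0:k}`, at time
`k = i + 1 + l`, has a range that contracts geometrically in `l`: each backward kernel dominates a
multiple of the filter. -/
lemma exists_reverse_version {s : X → X → ℝ} (hs : Measurable (Function.uncurry s)) {lo δ : ℝ}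
    (hsm : ∀ x x', s x x' ∈ Set.Icc lo (lo + δ)) (i l : ℕ) :
    ∃ v : X → ℝ, Measurable v ∧
      (∃ lo', ∀ x, v x ∈ Set.Icc lo' (lo' + (1 - σm / σp) ^ l * δ)) ∧
      ∀ w : X → ℝ, Measurable w → ∀ C : ℝ, (∀ x, |w x| ≤ C) →
        ∫ x, w (x (Fin.last (i + 1 + l))) * edge s i (Nat.le_add_right _ _) x
            ∂(pathMeasure M θ y (i + 1 + l)) =
          ∫ x, w (x (Fin.last (i + 1 + l))) * v (x (Fin.last (i + 1 + l)))
            ∂(pathMeasure M θ y (i + 1 + l)) := by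
  induction l with
  | zero =>
    have hF : Measurable fun b : (Fin (i + 1) → X) × X => s (b.1 (Fin.last i)) b.2 :=
      hs.comp (by fun_prop : Measurable fun b : (Fin (i + 1) → X) × X => (b.1 (Fin.last i), b.2))
    have hv := h.measurable_reverseMean y hF
    refine ⟨_, hv, ⟨lo, fun x => ?_⟩, fun w hw C hC => ?_⟩
    · simpa using h.reverseMean_mem hd0 hd y hF (fun _ => hsm _ _) x
    · have hm := measurable_edge hs (le_refl (i + 1))
      change ∫ x, w (x (Fin.last (i + 1))) * edge s i _ x ∂(pathMeasure M θ y (i + 1)) =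
        ∫ x, w (x (Fin.last (i + 1))) * reverseMean M θ y i (fun b => s (b.1 (Fin.last i)) b.2)
          (x (Fin.last (i + 1))) ∂(pathMeasure M θ y (i + 1))
      rw [integral_pathMeasure_succ M θ y i (by fun_prop),
        integral_pathMeasure_succ M θ y i (by fun_prop)]
      simp only [Fin.snoc_last, edge_snoc_self]
      exact h.integral_reverseMean hd0 hd y hF (fun _ => hsm _ _) hw hC
  | succ l ih =>
    obtain ⟨v, hv, ⟨lo', hvm⟩, hvw⟩ := ih
    have hfin := h.isFiniteMeasure_pathMeasure y (i + 1 + l)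
    have hF : Measurable fun b : (Fin (i + 1 + l + 1) → X) × X => v (b.1 (Fin.last _)) := by
      fun_prop
    have hv' := h.measurable_reverseMean y hF
    obtain ⟨lo'', hlo⟩ := exists_weighted_mean_mem_Icc (m := pathMeasure M θ y (i + 1 + l))
      (h := fun _ => 1) (v := fun x => v (x (Fin.last _))) (integrable_const _)
      (fun _ => zero_le_one) (h.mass_pos hd0 hd y _) (by fun_prop) (fun _ => hvm _) h.pos h.σp_pos
    refine ⟨_, hv', ⟨lo'', fun x' => ?_⟩, fun w hw C hC => ?_⟩
    · have := hlo (fun x => M.q θ (x (Fin.last _)) x')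
        ((measurable_q_last _).comp measurable_prodMk_right) fun x => by
          simpa using h.q_mem (x (Fin.last _)) x'
      rw [pow_succ', mul_assoc]
      exact this
    · have hm := measurable_edge hs (show i + 1 ≤ i + 1 + l + 1 by omega)
      have hm' := measurable_edge hs (show i + 1 ≤ i + 1 + l by omega)
      change ∫ x, w (x (Fin.last (i + 1 + l + 1))) * edge s i _ x
          ∂(pathMeasure M θ y (i + 1 + l + 1)) =
        ∫ x, w (x (Fin.last (i + 1 + l + 1))) *
          reverseMean M θ y (i + 1 + l) (fun b => v (b.1 (Fin.last _)))
            (x (Fin.last (i + 1 + l + 1))) ∂(pathMeasure M θ y (i + 1 + l + 1))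
      rw [integral_pathMeasure_succ M θ y _ (by fun_prop),
        integral_pathMeasure_succ M θ y _ (by fun_prop)]
      simp only [Fin.snoc_last]
      rw [← h.integral_reverseMean hd0 hd y hF (fun _ => hvm _) hw hC]
      obtain ⟨D, hD⟩ := exists_abs_le_of_mem_Icc hvm
      obtain ⟨D', hD'⟩ : ∃ D', ∀ x x', |s x x'| ≤ D' :=
        ⟨max |lo| |lo + δ|, fun x x' => abs_le_max_abs_abs (hsm x x').1 (hsm x x').2⟩
      obtain ⟨G, hG⟩ := h.exists_filterDensity_le (y (i + 1 + l + 1))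
      rw [integral_prod_symm, integral_prod_symm]
      · refine integral_congr_ae (ae_of_all _ fun x' => ?_)
        have hq : Measurable fun x => (filterDensity M θ (y (i + 1 + l + 1)) x x' : ℝ) * w x' :=
          (((measurable_filterDensity M θ _).comp
            measurable_prodMk_right).coe_nnreal_real.mul_const _)
        have := hvw _ hq (G * C) fun x => by
          rw [abs_mul, abs_of_nonneg NNReal.zero_le_coe]
          exact mul_le_mul (hG _ _) (hC _) (abs_nonneg _) (NNReal.zero_le_coe.trans (hG x x))
        simp only [edge_snoc (show i + 1 ≤ i + 1 + l by omega), ← mul_assoc] at this ⊢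
        exact this
      · refine h.integrable_filterDensity_mul_prod y _ (C := C * D) (by fun_prop) fun b => ?_
        rw [abs_mul]
        exact mul_le_mul (hC _) (hD _) (abs_nonneg _) ((abs_nonneg _).trans (hC b.2))
      · refine h.integrable_filterDensity_mul_prod y _ (C := C * D')
          ((hw.comp measurable_snd).mul (hm.comp (measurable_snoc_pair _))) fun b => ?_
        rw [abs_mul]
        exact mul_le_mul (hC _) (hD' _ _) (abs_nonneg _) ((abs_nonneg _).trans (hC b.2))

omit hd0 hd in
lemma tiltedMean_edge_succ {s : X → X → ℝ} (hs : Measurable (Function.uncurry s)) {lo hi : ℝ}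
    (hsm : ∀ x x', s x x' ∈ Set.Icc lo hi) {i k : ℕ} (hik : i + 1 ≤ k) {β : X → ℝ}
    (hβ : Comparable σm σp β) :
    tiltedMean M θ y β (edge s i (hik.trans k.le_succ)) =
      tiltedMean M θ y (backward M θ (y (k + 1)) β) (edge s i hik) := by
  rw [h.tiltedMean_succ y hβ (measurable_edge hs _) fun x => hsm _ _]
  congr 1
  ext x
  have : (fun x' => (filterDensity M θ (y (k + 1)) (x (Fin.last k)) x' : ℝ) * β x' *
      edge s i (hik.trans k.le_succ) (Fin.snoc x x' : Fin (k + 2) → X)) =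
      fun x' => (filterDensity M θ (y (k + 1)) (x (Fin.last k)) x' : ℝ) * β x' *
        edge s i hik x := by
    ext x'; rw [edge_snoc]
  rw [backwardMean, this, integral_mul_const]
  exact mul_div_cancel_left₀ _ (h.backward_pos (y (k + 1)) hβ _).ne'

omit hd0 hd in
lemma exists_tiltedMean_edge_eq {s : X → X → ℝ} (hs : Measurable (Function.uncurry s)) {lo hi : ℝ}
    (hsm : ∀ x x', s x x' ∈ Set.Icc lo hi) {i k n : ℕ} (hik : i + 1 ≤ k) (hkn : k ≤ n)
    {β : X → ℝ} (hβ : Comparable σm σp β) :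
    ∃ β', Comparable σm σp β' ∧
      tiltedMean M θ y β (edge s i (hik.trans hkn)) = tiltedMean M θ y β' (edge s i hik) := by
  induction n, hkn using Nat.le_induction generalizing β with
  | base => exact ⟨β, hβ, rfl⟩
  | succ n hkn ih =>
    obtain ⟨β', h1, h2⟩ := ih (h.comparable_backward (y (n + 1)) hβ)
    exact ⟨β', h1, (h.tiltedMean_edge_succ y hs hsm (hik.trans hkn) hβ).trans h2⟩

lemma tiltedMean_mem {k : ℕ} {β : X → ℝ} (hβ : Comparable σm σp β) {r : (Fin (k + 1) → X) → ℝ}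
    (hr : Measurable r) {lo hi : ℝ} (hrm : ∀ x, r x ∈ Set.Icc lo hi) :
    tiltedMean M θ y β r ∈ Set.Icc lo hi := by
  have := h.isFiniteMeasure_pathMeasure y k
  exact weighted_mean_mem_Icc (hβ.integrable h.pos (measurable_pi_apply _))
    (fun x => (hβ.pos h.pos _).le) (h.integral_pathMeasure_pos hd0 hd y hβ) hr hrm

/-- Observations after time `k = i + 1 + l` change the smoothed value of `s(X_i, X_{i+1})` by at
most a multiple of `ρ ^ (l + 1)`: `l` backward steps from `k` to `i + 1` contract, and the
distributions of `X_k` given `Y_{0:k}` and given `Y_{0:n}` have a common component of mass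
`1 - ρ`. -/
lemma abs_tiltedMean_edge_sub_le {s : X → X → ℝ} (hs : Measurable (Function.uncurry s)) {lo δ : ℝ}
    (hsm : ∀ x x', s x x' ∈ Set.Icc lo (lo + δ)) (i l : ℕ) {n : ℕ} (hn : i + 1 + l ≤ n) :
    |tiltedMean M θ y (fun _ => 1) (edge s i (Nat.le_add_right (i + 1) l)) -
        tiltedMean M θ y (fun _ => 1) (edge s i ((Nat.le_add_right (i + 1) l).trans hn))| ≤
      (1 - σm / σp) ^ (l + 1) * δ := by
  obtain ⟨β, hβ, hβe⟩ := h.exists_tiltedMean_edge_eq y hs hsm (Nat.le_add_right (i + 1) l) hn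
    h.comparable_one
  have hfin := h.isFiniteMeasure_pathMeasure y (i + 1 + l)
  obtain ⟨v, hv, ⟨lo', hvm⟩, hvw⟩ := h.exists_reverse_version hd0 hd y hs hsm i l
  obtain ⟨lo'', hlo⟩ := exists_weighted_mean_mem_Icc (m := pathMeasure M θ y (i + 1 + l))
    (h := fun _ => 1) (v := fun x => v (x (Fin.last _))) (integrable_const _)
    (fun _ => zero_le_one) (h.mass_pos hd0 hd y _) (by fun_prop) (fun _ => hvm _) h.pos h.σp_pos
  have key {β : X → ℝ} (hβ : Comparable σm σp β) :
      tiltedMean M θ y β (edge s i (Nat.le_add_right (i + 1) l)) ∈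
        Set.Icc lo'' (lo'' + (1 - σm / σp) * ((1 - σm / σp) ^ l * δ)) := by
    obtain ⟨c, hc0, hc⟩ := hβ.exists_mem
    obtain ⟨C, hC⟩ := exists_abs_le_of_mem_Icc hc
    have hβm := hβ.measurable
    have h1 := hlo (fun x => c⁻¹ * β (x (Fin.last _))) (by fun_prop) fun x => by
      obtain ⟨a1, a2⟩ := hc (x (Fin.last _))
      rw [inv_mul_eq_div, le_div_iff₀ hc0, div_le_iff₀ hc0]
      simpa using ⟨a1, a2⟩
    simp only [mul_assoc] at h1
    rw [integral_const_mul, integral_const_mul, ← hvw β hβm C hC,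
      mul_div_mul_left _ _ (inv_ne_zero hc0.ne')] at h1
    exact h1
  rw [hβe, pow_succ', mul_assoc]
  have k1 := key h.comparable_one
  have k2 := key hβ
  rw [abs_le]
  constructor <;> linarith [k1.1, k1.2, k2.1, k2.2]

end StrongMixing

end Forgetting

/-! ### The particle system for given observations -/

/-- Independent indices followed by independent moves from the selected points amount to
independent draws from the mixture. -/
lemma pi_comp_pi {J E : Type*} [MeasurableSpace J] [MeasurableSpace E] (N : ℕ) (m : Measure J)
    [IsProbabilityMeasure m] (κ : Kernel J E) [IsMarkovKernel κ]
    {G : (Fin N → E) → ℝ≥0∞} (hG : Measurable G) :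
    ∫⁻ I, ∫⁻ x, G x ∂(Measure.pi fun i => κ (I i)) ∂(Measure.pi fun _ : Fin N => m) =
      ∫⁻ x, G x ∂(Measure.pi fun _ : Fin N => κ ∘ₘ m) := by
  let K : Kernel (Fin N → J) (Fin N → E) :=
    kernelPi fun i => κ.comap (fun I : Fin N → J => I i) (measurable_pi_apply i)
  have hK (I : Fin N → J) : K I = Measure.pi fun i => κ (I i) := rfl
  have h : (Measure.pi fun _ : Fin N => κ ∘ₘ m) = K ∘ₘ (Measure.pi fun _ : Fin N => m) := by
    refine Measure.pi_eq fun s hs => ?_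
    rw [Measure.bind_apply (MeasurableSet.univ_pi hs) K.measurable.aemeasurable]
    simp only [hK, Measure.pi_pi]
    have hi : iIndepFun (fun (i : Fin N) (I : Fin N → J) => κ (I i) (s i))
        (Measure.pi fun _ : Fin N => m) :=
      iIndepFun_pi fun i => (κ.measurable_coe (hs i)).aemeasurable
    rw [lintegral_prod_eq_prod_lintegral_of_indepFun _ _ hi fun i =>
      (κ.measurable_coe (hs i)).comp (measurable_pi_apply i)]
    refine Finset.prod_congr rfl fun i _ => ?_
    rw [Measure.bind_apply (hs i) κ.measurable.aemeasurable]
    exact (measurePreserving_eval (fun _ : Fin N => m) i).lintegral_comp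
      (κ.measurable_coe (hs i))
  rw [h, Measure.lintegral_bind K.measurable.aemeasurable hG.aemeasurable]
  rfl

section Particles

variable {Θ X 𝓨 : Type*} [MeasurableSpace X] [MeasurableSpace 𝓨]
  {M : StateSpaceModel Θ X 𝓨} (S : Proposal M) (N : ℕ) [NeZero N] (θ : Θ)

/-- The law of one selected index, given the observation and the particle paths. -/
noncomputable def indexKernel (k : ℕ) : Kernel (𝓨 × (Fin N → Fin (k + 1) → X)) (Fin N) where
  toFun a := indexLaw fun j => S.pathWeight θ k a.1 (a.2 j)
  measurable' := by
    refine measurable_indexLaw.comp (measurable_pi_lambda _ fun j => ?_)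
    exact (S.measurable_pathWeight θ k).comp (by fun_prop :
      Measurable fun a : 𝓨 × (Fin N → Fin (k + 1) → X) => (a.1, a.2 j))

instance (k : ℕ) : IsMarkovKernel (indexKernel S N θ k) :=
  ⟨fun a => inferInstanceAs (IsProbabilityMeasure
    (indexLaw fun j => S.pathWeight θ k a.1 (a.2 j)))⟩

lemma selection_apply (k : ℕ) (a : 𝓨 × (Fin N → Fin (k + 1) → X)) :
    selection S N θ k a =
      Measure.pi fun _ => indexLaw fun j => S.pathWeight θ k a.1 (a.2 j) := rfl

omit [NeZero N] in
lemma measurable_apply_index {E : Type*} [MeasurableSpace E] :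
    Measurable fun b : (Fin N → E) × Fin N => b.1 b.2 :=
  measurable_from_prod_countable_left fun j => measurable_pi_apply j

/-- The law of one particle path at time `k + 1` given the particle paths at time `k`: a path is
selected according to the weights and extended by a draw from the proposal kernel. -/
noncomputable def mixtureKernel (k : ℕ) :
    Kernel ((ℕ → 𝓨) × (Fin N → Fin (k + 1) → X)) (Fin (k + 2) → X) :=
  ((indexKernel S N θ k).comap (fun a : (ℕ → 𝓨) × (Fin N → Fin (k + 1) → X) => (a.1 k, a.2))
      (by fun_prop) ⊗ₖ
    (mutation S θ k).comap
      (fun b : ((ℕ → 𝓨) × (Fin N → Fin (k + 1) → X)) × Fin N => (b.1.1 (k + 1), b.1.2 b.2))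
      ((by fun_prop : Measurable fun b : ((ℕ → 𝓨) × (Fin N → Fin (k + 1) → X)) × Fin N =>
        b.1.1 (k + 1)).prodMk ((measurable_apply_index N).comp (by fun_prop :
          Measurable fun b : ((ℕ → 𝓨) × (Fin N → Fin (k + 1) → X)) × Fin N =>
            (b.1.2, b.2))))).snd

instance (k : ℕ) : IsMarkovKernel (mixtureKernel S N θ k) := by
  unfold mixtureKernel; infer_instance

/-- The law of the particle paths before selection at time `k`, given the observations. -/
noncomputable def particleLaw : (k : ℕ) → Kernel (ℕ → 𝓨) (Fin N → Fin (k + 1) → X)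
  | 0 => Kernel.const _ (Measure.pi fun _ : Fin N => Measure.pi fun _ : Fin (0 + 1) => S.ς)
  | k + 1 => (particleLaw k ⊗ₖ kernelPi fun _ : Fin N => mixtureKernel S N θ k).snd

instance (k : ℕ) : IsMarkovKernel (particleLaw S N θ k) := by
  induction k with
  | zero => unfold particleLaw; infer_instance
  | succ k ih => unfold particleLaw; infer_instance

lemma mutation_apply (k : ℕ) (y : 𝓨) (x : Fin (k + 1) → X) :
    mutation S θ k (y, x) =
      (S.R θ k (y, x (Fin.last k))).map fun x' => (Fin.snoc x x' : Fin (k + 2) → X) := by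
  rw [mutation, Kernel.map_apply _ (measurable_snoc_pair k), Kernel.prod_apply,
    Kernel.deterministic_apply, Kernel.comap_apply, Measure.dirac_prod,
    Measure.map_map (measurable_snoc_pair k) measurable_prodMk_left]
  rfl

lemma integral_mutation (k : ℕ) (y : 𝓨) (x : Fin (k + 1) → X) {F : (Fin (k + 2) → X) → ℝ}
    (hF : Measurable F) :
    ∫ z, F z ∂(mutation S θ k (y, x)) =
      ∫ x', F (Fin.snoc x x') ∂(S.R θ k (y, x (Fin.last k))) := by
  rw [mutation_apply, integral_map (measurable_snoc_right x).aemeasurable hF.aestronglyMeasurable]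

variable {N} in
lemma integral_indexLaw (w : Fin N → ℝ≥0) (F : Fin N → ℝ) :
    ∫ j, F j ∂(indexLaw w) = ∑ j, (normalized w j : ℝ) * F j := by
  rw [integral_fintype Integrable.of_finite]
  refine Finset.sum_congr rfl fun j _ => ?_
  congr 1
  rw [measureReal_def, indexLaw_apply]
  simp [Set.indicator_apply]

lemma mixtureKernel_apply (k : ℕ) (y : ℕ → 𝓨) (a : Fin N → Fin (k + 1) → X) :
    mixtureKernel S N θ k (y, a) =
      (mutation S θ k).comap (fun j : Fin N => (y (k + 1), a j)) (measurable_of_countable _) ∘ₘ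
        indexLaw fun j => S.pathWeight θ k (y k) (a j) := by
  ext s hs
  rw [mixtureKernel, Kernel.snd_apply' _ _ hs, Kernel.compProd_apply (measurable_snd hs),
    Measure.bind_apply hs (Kernel.measurable _).aemeasurable]
  rfl

lemma integral_mixtureKernel (k : ℕ) (y : ℕ → 𝓨) (a : Fin N → Fin (k + 1) → X)
    {F : (Fin (k + 2) → X) → ℝ} (hF : Measurable F) {C : ℝ} (hC : ∀ x, |F x| ≤ C) :
    ∫ z, F z ∂(mixtureKernel S N θ k (y, a)) =
      ∑ j, (normalized (fun j => S.pathWeight θ k (y k) (a j)) j : ℝ) *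
        ∫ x', F (Fin.snoc (a j) x') ∂(S.R θ k (y (k + 1), a j (Fin.last k))) := by
  have hi : Integrable F (mixtureKernel S N θ k (y, a)) := integrable_of_bdd hF hC
  rw [mixtureKernel_apply] at hi ⊢
  have e := Kernel.integral_comp (κ := Kernel.const Unit
    (indexLaw fun j => S.pathWeight θ k (y k) (a j))) (a := ())
    (η := (mutation S θ k).comap (fun j : Fin N => (y (k + 1), a j)) (measurable_of_countable _))
    (f := F) (by rwa [Kernel.comp_apply, Kernel.const_apply])
  rw [Kernel.comp_apply, Kernel.const_apply] at e
  rw [e, integral_indexLaw]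
  simp only [Kernel.comap_apply, integral_mutation S θ k _ _ hF]

/-- The weighted mean of `r` over particle paths, where the normalized importance weights are
multiplied by a function `β` of the last component. -/
noncomputable def particleMean (k : ℕ) (y : 𝓨) (β : X → ℝ) (r : (Fin (k + 1) → X) → ℝ)
    (a : Fin N → Fin (k + 1) → X) : ℝ :=
  (∑ j, (normalized (fun j => S.pathWeight θ k y (a j)) j : ℝ) * β (a j (Fin.last k)) * r (a j)) /
    ∑ j, (normalized (fun j => S.pathWeight θ k y (a j)) j : ℝ) * β (a j (Fin.last k))

omit [NeZero N] in
lemma measurable_normalized_weight (k : ℕ) (j : Fin N) :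
    Measurable fun a : 𝓨 × (Fin N → Fin (k + 1) → X) =>
      (normalized (fun j => S.pathWeight θ k a.1 (a.2 j)) j : ℝ) := by
  refine ((measurable_normalized j).comp (measurable_pi_lambda _ fun i => ?_)).coe_nnreal_real
  exact (S.measurable_pathWeight θ k).comp (by fun_prop :
    Measurable fun a : 𝓨 × (Fin N → Fin (k + 1) → X) => (a.1, a.2 i))

omit [NeZero N] in
lemma measurable_particleMean (k : ℕ) (y : 𝓨) {β : X → ℝ} (hβ : Measurable β)
    {r : (Fin (k + 1) → X) → ℝ} (hr : Measurable r) :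
    Measurable (particleMean S N θ k y β r) := by
  have hn (j : Fin N) : Measurable fun a : Fin N → Fin (k + 1) → X =>
      (normalized (fun j => S.pathWeight θ k y (a j)) j : ℝ) :=
    (measurable_normalized_weight S N θ k j).comp measurable_prodMk_left
  have hb (j : Fin N) : Measurable fun a : Fin N → Fin (k + 1) → X => β (a j (Fin.last k)) :=
    hβ.comp (by fun_prop)
  exact (Finset.measurable_sum _ fun j _ => ((hn j).mul (hb j)).mul
    (hr.comp (measurable_pi_apply j))).div
      (Finset.measurable_sum _ fun j _ => (hn j).mul (hb j))

variable {N} in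
lemma sum_normalized_real (w : Fin N → ℝ≥0) : ∑ j, (normalized w j : ℝ) = 1 := by
  rw [← NNReal.coe_sum, sum_normalized, NNReal.coe_one]

variable {N S θ} {σm σp : ℝ}

lemma Comparable.sum_normalized_pos (hσ : 0 < σm) {β : X → ℝ} (hβ : Comparable σm σp β)
    (w : Fin N → ℝ≥0) (x : Fin N → X) : 0 < ∑ j, (normalized w j : ℝ) * β (x j) := by
  obtain ⟨c, hc0, hc⟩ := hβ.exists_mem
  refine (mul_pos hσ hc0).trans_le ?_
  calc σm * c = ∑ j, (normalized w j : ℝ) * (σm * c) := by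
        rw [← Finset.sum_mul, sum_normalized_real, one_mul]
    _ ≤ _ := Finset.sum_le_sum fun j _ =>
        mul_le_mul_of_nonneg_left (hc _).1 NNReal.zero_le_coe

lemma particleMean_mem (hσ : 0 < σm) {k : ℕ} (y : 𝓨) {β : X → ℝ} (hβ : Comparable σm σp β)
    {r : (Fin (k + 1) → X) → ℝ} {lo hi : ℝ} (hrm : ∀ x, r x ∈ Set.Icc lo hi)
    (a : Fin N → Fin (k + 1) → X) : particleMean S N θ k y β r a ∈ Set.Icc lo hi := by
  have hpos := hβ.sum_normalized_pos hσ (fun j => S.pathWeight θ k y (a j))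
    fun j => a j (Fin.last k)
  have h0 (j : Fin N) : 0 ≤ (normalized (fun j => S.pathWeight θ k y (a j)) j : ℝ) *
      β (a j (Fin.last k)) := mul_nonneg NNReal.zero_le_coe (hβ.pos hσ _).le
  unfold particleMean
  constructor
  · rw [le_div_iff₀ hpos, Finset.mul_sum]
    refine Finset.sum_le_sum fun j _ => ?_
    rw [mul_comm]
    exact mul_le_mul_of_nonneg_left (hrm _).1 (h0 j)
  · rw [div_le_iff₀ hpos, Finset.mul_sum]
    refine Finset.sum_le_sum fun j _ => ?_
    rw [mul_comm hi]
    exact mul_le_mul_of_nonneg_left (hrm _).2 (h0 j)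

lemma particleMean_mul_sum (hσ : 0 < σm) {k : ℕ} (y : 𝓨) {β : X → ℝ} (hβ : Comparable σm σp β)
    (r : (Fin (k + 1) → X) → ℝ) (a : Fin N → Fin (k + 1) → X) :
    particleMean S N θ k y β r a * ∑ j, S.pathWeight θ k y (a j) * β (a j (Fin.last k)) =
      ∑ j, S.pathWeight θ k y (a j) * β (a j (Fin.last k)) * r (a j) := by
  have hpos := hβ.sum_normalized_pos hσ (fun j => S.pathWeight θ k y (a j))
    fun j => a j (Fin.last k)
  by_cases hw : ∑ j, S.pathWeight θ k y (a j) = 0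
  · have : ∀ j, S.pathWeight θ k y (a j) = 0 := fun j =>
      (Finset.sum_eq_zero_iff.1 hw) j (Finset.mem_univ j)
    simp [this]
  · have hw' : ((∑ j, S.pathWeight θ k y (a j) : ℝ≥0) : ℝ) ≠ 0 := by exact_mod_cast hw
    have hn (j : Fin N) : (S.pathWeight θ k y (a j) : ℝ) =
        (∑ j, S.pathWeight θ k y (a j) : ℝ≥0) *
          (normalized (fun j => S.pathWeight θ k y (a j)) j : ℝ) := by
      rw [normalized, if_neg hw, NNReal.coe_div]
      field_simp
    have e1 : ∑ j, (S.pathWeight θ k y (a j) : ℝ) * β (a j (Fin.last k)) =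
        (∑ j, S.pathWeight θ k y (a j) : ℝ≥0) *
          ∑ j, (normalized (fun j => S.pathWeight θ k y (a j)) j : ℝ) * β (a j (Fin.last k)) := by
      rw [Finset.mul_sum]
      exact Finset.sum_congr rfl fun j _ => by rw [hn j]; ring
    have e2 : ∑ j, (S.pathWeight θ k y (a j) : ℝ) * β (a j (Fin.last k)) * r (a j) =
        (∑ j, S.pathWeight θ k y (a j) : ℝ≥0) *
          ∑ j, (normalized (fun j => S.pathWeight θ k y (a j)) j : ℝ) * β (a j (Fin.last k)) *
            r (a j) := by
      rw [Finset.mul_sum]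
      exact Finset.sum_congr rfl fun j _ => by rw [hn j]; ring
    rw [e1, e2, particleMean, mul_left_comm, div_mul_cancel₀ _ hpos.ne']

end Particles

/-! ### One step of the particle approximation -/

section CompProd

variable {α β : Type*} [MeasurableSpace α] [MeasurableSpace β] {m : Measure α}
  [IsProbabilityMeasure m] {κ : Kernel α β} [IsMarkovKernel κ]

lemma eLpNorm_compProd_le {f : α × β → ℝ} (hf : Measurable f) {p : ℕ} (hp : p ≠ 0) {C : ℝ≥0∞}
    (h : ∀ a, eLpNorm (fun b => f (a, b)) p (κ a) ≤ C) : eLpNorm f p (m ⊗ₘ κ) ≤ C := by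
  have hp' : 0 < (p : ℝ) := by exact_mod_cast Nat.pos_of_ne_zero hp
  simp only [eLpNorm_natCast_eq _ hp] at h ⊢
  rw [Measure.lintegral_compProd (by fun_prop)]
  have h1 (a : α) : ∫⁻ b, ‖f (a, b)‖ₑ ^ p ∂(κ a) ≤ C ^ (p : ℝ) := by
    have := ENNReal.rpow_le_rpow (h a) hp'.le
    rwa [← ENNReal.rpow_mul, one_div_mul_cancel hp'.ne', ENNReal.rpow_one] at this
  calc _ ≤ (∫⁻ _, C ^ (p : ℝ) ∂m) ^ (1 / (p : ℝ)) := by gcongr with a; exact h1 a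
    _ = C := by
      rw [lintegral_const, measure_univ, mul_one, ← ENNReal.rpow_mul, mul_one_div_cancel hp'.ne',
        ENNReal.rpow_one]

/-- The triangle inequality along one step of a Markov chain. -/
lemma eLpNorm_snd_sub_le {f : α → ℝ} (hf : Measurable f) {g : β → ℝ} (hg : Measurable g) (c : ℝ)
    {p : ℕ} (hp : p ≠ 0) {C D : ℝ≥0∞} (h1 : eLpNorm (fun a => f a - c) p m ≤ C)
    (h2 : ∀ a, eLpNorm (fun b => g b - f a) p (κ a) ≤ D) :
    eLpNorm (fun b => g b - c) p (m ⊗ₘ κ).snd ≤ C + D := by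
  rw [Measure.snd, eLpNorm_map_measure (hg.sub_const c).aestronglyMeasurable (by fun_prop)]
  have e : (fun b => g b - c) ∘ Prod.snd =
      (fun z : α × β => f z.1 - c) + fun z : α × β => g z.2 - f z.1 := by
    ext z; simp
  rw [e]
  refine (eLpNorm_add_le (Measurable.aestronglyMeasurable (by fun_prop))
    (Measurable.aestronglyMeasurable (by fun_prop))
    (by exact_mod_cast Nat.one_le_iff_ne_zero.2 hp)).trans (add_le_add ?_ ?_)
  · have : eLpNorm (fun z : α × β => f z.1 - c) p (m ⊗ₘ κ) =
        eLpNorm (fun a => f a - c) p (m ⊗ₘ κ).fst := by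
      rw [Measure.fst, eLpNorm_map_measure (hf.sub_const c).aestronglyMeasurable (by fun_prop)]
      rfl
    rw [this, Measure.fst_compProd]
    exact h1
  · exact eLpNorm_compProd_le (by fun_prop) hp h2

lemma abs_integral_snd_sub_le {f : α → ℝ} (hf : Measurable f) {g : β → ℝ} (hg : Measurable g)
    {A B : ℝ} (hfA : ∀ a, |f a| ≤ A) (hgB : ∀ b, |g b| ≤ B) (c : ℝ) {C D : ℝ}
    (h1 : |∫ a, (f a - c) ∂m| ≤ C) (h2 : ∀ a, |∫ b, (g b - f a) ∂(κ a)| ≤ D) :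
    |∫ b, (g b - c) ∂(m ⊗ₘ κ).snd| ≤ C + D := by
  have hgi : Integrable (fun z : α × β => g z.2) (m ⊗ₘ κ) :=
    integrable_of_bdd (by fun_prop) fun z => hgB z.2
  have hfi : Integrable (fun z : α × β => f z.1) (m ⊗ₘ κ) :=
    integrable_of_bdd (by fun_prop) fun z => hfA z.1
  have hfc : Integrable (fun z : α × β => f z.1 - c) (m ⊗ₘ κ) := hfi.sub (integrable_const _)
  have hgf : Integrable (fun z : α × β => g z.2 - f z.1) (m ⊗ₘ κ) := hgi.sub hfi
  have e : ∫ b, (g b - c) ∂(m ⊗ₘ κ).snd =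
      ∫ a, (f a - c) ∂m + ∫ a, ∫ b, (g b - f a) ∂(κ a) ∂m := by
    rw [Measure.snd, integral_map (by fun_prop) (hg.sub_const c).aestronglyMeasurable]
    have e1 : ∫ z : α × β, (g z.2 - c) ∂(m ⊗ₘ κ) =
        ∫ z : α × β, (f z.1 - c) ∂(m ⊗ₘ κ) + ∫ z : α × β, (g z.2 - f z.1) ∂(m ⊗ₘ κ) := by
      rw [← integral_add hfc hgf]
      congr 1
      ext z
      ring
    rw [e1, Measure.integral_compProd hfc, Measure.integral_compProd hgf]
    simp
  rw [e]
  refine (abs_add_le _ _).trans (add_le_add h1 ?_)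
  have := norm_integral_le_of_norm_le_const (μ := m) (f := fun a => ∫ b, (g b - f a) ∂(κ a))
    (ae_of_all _ h2)
  simpa using this

end CompProd

lemma IsRNDensity.integral_eq {α : Type*} [MeasurableSpace α] {f : α → ℝ≥0} {m m₀ : Measure α}
    (h : IsRNDensity f m m₀) (F : α → ℝ) : ∫ x, F x ∂m = ∫ x, f x * F x ∂m₀ := by
  rw [h.2, integral_withDensity_eq_integral_smul h.1]
  rfl

section Propagation

variable {Θ X 𝓨 : Type*} [MeasurableSpace X] [MeasurableSpace 𝓨]
  {M : StateSpaceModel Θ X 𝓨} {S : Proposal M} {N : ℕ} [NeZero N] {θ : Θ} {σm σp d : ℝ}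

lemma pathWeight_le (hA : S.A2) (k : ℕ) (y : 𝓨) (x : Fin (k + 1) → X) :
    (S.pathWeight θ k y x : ℝ) ≤ (S.normW θ k y).toReal := by
  have h1 : (S.pathWeight θ k y x : ℝ≥0∞) ≤ S.normW θ k y := by
    cases k with
    | zero => exact le_iSup (fun x => (S.W₀ θ y x : ℝ≥0∞)) (x 0)
    | succ k => exact le_iSup₂ (f := fun x x' => (S.W θ k y x x' : ℝ≥0∞)) _ _
  have := ENNReal.toReal_mono (hA k θ y).ne h1
  simpa using this

variable (S θ σm σp d) in
/-- The bound for the ratio of an importance weight, multiplied by a future likelihood, to its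
conditional mean. -/
noncomputable def weightRatio (k : ℕ) (y : 𝓨) : ℝ :=
  (S.normW θ k y).toReal / (∫ x, (M.g θ x y : ℝ) ∂M.μ) *
    ((if k = 0 then 1 / d else 1 / σm) * (σp / σm))

lemma pathWeight_snoc (k : ℕ) (y : 𝓨) (x : Fin (k + 1) → X) (x' : X) :
    S.pathWeight θ (k + 1) y (Fin.snoc x x') =
      M.g θ x' y * S.dR θ k y (x (Fin.last k)) x' := by
  simp only [Proposal.pathWeight, Proposal.W, Fin.snoc_castSucc, Fin.snoc_last]

lemma integral_pathWeight_snoc (k : ℕ) (y : 𝓨) (β : X → ℝ) (r : (Fin (k + 2) → X) → ℝ)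
    (x : Fin (k + 1) → X) :
    ∫ x', S.pathWeight θ (k + 1) y (Fin.snoc x x') * β x' * r (Fin.snoc x x')
        ∂(S.R θ k (y, x (Fin.last k))) =
      ∫ x', filterDensity M θ y (x (Fin.last k)) x' * β x' * r (Fin.snoc x x') ∂M.μ := by
  have h1 := (S.dR_density θ k y (x (Fin.last k))).integral_eq
    fun x' => M.g θ x' y * β x' * r (Fin.snoc x x')
  have h2 := (M.q_density θ (x (Fin.last k))).integral_eq
    fun x' => M.g θ x' y * β x' * r (Fin.snoc x x')
  rw [h1] at h2
  simp only [pathWeight_snoc, filterDensity, NNReal.coe_mul]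
  refine Eq.trans ?_ (h2.trans ?_)
  · congr 1; ext x'; ring
  · congr 1; ext x'; ring

lemma measurable_pathWeight_right (k : ℕ) (y : 𝓨) :
    Measurable fun x : Fin (k + 1) → X => (S.pathWeight θ k y x : ℝ) :=
  ((S.measurable_pathWeight θ k).comp measurable_prodMk_left).coe_nnreal_real

namespace StrongMixing

variable (h : StrongMixing M θ σm σp) (hA : S.A2) (y : ℕ → 𝓨)
include h hA

omit [NeZero N] in
lemma weight_mul_le {k : ℕ} {β : X → ℝ} (hβ : Comparable σm σp β) {c : ℝ}
    (hc : ∀ x, β x ≤ σp * c) (y : 𝓨) (x : Fin (k + 1) → X) :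
    S.pathWeight θ k y x * β (x (Fin.last k)) ≤ (S.normW θ k y).toReal * (σp * c) :=
  mul_le_mul (pathWeight_le hA k y x) (hc _) (hβ.pos h.pos _).le ENNReal.toReal_nonneg

omit [NeZero N] in
lemma abs_weight_mul_mul_le {k : ℕ} {β : X → ℝ} (hβ : Comparable σm σp β) {c : ℝ}
    (hc : ∀ x, β x ≤ σp * c) (y : 𝓨) {r : (Fin (k + 1) → X) → ℝ} {D : ℝ} (hD : ∀ x, |r x| ≤ D)
    (x : Fin (k + 1) → X) :
    |S.pathWeight θ k y x * β (x (Fin.last k)) * r x| ≤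
      (S.normW θ k y).toReal * (σp * c) * D := by
  have h0 : 0 ≤ S.pathWeight θ k y x * β (x (Fin.last k)) :=
    mul_nonneg NNReal.zero_le_coe (hβ.pos h.pos _).le
  have h1 := h.weight_mul_le hA hβ hc y x
  rw [abs_mul, abs_of_nonneg h0]
  exact mul_le_mul h1 (hD x) (abs_nonneg _) (h0.trans h1)

/-- The weighted mean at time `k + 1` targets the weighted mean at time `k` of the backward
conditional mean. -/
lemma integral_mixtureKernel_weight {k : ℕ} {β : X → ℝ} (hβ : Comparable σm σp β)
    {r : (Fin (k + 2) → X) → ℝ} (hr : Measurable r) {lo hi : ℝ}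
    (hrm : ∀ x, r x ∈ Set.Icc lo hi) (a : Fin N → Fin (k + 1) → X) :
    ∫ x, S.pathWeight θ (k + 1) (y (k + 1)) x * β (x (Fin.last (k + 1))) * r x
        ∂(mixtureKernel S N θ k (y, a)) =
      particleMean S N θ k (y k) (backward M θ (y (k + 1)) β)
          (backwardMean M θ (y (k + 1)) β r) a *
        ∑ j, (normalized (fun j => S.pathWeight θ k (y k) (a j)) j : ℝ) *
          backward M θ (y (k + 1)) β (a j (Fin.last k)) := by
  obtain ⟨c, _, hc⟩ := hβ.exists_mem
  obtain ⟨D, hD⟩ := exists_abs_le_of_mem_Icc hrm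
  have hm : Measurable fun x : Fin (k + 2) → X =>
      S.pathWeight θ (k + 1) (y (k + 1)) x * β (x (Fin.last (k + 1))) * r x :=
    ((measurable_pathWeight_right (k + 1) _).mul
      (hβ.measurable.comp (measurable_pi_apply _))).mul hr
  rw [integral_mixtureKernel S N θ k y a hm
    (h.abs_weight_mul_mul_le hA hβ (fun x => (hc x).2) _ hD), particleMean,
    div_mul_cancel₀ _ ((h.comparable_backward _ hβ).sum_normalized_pos h.pos
      (fun j => S.pathWeight θ k (y k) (a j)) fun j => a j (Fin.last k)).ne']
  refine Finset.sum_congr rfl fun j _ => ?_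
  simp only [Fin.snoc_last]
  rw [integral_pathWeight_snoc, mul_assoc, h.backward_mul_backwardMean _ hβ]

lemma integral_mixtureKernel_weight_one {k : ℕ} {β : X → ℝ} (hβ : Comparable σm σp β)
    (a : Fin N → Fin (k + 1) → X) :
    ∫ x, S.pathWeight θ (k + 1) (y (k + 1)) x * β (x (Fin.last (k + 1)))
        ∂(mixtureKernel S N θ k (y, a)) =
      ∑ j, (normalized (fun j => S.pathWeight θ k (y k) (a j)) j : ℝ) *
          backward M θ (y (k + 1)) β (a j (Fin.last k)) := by
  have h1 := h.integral_mixtureKernel_weight hA y hβ (k := k) (r := fun _ => 1) measurable_const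
    (lo := 1) (hi := 1) (by simp) a
  simp only [mul_one] at h1
  have h2 : particleMean S N θ k (y k) (backward M θ (y (k + 1)) β)
      (backwardMean M θ (y (k + 1)) β fun _ : Fin (k + 2) → X => 1) a = 1 := by
    have := particleMean_mem (S := S) (N := N) (θ := θ) h.pos (y k)
      (h.comparable_backward (y (k + 1)) hβ)
      (h.backwardMean_mem (k := k) (y (k + 1)) hβ (r := fun _ => 1) measurable_const (lo := 1)
        (hi := 1) (by simp)) a
    exact le_antisymm this.2 this.1
  rw [h1, h2, one_mul]

lemma ratioEstimator_succ {k : ℕ} {β : X → ℝ} (hβ : Comparable σm σp β) {c : ℝ}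
    (hc : ∀ x, β x ≤ σp * c) {r : (Fin (k + 2) → X) → ℝ} (hr : Measurable r) {lo δ : ℝ}
    (hrm : ∀ x, r x ∈ Set.Icc lo (lo + δ)) (a : Fin N → Fin (k + 1) → X) :
    RatioEstimator (mixtureKernel S N θ k (y, a)) N
      (fun x => S.pathWeight θ (k + 1) (y (k + 1)) x * β (x (Fin.last (k + 1)))) r
      (particleMean S N θ (k + 1) (y (k + 1)) β r) lo δ
      ((S.normW θ (k + 1) (y (k + 1))).toReal * (σp * c)) where
  measurable_w := (measurable_pathWeight_right (k + 1) _).mul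
    (hβ.measurable.comp (measurable_pi_apply _))
  measurable_r := hr
  measurable_T := measurable_particleMean S N θ (k + 1) _ hβ.measurable hr
  nonneg x := mul_nonneg NNReal.zero_le_coe (hβ.pos h.pos _).le
  le := h.weight_mul_le hA hβ hc _
  pos := by
    rw [h.integral_mixtureKernel_weight_one hA y hβ]
    exact (h.comparable_backward _ hβ).sum_normalized_pos h.pos _ _
  mem_r := hrm
  mem_T := particleMean_mem h.pos _ hβ hrm
  mean := particleMean_mul_sum h.pos _ hβ r

omit hA in
lemma weightRatio_nonneg (hd0 : 0 < d) (k : ℕ) (y : 𝓨) : 0 ≤ weightRatio S θ σm σp d k y := by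
  have h1 := h.pos
  have h2 := h.σp_pos
  have h3 := h.g_pos y
  unfold weightRatio
  split_ifs <;> positivity

omit hA in
lemma div_le_weightRatio_aux {W σ G b c : ℝ} (hW : 0 ≤ W) (hσ : 0 < σ) (hG : 0 < G) (hc : 0 < c)
    (hb : σ * (σm * c * G) ≤ b) : W * (σp * c) / b ≤ W / G * (1 / σ * (σp / σm)) := by
  have h1 := h.pos
  have h2 := h.σp_pos
  calc W * (σp * c) / b ≤ W * (σp * c) / (σ * (σm * c * G)) := by gcongr
    _ = _ := by field_simp

/-- The conditional mean of a weight at time `k + 1` is at least `σm` times the filter mass. -/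
lemma div_le_weightRatio_succ {k : ℕ} {β : X → ℝ} (hβ : Comparable σm σp β) {c : ℝ} (hc0 : 0 < c)
    (hc : ∀ x, σm * c ≤ β x) (a : Fin N → Fin (k + 1) → X) :
    (S.normW θ (k + 1) (y (k + 1))).toReal * (σp * c) /
        ∫ x, S.pathWeight θ (k + 1) (y (k + 1)) x * β (x (Fin.last (k + 1)))
          ∂(mixtureKernel S N θ k (y, a)) ≤
      weightRatio S θ σm σp d (k + 1) (y (k + 1)) := by
  rw [weightRatio, if_neg k.succ_ne_zero]
  refine h.div_le_weightRatio_aux ENNReal.toReal_nonneg h.pos (h.g_pos _) hc0 ?_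
  rw [h.integral_mixtureKernel_weight_one hA y hβ]
  have h1 := h.le_integral_g_mul (y (k + 1)) hβ hc
  calc σm * (σm * c * ∫ x, (M.g θ x (y (k + 1)) : ℝ) ∂M.μ)
      ≤ σm * ∫ x, M.g θ x (y (k + 1)) * β x ∂M.μ := mul_le_mul_of_nonneg_left h1 h.pos.le
    _ = ∑ j, (normalized (fun j => S.pathWeight θ k (y k) (a j)) j : ℝ) *
          (σm * ∫ x, M.g θ x (y (k + 1)) * β x ∂M.μ) := by
        rw [← Finset.sum_mul, sum_normalized_real, one_mul]
    _ ≤ _ := Finset.sum_le_sum fun j _ =>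
        mul_le_mul_of_nonneg_left (h.backward_mem _ hβ _).1 NNReal.zero_le_coe

omit h hA [NeZero N] in
lemma integral_initial_weight (β : X → ℝ) (hβ : Measurable β) {r : (Fin (0 + 1) → X) → ℝ}
    (hr : Measurable r) :
    ∫ x, S.pathWeight θ 0 (y 0) x * β (x (Fin.last 0)) * r x
        ∂(Measure.pi fun _ : Fin (0 + 1) => S.ς) =
      ∫ x, M.dν x * M.g θ x (y 0) * β x * r (fun _ => x) ∂M.μ := by
  have hm : Measurable fun x : Fin (0 + 1) → X =>
      S.pathWeight θ 0 (y 0) x * β (x (Fin.last 0)) * r x :=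
    ((measurable_pathWeight_right 0 _).mul (hβ.comp (measurable_pi_apply _))).mul hr
  have hmp := measurePreserving_const_fin_one S.ς
  rw [← hmp.map_eq, integral_map hmp.measurable.aemeasurable hm.aestronglyMeasurable]
  have h1 := S.dς_density.integral_eq fun x => M.g θ x (y 0) * β x * r fun _ => x
  have h2 := M.dν_density.integral_eq fun x => M.g θ x (y 0) * β x * r fun _ => x
  rw [h1] at h2
  refine Eq.trans ?_ (h2.trans ?_)
  · congr 1; ext x; simp only [Proposal.pathWeight, Proposal.W₀, NNReal.coe_mul]; ring
  · congr 1; ext x; ring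

variable (hd0 : 0 < d) (hd : ∀ x, d ≤ M.dν x)
include hd0 hd

omit hA hd0 in
lemma le_integral_initial {β : X → ℝ} (hβ : Comparable σm σp β) {c : ℝ}
    (hc : ∀ x, σm * c ≤ β x) (hd0 : 0 < d) :
    d * (σm * c * ∫ x, (M.g θ x (y 0) : ℝ) ∂M.μ) ≤
      ∫ x, M.dν x * M.g θ x (y 0) * β x ∂M.μ := by
  have hpos := h.integral_pathMeasure_pos hd0 hd y (k := 0) hβ
  rw [integral_pathMeasure_zero M θ y (F := fun x => β (x (Fin.last 0)))
    (hβ.measurable.comp (measurable_pi_apply _))] at hpos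
  have hi : Integrable (fun x => M.dν x * M.g θ x (y 0) * β x) M.μ := by
    by_contra hc
    rw [integral_undef hc] at hpos
    exact lt_irrefl _ hpos
  refine (mul_le_mul_of_nonneg_left (h.le_integral_g_mul (y 0) hβ hc) hd0.le).trans ?_
  rw [← integral_const_mul]
  refine integral_mono ((h.integrable_g_mul (y 0) hβ).const_mul _) hi fun x => ?_
  simp only
  rw [mul_assoc]
  exact mul_le_mul_of_nonneg_right (hd x)
    (mul_nonneg NNReal.zero_le_coe (hβ.pos h.pos x).le)

lemma ratioEstimator_zero {β : X → ℝ} (hβ : Comparable σm σp β) {c : ℝ} (hc0 : 0 < c)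
    (hc : ∀ x, β x ∈ Set.Icc (σm * c) (σp * c)) {r : (Fin (0 + 1) → X) → ℝ} (hr : Measurable r)
    {lo δ : ℝ} (hrm : ∀ x, r x ∈ Set.Icc lo (lo + δ)) :
    RatioEstimator (Measure.pi fun _ : Fin (0 + 1) => S.ς) N
      (fun x => S.pathWeight θ 0 (y 0) x * β (x (Fin.last 0))) r
      (particleMean S N θ 0 (y 0) β r) lo δ ((S.normW θ 0 (y 0)).toReal * (σp * c)) where
  measurable_w := (measurable_pathWeight_right 0 _).mul
    (hβ.measurable.comp (measurable_pi_apply _))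
  measurable_r := hr
  measurable_T := measurable_particleMean S N θ 0 _ hβ.measurable hr
  nonneg x := mul_nonneg NNReal.zero_le_coe (hβ.pos h.pos _).le
  le := h.weight_mul_le hA hβ (fun x => (hc x).2) _
  pos := by
    have h1 := integral_initial_weight (S := S) (θ := θ) y β hβ.measurable
      (r := fun _ => 1) measurable_const
    simp only [mul_one] at h1
    rw [h1]
    refine lt_of_lt_of_le ?_ (h.le_integral_initial y hd hβ (fun x => (hc x).1) hd0)
    exact mul_pos hd0 (mul_pos (mul_pos h.pos hc0) (h.g_pos _))
  mem_r := hrm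
  mem_T := particleMean_mem h.pos _ hβ hrm
  mean := particleMean_mul_sum h.pos _ hβ r

omit hA in
lemma div_le_weightRatio_zero {β : X → ℝ} (hβ : Comparable σm σp β) {c : ℝ} (hc0 : 0 < c)
    (hc : ∀ x, σm * c ≤ β x) :
    (S.normW θ 0 (y 0)).toReal * (σp * c) /
        ∫ x, S.pathWeight θ 0 (y 0) x * β (x (Fin.last 0))
          ∂(Measure.pi fun _ : Fin (0 + 1) => S.ς) ≤ weightRatio S θ σm σp d 0 (y 0) := by
  rw [weightRatio, if_pos rfl]
  refine h.div_le_weightRatio_aux ENNReal.toReal_nonneg hd0 (h.g_pos _) hc0 ?_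
  have h1 := integral_initial_weight (S := S) (θ := θ) y β hβ.measurable
    (r := fun _ => 1) measurable_const
  simp only [mul_one] at h1
  rw [h1]
  exact h.le_integral_initial y hd hβ hc hd0

end StrongMixing

end Propagation

/-! ### Accumulation of the Monte Carlo error -/

section ParticleError

variable {Θ X 𝓨 : Type*} [MeasurableSpace X] [MeasurableSpace 𝓨]
  {M : StateSpaceModel Θ X 𝓨} {S : Proposal M} {N : ℕ} [NeZero N] {θ : Θ} {σm σp d : ℝ}

lemma particleLaw_succ_apply (k : ℕ) (y : ℕ → 𝓨) :
    particleLaw S N θ (k + 1) y =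
      (particleLaw S N θ k y ⊗ₘ
        (kernelPi fun _ : Fin N => mixtureKernel S N θ k).sectR y).snd := by
  rw [particleLaw, Kernel.snd_apply, Kernel.compProd_apply_eq_compProd_sectR]
  rfl

lemma kernelPi_sectR_apply (k : ℕ) (y : ℕ → 𝓨) (a : Fin N → Fin (k + 1) → X) :
    (kernelPi fun _ : Fin N => mixtureKernel S N θ k).sectR y a =
      Measure.pi fun _ : Fin N => mixtureKernel S N θ k (y, a) := rfl

namespace StrongMixing

variable (h : StrongMixing M θ σm σp) (y : ℕ → 𝓨)
include h

lemma rho_nonneg : 0 ≤ 1 - σm / σp := by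
  rw [sub_nonneg, div_le_one h.σp_pos]
  exact h.le_one.trans h.one_le

/-- Backward conditional means of functions of the components from `i` on contract as long as the
time of the conditioning is before `i`. -/
lemma exists_backwardMean_mem_pow (i k : ℕ) (y : 𝓨) {β : X → ℝ} (hβ : Comparable σm σp β)
    {r : (Fin (k + 2) → X) → ℝ} (hr : Measurable r) (hdep : DependsFrom i r) {lo δ : ℝ}
    (hrm : ∀ x, r x ∈ Set.Icc lo (lo + (1 - σm / σp) ^ (i - (k + 1)) * δ)) :
    ∃ lo', ∀ x, backwardMean M θ y β r x ∈ Set.Icc lo' (lo' + (1 - σm / σp) ^ (i - k) * δ) := by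
  rcases lt_or_ge k i with hk | hk
  · obtain ⟨lo', hlo⟩ := h.exists_backwardMean_mem hk y hβ hr hdep hrm
    refine ⟨lo', fun x => ?_⟩
    rw [show i - k = i - (k + 1) + 1 by omega, pow_succ', mul_assoc]
    exact hlo x
  · refine ⟨lo, fun x => ?_⟩
    have e : i - k = i - (k + 1) := by omega
    rw [e]
    exact h.backwardMean_mem y hβ hr hrm x

variable (hA : S.A2) (hd0 : 0 < d) (hd : ∀ x, d ≤ M.dν x)
include hA hd0 hd

/-- The `L^p` error of the weighted particle mean at time `k` for a function of the components from
`i` on: the error made at time `l` is multiplied by `ρ ^ (i - l)`. -/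
theorem eLpNorm_particleMean_sub_le (i : ℕ) {p : ℕ} (hp : p ≠ 0) {δ : ℝ} (hδ' : 0 ≤ δ)
    (k : ℕ) :
    ∀ {β : X → ℝ}, Comparable σm σp β → ∀ {r : (Fin (k + 1) → X) → ℝ}, Measurable r →
      DependsFrom i r → ∀ {lo : ℝ},
      (∀ x, r x ∈ Set.Icc lo (lo + (1 - σm / σp) ^ (i - k) * δ)) →
      eLpNorm (fun a => particleMean S N θ k (y k) β r a - tiltedMean M θ y β r) p
          (particleLaw S N θ k y) ≤
        ENNReal.ofReal (2 * momentConst p / √N * ∑ l ∈ Finset.range (k + 1),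
          (1 - σm / σp) ^ (i - l) * δ * weightRatio S θ σm σp d l (y l)) := by
  have hK : 0 ≤ momentConst p := zero_le_one.trans (one_le_momentConst p)
  induction k with
  | zero =>
    intro β hβ r hr hdep lo hrm
    obtain ⟨c, hc0, hc⟩ := hβ.exists_mem
    have hR := h.ratioEstimator_zero (N := N) hA y hd0 hd hβ hc0 hc hr hrm
    have hw := h.div_le_weightRatio_zero (S := S) y hd0 hd hβ hc0 fun x => (hc x).1
    have hδ := hR.nonneg_δ
    have h1 := integral_initial_weight (S := S) (θ := θ) y β hβ.measurable
      (r := fun _ => 1) measurable_const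
    simp only [mul_one] at h1
    have hcen := integral_initial_weight (S := S) (θ := θ) y β hβ.measurable hr
    have hpos := hR.pos
    have := hR.eLpNorm_sub_le (c := tiltedMean M θ y β r) (by
      rw [tiltedMean_zero y hβ.measurable hr, hcen, h1, div_mul_cancel₀]
      rw [← h1]; exact hpos.ne') hp
    refine this.trans (ENNReal.ofReal_le_ofReal ?_)
    have e : ∑ l ∈ Finset.range (0 + 1), (1 - σm / σp) ^ (i - l) * δ *
        weightRatio S θ σm σp d l (y l) =
          (1 - σm / σp) ^ (i - 0) * δ * weightRatio S θ σm σp d 0 (y 0) := by simp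
    rw [e, mul_div_right_comm]
    gcongr
  | succ k ih =>
    intro β hβ r hr hdep lo hrm
    obtain ⟨c, hc0, hc⟩ := hβ.exists_mem
    have hβ' := h.comparable_backward (y (k + 1)) hβ
    have hr' := measurable_backwardMean (M := M) (θ := θ) (y (k + 1)) hβ.measurable hr
    obtain ⟨lo', hrm'⟩ := h.exists_backwardMean_mem_pow i k (y (k + 1)) hβ hr hdep hrm
    have hprev := ih hβ' hr' (dependsFrom_backwardMean (y (k + 1)) β hdep) hrm'
    rw [← h.tiltedMean_succ y hβ hr hrm] at hprev
    have hwr := h.weightRatio_nonneg (S := S) hd0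
    have hρ := h.rho_nonneg
    have hδ : 0 ≤ (1 - σm / σp) ^ (i - (k + 1)) * δ := mul_nonneg (pow_nonneg hρ _) hδ'
    have hstep (a : Fin N → Fin (k + 1) → X) :
        eLpNorm (fun b => particleMean S N θ (k + 1) (y (k + 1)) β r b -
          particleMean S N θ k (y k) (backward M θ (y (k + 1)) β)
            (backwardMean M θ (y (k + 1)) β r) a) p
          ((kernelPi fun _ : Fin N => mixtureKernel S N θ k).sectR y a) ≤
        ENNReal.ofReal (2 * momentConst p / √N * ((1 - σm / σp) ^ (i - (k + 1)) * δ *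
          weightRatio S θ σm σp d (k + 1) (y (k + 1)))) := by
      have hR := h.ratioEstimator_succ hA y hβ (fun x => (hc x).2) hr hrm a
      have hw := h.div_le_weightRatio_succ (d := d) hA y hβ hc0 (fun x => (hc x).1) a
      rw [kernelPi_sectR_apply]
      refine (hR.eLpNorm_sub_le ?_ hp).trans (ENNReal.ofReal_le_ofReal ?_)
      · rw [h.integral_mixtureKernel_weight hA y hβ hr hrm,
          h.integral_mixtureKernel_weight_one hA y hβ]
      · rw [mul_div_right_comm]
        gcongr
    rw [particleLaw_succ_apply]
    refine (eLpNorm_snd_sub_le (measurable_particleMean S N θ k _ hβ'.measurable hr')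
      (measurable_particleMean S N θ (k + 1) _ hβ.measurable hr) _ hp hprev hstep).trans ?_
    rw [← ENNReal.ofReal_add, ← mul_add, ← Finset.sum_range_succ]
    · exact mul_nonneg (by positivity) (Finset.sum_nonneg fun l _ =>
        mul_nonneg (mul_nonneg (pow_nonneg hρ _) hδ') (hwr _ _))
    · exact mul_nonneg (by positivity) (mul_nonneg hδ (hwr _ _))

/-- The bias of the weighted particle mean at time `k` for a function of the components from `i`
on. -/
theorem abs_integral_particleMean_sub_le (i : ℕ) {δ : ℝ} (hδ' : 0 ≤ δ) (k : ℕ) :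
    ∀ {β : X → ℝ}, Comparable σm σp β → ∀ {r : (Fin (k + 1) → X) → ℝ}, Measurable r →
      DependsFrom i r → ∀ {lo : ℝ},
      (∀ x, r x ∈ Set.Icc lo (lo + (1 - σm / σp) ^ (i - k) * δ)) →
      |∫ a, (particleMean S N θ k (y k) β r a - tiltedMean M θ y β r) ∂(particleLaw S N θ k y)| ≤
        3 * momentConst 2 ^ 2 / N * ∑ l ∈ Finset.range (k + 1),
          (1 - σm / σp) ^ (i - l) * δ * weightRatio S θ σm σp d l (y l) ^ 2 := by
  have hρ := h.rho_nonneg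
  have h1 := h.pos
  have h2 := h.σp_pos
  induction k with
  | zero =>
    intro β hβ r hr hdep lo hrm
    obtain ⟨c, hc0, hc⟩ := hβ.exists_mem
    have hR := h.ratioEstimator_zero (N := N) hA y hd0 hd hβ hc0 hc hr hrm
    have hw := h.div_le_weightRatio_zero (S := S) y hd0 hd hβ hc0 fun x => (hc x).1
    have hδ := hR.nonneg_δ
    have h1 := integral_initial_weight (S := S) (θ := θ) y β hβ.measurable
      (r := fun _ => 1) measurable_const
    simp only [mul_one] at h1
    have hcen := integral_initial_weight (S := S) (θ := θ) y β hβ.measurable hr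
    have hpos := hR.pos
    have := hR.abs_integral_sub_le (c := tiltedMean M θ y β r) (by
      rw [tiltedMean_zero y hβ.measurable hr, hcen, h1, div_mul_cancel₀]
      rw [← h1]; exact hpos.ne')
    refine this.trans ?_
    have e : ∑ l ∈ Finset.range (0 + 1), (1 - σm / σp) ^ (i - l) * δ *
        weightRatio S θ σm σp d l (y l) ^ 2 =
          (1 - σm / σp) ^ (i - 0) * δ * weightRatio S θ σm σp d 0 (y 0) ^ 2 := by simp
    rw [e, mul_div_right_comm]
    gcongr
  | succ k ih =>
    intro β hβ r hr hdep lo hrm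
    obtain ⟨c, hc0, hc⟩ := hβ.exists_mem
    have hβ' := h.comparable_backward (y (k + 1)) hβ
    have hr' := measurable_backwardMean (M := M) (θ := θ) (y (k + 1)) hβ.measurable hr
    obtain ⟨lo', hrm'⟩ := h.exists_backwardMean_mem_pow i k (y (k + 1)) hβ hr hdep hrm
    have hprev := ih hβ' hr' (dependsFrom_backwardMean (y (k + 1)) β hdep) hrm'
    rw [← h.tiltedMean_succ y hβ hr hrm] at hprev
    have hδ : 0 ≤ (1 - σm / σp) ^ (i - (k + 1)) * δ := mul_nonneg (pow_nonneg hρ _) hδ'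
    have hstep (a : Fin N → Fin (k + 1) → X) :
        |∫ b, (particleMean S N θ (k + 1) (y (k + 1)) β r b -
          particleMean S N θ k (y k) (backward M θ (y (k + 1)) β)
            (backwardMean M θ (y (k + 1)) β r) a)
          ∂((kernelPi fun _ : Fin N => mixtureKernel S N θ k).sectR y a)| ≤
        3 * momentConst 2 ^ 2 / N * ((1 - σm / σp) ^ (i - (k + 1)) * δ *
          weightRatio S θ σm σp d (k + 1) (y (k + 1)) ^ 2) := by
      have hR := h.ratioEstimator_succ hA y hβ (fun x => (hc x).2) hr hrm a
      have hw := h.div_le_weightRatio_succ (d := d) hA y hβ hc0 (fun x => (hc x).1) a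
      have hpos := hR.pos
      rw [kernelPi_sectR_apply]
      refine (hR.abs_integral_sub_le ?_).trans ?_
      · rw [h.integral_mixtureKernel_weight hA y hβ hr hrm,
          h.integral_mixtureKernel_weight_one hA y hβ]
      · rw [mul_div_right_comm]
        gcongr
    obtain ⟨A, hA1⟩ := exists_abs_le_of_mem_Icc
      (particleMean_mem (S := S) (N := N) (θ := θ) h.pos (y k) hβ' hrm')
    obtain ⟨B, hB1⟩ := exists_abs_le_of_mem_Icc
      (particleMean_mem (S := S) (N := N) (θ := θ) h.pos (y (k + 1)) hβ hrm)
    rw [particleLaw_succ_apply]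
    refine (abs_integral_snd_sub_le (measurable_particleMean S N θ k _ hβ'.measurable hr')
      (measurable_particleMean S N θ (k + 1) _ hβ.measurable hr) hA1 hB1 _ hprev hstep).trans ?_
    rw [← mul_add, ← Finset.sum_range_succ]

end StrongMixing

end ParticleError

/-! ### The fixed-lag approximation for given observations -/

section FixedLagTerm

variable {Θ X 𝓨 : Type*} [MeasurableSpace X] [MeasurableSpace 𝓨]
  {M : StateSpaceModel Θ X 𝓨} (S : Proposal M) (N : ℕ) [NeZero N] (θ : Θ)

/-- The law of the particle paths and of the selected indices at time `k`, given the
observations. -/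
noncomputable def systemLaw (k : ℕ) :
    Kernel (ℕ → 𝓨) ((Fin N → Fin (k + 1) → X) × (Fin N → Fin N)) :=
  particleLaw S N θ k ⊗ₖ (selection S N θ k).comap
    (fun a : (ℕ → 𝓨) × (Fin N → Fin (k + 1) → X) => (a.1 k, a.2)) (by fun_prop)

instance (k : ℕ) : IsMarkovKernel (systemLaw S N θ k) := by
  unfold systemLaw; infer_instance

variable {S N θ}

lemma systemLaw_apply (k : ℕ) (y : ℕ → 𝓨) :
    systemLaw S N θ k y = particleLaw S N θ k y ⊗ₘ
      ((selection S N θ k).comap (fun a : (ℕ → 𝓨) × (Fin N → Fin (k + 1) → X) => (a.1 k, a.2))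
        (by fun_prop)).sectR y := by
  rw [systemLaw, Kernel.compProd_apply_eq_compProd_sectR]

/-- The average of `r` over the selected paths. -/
noncomputable def resampledMean {k : ℕ} (r : (Fin (k + 1) → X) → ℝ)
    (p : (Fin N → Fin (k + 1) → X) × (Fin N → Fin N)) : ℝ :=
  (N : ℝ)⁻¹ * ∑ j, r (p.1 (p.2 j))

omit [NeZero N] in
lemma measurable_resampledMean {k : ℕ} {r : (Fin (k + 1) → X) → ℝ} (hr : Measurable r) :
    Measurable (resampledMean (N := N) r) := by
  refine (Finset.measurable_sum _ fun j _ => hr.comp ?_).const_mul _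
  exact (measurable_apply_index N).comp (by fun_prop :
    Measurable fun p : (Fin N → Fin (k + 1) → X) × (Fin N → Fin N) => (p.1, p.2 j))

omit [MeasurableSpace X] in
lemma abs_resampledMean_le {k : ℕ} {r : (Fin (k + 1) → X) → ℝ} {C : ℝ} (hC : ∀ x, |r x| ≤ C)
    (p : (Fin N → Fin (k + 1) → X) × (Fin N → Fin N)) : |resampledMean r p| ≤ C := by
  have hN : (0 : ℝ) < N := by exact_mod_cast Nat.pos_of_ne_zero (NeZero.ne N)
  rw [resampledMean, abs_mul, abs_of_pos (by positivity)]
  have : |∑ j, r (p.1 (p.2 j))| ≤ N * C := by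
    refine (Finset.abs_sum_le_sum_abs _ _).trans ?_
    refine (Finset.sum_le_sum fun j _ => hC _).trans ?_
    simp
  calc (N : ℝ)⁻¹ * |∑ j, r (p.1 (p.2 j))| ≤ (N : ℝ)⁻¹ * (N * C) := by gcongr
    _ = C := by field_simp

lemma particleMean_one (k : ℕ) (y : 𝓨) (r : (Fin (k + 1) → X) → ℝ)
    (a : Fin N → Fin (k + 1) → X) :
    particleMean S N θ k y (fun _ => 1) r a =
      ∫ j, r (a j) ∂(indexLaw fun j => S.pathWeight θ k y (a j)) := by
  rw [integral_indexLaw, particleMean]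
  simp only [mul_one, sum_normalized_real, div_one]

lemma eLpNorm_average_sub_le {E : Type*} [MeasurableSpace E] {π : Measure E}
    [IsProbabilityMeasure π] {r : E → ℝ} (hr : Measurable r) {lo δ c : ℝ} (hδ : 0 ≤ δ)
    (hrm : ∀ x, r x ∈ Set.Icc lo (lo + δ)) (hm : c ∈ Set.Icc lo (lo + δ)) (hc : c = ∫ x, r x ∂π)
    {p : ℕ} (hp : p ≠ 0) :
    eLpNorm (fun x : Fin N → E => (N : ℝ)⁻¹ * ∑ j, r (x j) - c) p (Measure.pi fun _ => π) ≤
      ENNReal.ofReal (momentConst p * δ / √N) := by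
  have hN : (N : ℝ) ≠ 0 := by exact_mod_cast NeZero.ne N
  have hb (x : E) : |r x - c| ≤ δ := by
    have := hrm x
    rw [abs_le]
    constructor <;> linarith [hm.1, hm.2, this.1, this.2]
  have hi : Integrable r π := by
    refine Integrable.of_bound hr.aestronglyMeasurable (δ + |c|) (ae_of_all _ fun x => ?_)
    have := abs_add_le (r x - c) c
    rw [sub_add_cancel] at this
    exact this.trans (by linarith [hb x])
  have e : (fun x : Fin N → E => (N : ℝ)⁻¹ * ∑ j, r (x j) - c) =
      fun x => (N : ℝ)⁻¹ * ∑ j, (fun x => r x - c) (x j) := by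
    ext x
    simp only [Finset.sum_sub_distrib, Finset.sum_const, Finset.card_univ,
      Fintype.card_fin, nsmul_eq_mul]
    field_simp
  rw [e]
  refine eLpNorm_average_le (hr.sub_const c) hδ hb ?_ hp
  rw [integral_sub hi (integrable_const _), ← hc]
  simp

namespace StrongMixing

variable {σm σp d : ℝ} (h : StrongMixing M θ σm σp) (y : ℕ → 𝓨)
include h

lemma eLpNorm_resampledMean_sub_le {k p : ℕ} (hp : p ≠ 0) {r : (Fin (k + 1) → X) → ℝ} {lo δ : ℝ}
    (hδ : 0 ≤ δ) (hrm : ∀ x, r x ∈ Set.Icc lo (lo + δ)) (a : Fin N → Fin (k + 1) → X) :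
    eLpNorm (fun I : Fin N → Fin N => resampledMean r (a, I) -
        particleMean S N θ k (y k) (fun _ => 1) r a) p (selection S N θ k (y k, a)) ≤
      ENNReal.ofReal (momentConst p * δ / √N) := by
  have hm := particleMean_mem (S := S) (N := N) (θ := θ) h.pos (y k) h.comparable_one hrm a
  have hc := particleMean_one (S := S) (θ := θ) k (y k) r a
  generalize particleMean S N θ k (y k) (fun _ => 1) r a = c at hm hc ⊢
  rw [selection_apply]
  exact eLpNorm_average_sub_le (measurable_of_countable _) hδ (fun j => hrm (a j)) hm hc hp

omit h in
lemma integral_resampledMean_sub {k : ℕ} (r : (Fin (k + 1) → X) → ℝ)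
    (a : Fin N → Fin (k + 1) → X) :
    ∫ I, (resampledMean r (a, I) - particleMean S N θ k (y k) (fun _ => 1) r a)
        ∂(selection S N θ k (y k, a)) = 0 := by
  rw [selection_apply, integral_sub Integrable.of_finite (integrable_const _), particleMean_one]
  simp only [resampledMean]
  rw [integral_pi_average (h := fun j => r (a j)) Integrable.of_finite]
  simp

variable (hd0 : 0 < d) (hd : ∀ x, d ≤ M.dν x)
include hd0 hd

/-- The truncation error of the lag `Δ`, which is present only if `i + Δ < n`. -/
lemma abs_tiltedMean_min_sub_le {s : X → X → ℝ} (hs : Measurable (Function.uncurry s)) {lo δ : ℝ}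
    (hsm : ∀ x x', s x x' ∈ Set.Icc lo (lo + δ)) {i n m Δ : ℕ} (hΔ : 1 ≤ Δ)
    (hm : m = min (i + Δ) n) (him : i + 1 ≤ m) (hin : i + 1 ≤ n) :
    |tiltedMean M θ y (fun _ => 1) (edge s i him) -
        tiltedMean M θ y (fun _ => 1) (edge s i hin)| ≤
      (if i + Δ < n then (1 - σm / σp) ^ Δ else 0) * δ := by
  split_ifs with hlt
  · obtain ⟨l, rfl⟩ : ∃ l, m = i + 1 + l := ⟨m - (i + 1), by omega⟩
    obtain rfl : Δ = l + 1 := by omega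
    exact h.abs_tiltedMean_edge_sub_le hd0 hd y hs hsm i l (by omega)
  · obtain rfl : m = n := by omega
    simp

variable (hA : S.A2)
include hA

/-- The three summands bound the effect of the lag, the error of the weighted particle mean, and the
resampling error. -/
theorem eLpNorm_fixedLag_sub_le {s : X → X → ℝ} (hs : Measurable (Function.uncurry s)) {B : ℝ}
    (hB : ∀ x x', |s x x'| ≤ B) {p : ℕ} (hp : p ≠ 0) {i n m Δ : ℕ} (hΔ : 1 ≤ Δ)
    (hm : m = min (i + Δ) n) (him : i + 1 ≤ m) (hin : i + 1 ≤ n) :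
    eLpNorm (fun z => resampledMean (edge s i him) z - tiltedMean M θ y (fun _ => 1) (edge s i hin))
        p (systemLaw S N θ m y) ≤
      ENNReal.ofReal ((if i + Δ < n then (1 - σm / σp) ^ Δ else 0) * (2 * B) +
        2 * momentConst p / √N * ∑ l ∈ Finset.range (m + 1),
          (1 - σm / σp) ^ (i - l) * (2 * B) * weightRatio S θ σm σp d l (y l) +
        momentConst p * (2 * B) / √N) := by
  obtain ⟨x₀⟩ : Nonempty X := nonempty_of_isProbabilityMeasure M.μ
  have hB0 : 0 ≤ 2 * B := by
    have := (abs_nonneg _).trans (hB x₀ x₀)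
    linarith
  have hK : 0 ≤ momentConst p := zero_le_one.trans (one_le_momentConst p)
  have hρ := h.rho_nonneg
  have hwr := h.weightRatio_nonneg (S := S) hd0
  have hsm (x x' : X) : s x x' ∈ Set.Icc (-B) (-B + 2 * B) := by
    have := abs_le.1 (hB x x')
    constructor <;> linarith [this.1, this.2]
  have hrm (x : Fin (m + 1) → X) : edge s i him x ∈ Set.Icc (-B) (-B + 2 * B) := hsm _ _
  have him' : i - m = 0 := by omega
  have h1 := h.eLpNorm_particleMean_sub_le y (N := N) hA hd0 hd i hp hB0 m h.comparable_one
    (measurable_edge hs him) (dependsFrom_edge him) (lo := -B) (by simpa [him'] using hrm)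
  have h2 := h.abs_tiltedMean_min_sub_le y hd0 hd hs hsm hΔ hm him hin
  set Φm := tiltedMean M θ y (fun _ => 1) (edge s i him)
  set Φn := tiltedMean M θ y (fun _ => 1) (edge s i hin)
  have hmeas := measurable_particleMean S N θ m (y m) (β := fun _ => 1) measurable_const
    (measurable_edge hs him)
  have h3 : eLpNorm (fun a => particleMean S N θ m (y m) (fun _ => 1) (edge s i him) a - Φn) p
      (particleLaw S N θ m y) ≤
      ENNReal.ofReal ((if i + Δ < n then (1 - σm / σp) ^ Δ else 0) * (2 * B)) +
      ENNReal.ofReal (2 * momentConst p / √N * ∑ l ∈ Finset.range (m + 1),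
          (1 - σm / σp) ^ (i - l) * (2 * B) * weightRatio S θ σm σp d l (y l)) := by
    have e : (fun a => particleMean S N θ m (y m) (fun _ => 1) (edge s i him) a - Φn) =
        (fun _ => Φm - Φn) +
          fun a => particleMean S N θ m (y m) (fun _ => 1) (edge s i him) a - Φm := by
      ext a; simp
    rw [e]
    refine (eLpNorm_add_le aestronglyMeasurable_const (hmeas.sub_const _).aestronglyMeasurable
      (by exact_mod_cast Nat.one_le_iff_ne_zero.2 hp)).trans (add_le_add ?_ h1)
    rw [eLpNorm_const _ (by exact_mod_cast hp) (NeZero.ne _)]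
    simp only [measure_univ, ENNReal.one_rpow, mul_one]
    rw [Real.enorm_eq_ofReal_abs]
    exact ENNReal.ofReal_le_ofReal h2
  have h4 (a : Fin N → Fin (m + 1) → X) :=
    h.eLpNorm_resampledMean_sub_le y (S := S) hp hB0 hrm a
  have hres := measurable_resampledMean (N := N) (measurable_edge hs him)
  set mm := particleLaw S N θ m y
  rw [systemLaw_apply]
  set κ := ((selection S N θ m).comap
    (fun a : (ℕ → 𝓨) × (Fin N → Fin (m + 1) → X) => (a.1 m, a.2)) (by fun_prop)).sectR y with hκ
  have e : (fun z => resampledMean (edge s i him) z - Φn) =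
      (fun z : (Fin N → Fin (m + 1) → X) × (Fin N → Fin N) =>
        particleMean S N θ m (y m) (fun _ => 1) (edge s i him) z.1 - Φn) +
      fun z => resampledMean (edge s i him) z -
        particleMean S N θ m (y m) (fun _ => 1) (edge s i him) z.1 := by
    ext z; simp
  have hm1 : Measurable fun z : (Fin N → Fin (m + 1) → X) × (Fin N → Fin N) =>
      particleMean S N θ m (y m) (fun _ => 1) (edge s i him) z.1 := hmeas.comp measurable_fst
  rw [e, ENNReal.ofReal_add, ENNReal.ofReal_add]
  · refine (eLpNorm_add_le (hm1.sub_const _).aestronglyMeasurable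
      (hres.sub hm1).aestronglyMeasurable
      (by exact_mod_cast Nat.one_le_iff_ne_zero.2 hp)).trans (add_le_add ?_ ?_)
    · refine le_trans (le_of_eq ?_) h3
      have : eLpNorm (fun z : (Fin N → Fin (m + 1) → X) × (Fin N → Fin N) =>
          particleMean S N θ m (y m) (fun _ => 1) (edge s i him) z.1 - Φn) p (mm ⊗ₘ κ) =
          eLpNorm (fun a => particleMean S N θ m (y m) (fun _ => 1) (edge s i him) a - Φn) p
            (mm ⊗ₘ κ).fst := by
        rw [Measure.fst, eLpNorm_map_measure (hmeas.sub_const _).aestronglyMeasurable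
          (by fun_prop)]
        rfl
      rw [this, Measure.fst_compProd]
    · exact eLpNorm_compProd_le (hres.sub hm1) hp h4
  · split_ifs <;> positivity
  · exact mul_nonneg (by positivity) (Finset.sum_nonneg fun l _ =>
      mul_nonneg (mul_nonneg (pow_nonneg hρ _) hB0) (hwr _ _))
  · refine add_nonneg ?_ (mul_nonneg (by positivity) (Finset.sum_nonneg fun l _ =>
      mul_nonneg (mul_nonneg (pow_nonneg hρ _) hB0) (hwr _ _)))
    split_ifs <;> positivity
  · positivity

/-- The two summands bound the effect of the lag and the bias of the weighted particle mean;
resampling adds no bias. -/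
theorem abs_integral_fixedLag_sub_le {s : X → X → ℝ} (hs : Measurable (Function.uncurry s)) {B : ℝ}
    (hB : ∀ x x', |s x x'| ≤ B) {i n m Δ : ℕ} (hΔ : 1 ≤ Δ)
    (hm : m = min (i + Δ) n) (him : i + 1 ≤ m) (hin : i + 1 ≤ n) :
    |∫ z, (resampledMean (edge s i him) z - tiltedMean M θ y (fun _ => 1) (edge s i hin))
        ∂(systemLaw S N θ m y)| ≤
      (if i + Δ < n then (1 - σm / σp) ^ Δ else 0) * (2 * B) +
        3 * momentConst 2 ^ 2 / N * ∑ l ∈ Finset.range (m + 1),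
          (1 - σm / σp) ^ (i - l) * (2 * B) * weightRatio S θ σm σp d l (y l) ^ 2 := by
  obtain ⟨x₀⟩ : Nonempty X := nonempty_of_isProbabilityMeasure M.μ
  have hB0 : 0 ≤ 2 * B := by
    have := (abs_nonneg _).trans (hB x₀ x₀)
    linarith
  have hsm (x x' : X) : s x x' ∈ Set.Icc (-B) (-B + 2 * B) := by
    have := abs_le.1 (hB x x')
    constructor <;> linarith [this.1, this.2]
  have hrm (x : Fin (m + 1) → X) : edge s i him x ∈ Set.Icc (-B) (-B + 2 * B) := hsm _ _
  have him' : i - m = 0 := by omega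
  have h1 := h.abs_integral_particleMean_sub_le y (N := N) hA hd0 hd i hB0 m h.comparable_one
    (measurable_edge hs him) (dependsFrom_edge him) (lo := -B) (by simpa [him'] using hrm)
  have h2 := h.abs_tiltedMean_min_sub_le y hd0 hd hs hsm hΔ hm him hin
  set Φm := tiltedMean M θ y (fun _ => 1) (edge s i him)
  set Φn := tiltedMean M θ y (fun _ => 1) (edge s i hin)
  have hmeas := measurable_particleMean S N θ m (y m) (β := fun _ => 1) measurable_const
    (measurable_edge hs him)
  have hres := measurable_resampledMean (N := N) (measurable_edge hs him)
  obtain ⟨A, hA1⟩ := exists_abs_le_of_mem_Icc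
    (particleMean_mem (S := S) (N := N) (θ := θ) h.pos (y m) h.comparable_one hrm)
  have hres1 : ∀ z, |resampledMean (N := N) (edge s i him) z| ≤ B :=
    abs_resampledMean_le fun x => hB _ _
  have hires : Integrable (fun z => resampledMean (edge s i him) z - Φn)
      (systemLaw S N θ m y) :=
    (integrable_of_bdd hres hres1).sub (integrable_const _)
  have key : ∫ z, (resampledMean (edge s i him) z - Φn) ∂(systemLaw S N θ m y) =
      (Φm - Φn) + ∫ a, (particleMean S N θ m (y m) (fun _ => 1) (edge s i him) a - Φm)
        ∂(particleLaw S N θ m y) := by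
    have hip : Integrable (fun a => particleMean S N θ m (y m) (fun _ => 1) (edge s i him) a)
      (particleLaw S N θ m y) := integrable_of_bdd hmeas hA1
    rw [systemLaw_apply] at hires ⊢
    rw [Measure.integral_compProd hires, integral_sub hip (integrable_const _)]
    have hin (a : Fin N → Fin (m + 1) → X) :
        ∫ I, (resampledMean (edge s i him) (a, I) - Φn) ∂(selection S N θ m (y m, a)) =
          particleMean S N θ m (y m) (fun _ => 1) (edge s i him) a - Φn := by
      have h0 := integral_resampledMean_sub (S := S) (θ := θ) y (edge s i him) a
      have hi : Integrable (fun I => resampledMean (edge s i him) (a, I))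
        (selection S N θ m (y m, a)) := Integrable.of_finite
      rw [integral_sub hi (integrable_const _)] at h0 ⊢
      simp only [integral_const, probReal_univ, one_smul] at h0 ⊢
      linarith
    calc _ = ∫ a, (particleMean S N θ m (y m) (fun _ => 1) (edge s i him) a - Φn)
          ∂(particleLaw S N θ m y) := integral_congr_ae (ae_of_all _ hin)
      _ = _ := by
        rw [integral_sub hip (integrable_const _)]
        simp
  rw [key]
  exact (abs_add_le _ _).trans (add_le_add h2 h1)

end StrongMixing

end FixedLagTerm

/-! ### The conditional law of the particle system given the observations -/

section Disintegration

variable {Θ X 𝓨 : Type*} [MeasurableSpace X] [MeasurableSpace 𝓨]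
  {M : StateSpaceModel Θ X 𝓨} (S : Proposal M) (D : DataModel X M.lam) (N : ℕ) [NeZero N] (θ : Θ)

lemma particleLaw_congr {k : ℕ} {y y' : ℕ → 𝓨} (h : ∀ i ≤ k, y i = y' i) :
    particleLaw S N θ k y = particleLaw S N θ k y' := by
  induction k with
  | zero => simp only [particleLaw, Kernel.const_apply]
  | succ k ih =>
    rw [particleLaw_succ_apply, particleLaw_succ_apply, ih fun i hi => h i (hi.trans k.le_succ)]
    congr 2
    ext a : 1
    rw [kernelPi_sectR_apply, kernelPi_sectR_apply]
    simp only [mixtureKernel_apply, h k k.le_succ, h (k + 1) le_rfl]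

/-- The particle system at time `k` depends on the observations up to time `k` only. -/
lemma systemLaw_congr {k : ℕ} {y y' : ℕ → 𝓨} (h : ∀ i ≤ k, y i = y' i) :
    systemLaw S N θ k y = systemLaw S N θ k y' := by
  rw [systemLaw_apply, systemLaw_apply, particleLaw_congr S N θ h]
  congr 1
  ext a : 1
  simp only [Kernel.sectR_apply, Kernel.comap_apply, h k le_rfl]

/-- The mutation and selection of the particle system when a new observation arrives. -/
noncomputable def propagate (k : ℕ) :
    Kernel (((Fin N → Fin (k + 1) → X) × (Fin N → Fin N)) × 𝓨)
      ((Fin N → Fin (k + 2) → X) × (Fin N → Fin N)) :=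
  (kernelPi fun i : Fin N => (mutation S θ k).comap
      (fun a : ((Fin N → Fin (k + 1) → X) × (Fin N → Fin N)) × 𝓨 => (a.2, a.1.1 (a.1.2 i)))
      (measurable_snd.prodMk ((measurable_apply_index N).comp (by fun_prop :
        Measurable fun a : ((Fin N → Fin (k + 1) → X) × (Fin N → Fin N)) × 𝓨 =>
          (a.1.1, a.1.2 i))))) ⊗ₖ
    (selection S N θ (k + 1)).comap
      (fun a : (((Fin N → Fin (k + 1) → X) × (Fin N → Fin N)) × 𝓨) × (Fin N → Fin (k + 2) → X) =>
        (a.1.2, a.2)) (by fun_prop)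

instance (k : ℕ) : IsMarkovKernel (propagate S N θ k) := by
  unfold propagate; infer_instance

/-- A step of the chain is a step of the data model followed by a step of the particle system. -/
lemma lintegral_step (k : ℕ) (z : ChainState X 𝓨 N k) {G : ChainState X 𝓨 N (k + 1) → ℝ≥0∞}
    (hG : Measurable G) :
    ∫⁻ w, G w ∂(step S D N θ k z) =
      ∫⁻ v, ∫⁻ p, G (v, p) ∂(propagate S N θ k (z.2, v.2))
        ∂((D.Q ⊗ₖ Kernel.prodMkLeft X D.G) z.1.1) := by
  rw [step, Kernel.lintegral_compProd _ _ _ hG, Kernel.comap_apply]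
  refine lintegral_congr fun v => ?_
  congr 1
  rw [propagate, Kernel.compProd_apply_eq_compProd_sectR, Kernel.compProd_apply_eq_compProd_sectR]
  rfl

/-- For given observations, the particle system is propagated in time. -/
lemma lintegral_propagate (k : ℕ) (y : ℕ → 𝓨)
    {G : (Fin N → Fin (k + 2) → X) × (Fin N → Fin N) → ℝ≥0∞} (hG : Measurable G) :
    ∫⁻ p, ∫⁻ p', G p' ∂(propagate S N θ k (p, y (k + 1))) ∂(systemLaw S N θ k y) =
      ∫⁻ p', G p' ∂(systemLaw S N θ (k + 1) y) := by
  set G' : (Fin N → Fin (k + 2) → X) → ℝ≥0∞ :=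
    fun a => ∫⁻ I, G (a, I) ∂(selection S N θ (k + 1) (y (k + 1), a)) with hG'
  have hG'm : Measurable G' :=
    Measurable.lintegral_kernel_prod_right' (κ := (selection S N θ (k + 1)).comap
      (fun a : Fin N → Fin (k + 2) → X => (y (k + 1), a)) (by fun_prop)) hG
  have h1 (p : (Fin N → Fin (k + 1) → X) × (Fin N → Fin N)) :
      ∫⁻ p', G p' ∂(propagate S N θ k (p, y (k + 1))) =
        ∫⁻ a, G' a ∂(Measure.pi fun i => mutation S θ k (y (k + 1), p.1 (p.2 i))) := by
    rw [propagate, Kernel.lintegral_compProd _ _ _ hG]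
    rfl
  have h2 : Measurable fun p : (Fin N → Fin (k + 1) → X) × (Fin N → Fin N) =>
      ∫⁻ p', G p' ∂(propagate S N θ k (p, y (k + 1))) :=
    Measurable.lintegral_kernel (κ := (propagate S N θ k).comap
      (fun p : (Fin N → Fin (k + 1) → X) × (Fin N → Fin N) => (p, y (k + 1))) (by fun_prop)) hG
  rw [systemLaw_apply, systemLaw_apply, Measure.lintegral_compProd h2,
    Measure.lintegral_compProd hG, particleLaw_succ_apply, Measure.snd]
  change _ = ∫⁻ a, G' a ∂_
  rw [lintegral_map hG'm measurable_snd,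
    Measure.lintegral_compProd (f := fun b => G' b.2) (hG'm.comp measurable_snd)]
  refine lintegral_congr fun a => ?_
  simp only [h1]
  rw [kernelPi_sectR_apply]
  simp only [mixtureKernel_apply]
  exact pi_comp_pi N (indexLaw fun j => S.pathWeight θ k (y k) (a j))
    ((mutation S θ k).comap (fun j : Fin N => (y (k + 1), a j)) (measurable_of_countable _)) hG'm

/-- The trajectory of the data model, stopped at time `k`. -/
def stoppedData (k : ℕ) (z : Traj X 𝓨 N) (i : ℕ) : X × 𝓨 := (z (min i k)).1

/-- Replaces all components after time `k` by `v`. -/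
def extendData (k : ℕ) (u : ℕ → X × 𝓨) (v : X × 𝓨) (i : ℕ) : X × 𝓨 :=
  if i ≤ k then u i else v

omit [MeasurableSpace X] [MeasurableSpace 𝓨] [NeZero N] in
lemma stoppedData_of_le {i k : ℕ} (h : i ≤ k) (z : Traj X 𝓨 N) :
    stoppedData N k z i = (z i).1 := by
  rw [stoppedData, min_eq_left h]

omit [MeasurableSpace X] [MeasurableSpace 𝓨] [NeZero N] in
lemma stoppedData_zero (z : Traj X 𝓨 N) : stoppedData N 0 z = fun _ => (z 0).1 := by
  ext i : 1
  rw [stoppedData, Nat.min_zero]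

lemma measurable_extendData (k : ℕ) :
    Measurable fun b : (ℕ → X × 𝓨) × (X × 𝓨) => extendData k b.1 b.2 := by
  refine measurable_pi_lambda _ fun i => ?_
  unfold extendData
  split_ifs <;> fun_prop

omit [MeasurableSpace X] [MeasurableSpace 𝓨] [NeZero N] in
lemma stoppedData_succ (k : ℕ) (z : Traj X 𝓨 N) :
    stoppedData N (k + 1) z = extendData k (stoppedData N k z) (z (k + 1)).1 := by
  ext i : 1
  simp only [stoppedData, extendData]
  split_ifs with h
  · rw [min_eq_left (h.trans k.le_succ), min_eq_left h]
  · rw [min_eq_right (by omega)]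

instance : IsProbabilityMeasure (chainLaw S D N θ) := by
  unfold chainLaw; infer_instance

lemma lintegral_chainLaw_zero {G : ChainState X 𝓨 N 0 → ℝ≥0∞} (hG : Measurable G) :
    ∫⁻ z, G (z 0) ∂(chainLaw S D N θ) = ∫⁻ w, G w ∂(initialLaw S D N θ) := by
  let e := (MeasurableEquiv.piUnique fun i : Finset.Iic 0 => ChainState X 𝓨 N i).symm
  have hG0 : Measurable fun z : Traj X 𝓨 N => G (z 0) := hG.comp (measurable_pi_apply 0)
  rw [chainLaw, Kernel.trajMeasure, Measure.lintegral_bind (Kernel.measurable _).aemeasurable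
    hG0.aemeasurable]
  have h (x : (i : Finset.Iic 0) → ChainState X 𝓨 N i) (κ : (n : ℕ) → Kernel
      ((i : Finset.Iic n) → ChainState X 𝓨 N i) (ChainState X 𝓨 N (n + 1)))
      [∀ n, IsMarkovKernel (κ n)] :
      ∫⁻ z, G (z 0) ∂(Kernel.traj κ 0 x) = G (x ⟨0, Finset.mem_Iic.2 le_rfl⟩) := by
    have h1 : Measurable fun x : (i : Finset.Iic 0) → ChainState X 𝓨 N i =>
        G (x ⟨0, Finset.mem_Iic.2 le_rfl⟩) := hG.comp (measurable_pi_apply _)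
    have h2 := Kernel.traj_map_frestrictLe_apply (κ := κ) 0 0 x
    rw [Kernel.partialTraj_self, Kernel.id_apply] at h2
    have h3 := lintegral_map h1 (Preorder.measurable_frestrictLe 0) (μ := Kernel.traj κ 0 x)
    rw [h2, lintegral_dirac' _ h1] at h3
    exact h3.symm
  simp only [h]
  have h1 : Measurable fun x : (i : Finset.Iic 0) → ChainState X 𝓨 N i =>
        G (x ⟨0, Finset.mem_Iic.2 le_rfl⟩) := hG.comp (measurable_pi_apply _)
  exact lintegral_map h1 e.measurable

/-- The Markov property of the chain. -/
lemma lintegral_chainLaw_succ (k : ℕ)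
    {G : ((i : Finset.Iic k) → ChainState X 𝓨 N i) × ChainState X 𝓨 N (k + 1) → ℝ≥0∞}
    (hG : Measurable G) :
    ∫⁻ z, G (Preorder.frestrictLe k z, z (k + 1)) ∂(chainLaw S D N θ) =
      ∫⁻ z, ∫⁻ w, G (Preorder.frestrictLe k z, w) ∂(step S D N θ k (z k)) ∂(chainLaw S D N θ) := by
  have h := Kernel.map_frestrictLe_trajMeasure_compProd_eq_map_trajMeasure
    (X := fun k => ChainState X 𝓨 N k) (μ₀ := initialLaw S D N θ)
    (κ := fun k => (step S D N θ k).comap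
      (fun h : (i : Finset.Iic k) → ChainState X 𝓨 N i => h ⟨k, Finset.mem_Iic.2 le_rfl⟩)
      (by fun_prop)) (a := k)
  have h1 : Measurable fun z : Traj X 𝓨 N => (Preorder.frestrictLe k z, z (k + 1)) := by fun_prop
  rw [← lintegral_map hG h1]
  change ∫⁻ a, G a ∂(Measure.map _ (Kernel.trajMeasure _ _)) = _
  rw [← h, Measure.lintegral_compProd hG, lintegral_map (Measurable.lintegral_kernel_prod_right' hG)
    (by fun_prop)]
  rfl

/-- The system at time `k + 1`, with its data up to then, arises from the one at time `k` by a draw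
of the new state and observation, followed by the propagation of the particles. -/
lemma lintegral_stoppedData_succ (k : ℕ)
    {F : (ℕ → X × 𝓨) × ((Fin N → Fin (k + 2) → X) × (Fin N → Fin N)) → ℝ≥0∞}
    (hF : Measurable F) :
    ∫⁻ z, F (stoppedData N (k + 1) z, (z (k + 1)).2) ∂(chainLaw S D N θ) =
      ∫⁻ z, ∫⁻ v, ∫⁻ p, F (extendData k (stoppedData N k z) v, p)
        ∂(propagate S N θ k ((z k).2, v.2)) ∂((D.Q ⊗ₖ Kernel.prodMkLeft X D.G)
          (stoppedData N k z k).1) ∂(chainLaw S D N θ) := by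
  let U : ((i : Finset.Iic k) → ChainState X 𝓨 N i) → ℕ → X × 𝓨 :=
    fun x i => (x ⟨min i k, Finset.mem_Iic.2 (min_le_right i k)⟩).1
  have hU : Measurable U := by fun_prop
  have h := lintegral_chainLaw_succ S D N θ k (G := fun b => F (extendData k (U b.1) b.2.1, b.2.2))
    (hF.comp (((measurable_extendData k).comp (by fun_prop :
      Measurable fun b : ((i : Finset.Iic k) → ChainState X 𝓨 N i) × ChainState X 𝓨 N (k + 1) =>
        (U b.1, b.2.1))).prodMk (by fun_prop)))
  simp only [stoppedData_succ]
  refine h.trans (lintegral_congr fun z => ?_)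
  rw [lintegral_step S D N θ k (z k) (G := fun w =>
    F (extendData k (U (Preorder.frestrictLe k z)) w.1, w.2))
    (hF.comp (((measurable_extendData k).comp (by fun_prop :
      Measurable fun w : ChainState X 𝓨 N (k + 1) =>
        (U (Preorder.frestrictLe k z), w.1))).prodMk (by fun_prop)))]
  rw [stoppedData_of_le N le_rfl]
  rfl

/-- Given the trajectory of the data model up to time `k`, the particle system at time `k` has the
law `systemLaw`. -/
lemma lintegral_stoppedData_self (k : ℕ) :
    ∀ {F : (ℕ → X × 𝓨) × ((Fin N → Fin (k + 1) → X) × (Fin N → Fin N)) → ℝ≥0∞}, Measurable F →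
    ∫⁻ z, F (stoppedData N k z, (z k).2) ∂(chainLaw S D N θ) =
      ∫⁻ z, ∫⁻ p, F (stoppedData N k z, p)
        ∂(systemLaw S N θ k fun i => (stoppedData N k z i).2) ∂(chainLaw S D N θ) := by
  induction k with
  | zero =>
    intro F hF
    have hm : Measurable fun w : ChainState X 𝓨 N 0 => F (fun _ => w.1, w.2) :=
      hF.comp (by fun_prop)
    have h1 := lintegral_chainLaw_zero S D N θ hm
    have hm2 : Measurable fun w : ChainState X 𝓨 N 0 => ∫⁻ p, F (fun _ => w.1, p)
        ∂(systemLaw S N θ 0 fun _ => w.1.2) :=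
      Measurable.lintegral_kernel_prod_right' (κ := (systemLaw S N θ 0).comap
        (fun w : ChainState X 𝓨 N 0 => fun _ => w.1.2) (by fun_prop))
        (f := fun b => F (fun _ => b.1.1, b.2)) (hF.comp (by fun_prop))
    have h2 := lintegral_chainLaw_zero S D N θ hm2
    simp only [stoppedData_zero]
    rw [h1, h2, initialLaw, Measure.lintegral_compProd hm, Measure.lintegral_compProd hm2]
    refine lintegral_congr fun v => ?_
    simp only [lintegral_const, measure_univ, mul_one]
    have e : ((Kernel.const (X × 𝓨)
        (Measure.pi fun _ : Fin N => Measure.pi fun _ : Fin (0 + 1) => S.ς) ⊗ₖ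
      (selection S N θ 0).comap (fun a : (X × 𝓨) × (Fin N → Fin (0 + 1) → X) => (a.1.2, a.2))
        (by fun_prop)) v) = systemLaw S N θ 0 fun _ => v.2 := by
      rw [systemLaw_apply, Kernel.compProd_apply_eq_compProd_sectR]
      rfl
    rw [e]
  | succ k ih =>
    intro F hF
    rw [lintegral_stoppedData_succ S D N θ k hF]
    let Q := D.Q ⊗ₖ Kernel.prodMkLeft X D.G
    have hF1 : Measurable fun b : (((ℕ → X × 𝓨) × ((Fin N → Fin (k + 1) → X) × (Fin N → Fin N))) ×
        (X × 𝓨)) × ((Fin N → Fin (k + 2) → X) × (Fin N → Fin N)) =>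
        F (extendData k b.1.1.1 b.1.2, b.2) :=
      hF.comp (((measurable_extendData k).comp (by fun_prop :
        Measurable fun b : (((ℕ → X × 𝓨) × ((Fin N → Fin (k + 1) → X) × (Fin N → Fin N))) ×
          (X × 𝓨)) × ((Fin N → Fin (k + 2) → X) × (Fin N → Fin N)) =>
            (b.1.1.1, b.1.2))).prodMk (by fun_prop))
    have hF2 : Measurable fun b : ((ℕ → X × 𝓨) × ((Fin N → Fin (k + 1) → X) × (Fin N → Fin N))) ×
        (X × 𝓨) => ∫⁻ p, F (extendData k b.1.1 b.2, p) ∂(propagate S N θ k (b.1.2, b.2.2)) :=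
      Measurable.lintegral_kernel_prod_right' (κ := (propagate S N θ k).comap
        (fun b : ((ℕ → X × 𝓨) × ((Fin N → Fin (k + 1) → X) × (Fin N → Fin N))) × (X × 𝓨) =>
          (b.1.2, b.2.2)) (by fun_prop)) hF1
    have hF3 : Measurable fun b : (ℕ → X × 𝓨) × ((Fin N → Fin (k + 1) → X) × (Fin N → Fin N)) =>
        ∫⁻ v, ∫⁻ p, F (extendData k b.1 v, p) ∂(propagate S N θ k (b.2, v.2)) ∂(Q (b.1 k).1) :=
      Measurable.lintegral_kernel_prod_right' (κ := Q.comap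
        (fun b : (ℕ → X × 𝓨) × ((Fin N → Fin (k + 1) → X) × (Fin N → Fin N)) => (b.1 k).1)
          (by fun_prop)) hF2
    have hG : Measurable fun b : (ℕ → X × 𝓨) × ((Fin N → Fin (k + 2) → X) × (Fin N → Fin N)) =>
        ∫⁻ p, F (b.1, p) ∂(systemLaw S N θ (k + 1) fun i => (b.1 i).2) :=
      Measurable.lintegral_kernel_prod_right' (κ := (systemLaw S N θ (k + 1)).comap
        (fun b : (ℕ → X × 𝓨) × ((Fin N → Fin (k + 2) → X) × (Fin N → Fin N)) =>
          fun i => (b.1 i).2) (by fun_prop)) (f := fun b => F (b.1.1, b.2)) (hF.comp (by fun_prop))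
    rw [ih hF3, lintegral_stoppedData_succ S D N θ k hG]
    refine lintegral_congr fun z => ?_
    have hF4 : Measurable fun b : ((Fin N → Fin (k + 1) → X) × (Fin N → Fin N)) × (X × 𝓨) =>
        ∫⁻ p, F (extendData k (stoppedData N k z) b.2, p) ∂(propagate S N θ k (b.1, b.2.2)) :=
      hF2.comp (by fun_prop : Measurable fun b : ((Fin N → Fin (k + 1) → X) × (Fin N → Fin N)) ×
        (X × 𝓨) => ((stoppedData N k z, b.1), b.2))
    refine (lintegral_lintegral_swap (μ := systemLaw S N θ k fun i => (stoppedData N k z i).2)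
      (ν := Q (stoppedData N k z k).1) (f := fun (p : (Fin N → Fin (k + 1) → X) × (Fin N → Fin N))
      (v : X × 𝓨) => ∫⁻ p', F (extendData k (stoppedData N k z) v, p')
        ∂(propagate S N θ k (p, v.2))) hF4.aemeasurable).trans ?_
    refine lintegral_congr fun v => ?_
    simp only [lintegral_const, measure_univ, mul_one]
    have e := lintegral_propagate S N θ k (fun i => (extendData k (stoppedData N k z) v i).2)
      (G := fun p => F (extendData k (stoppedData N k z) v, p)) (hF.comp (by fun_prop))
    rw [← e, systemLaw_congr S N θ (k := k)
      (y' := fun i => (extendData k (stoppedData N k z) v i).2)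
      fun i hi => by simp only [extendData, if_pos hi]]
    simp only [extendData, if_neg (Nat.not_succ_le_self k)]

/-- The particle system at time `m` is conditionally independent of the later data given the
earlier data. -/
lemma lintegral_stoppedData {m n : ℕ} (hmn : m ≤ n) :
    ∀ {F : (ℕ → X × 𝓨) × ((Fin N → Fin (m + 1) → X) × (Fin N → Fin N)) → ℝ≥0∞}, Measurable F →
    ∫⁻ z, F (stoppedData N n z, (z m).2) ∂(chainLaw S D N θ) =
      ∫⁻ z, ∫⁻ p, F (stoppedData N n z, p)
        ∂(systemLaw S N θ m fun i => (stoppedData N n z i).2) ∂(chainLaw S D N θ) := by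
  induction n, hmn using Nat.le_induction with
  | base => exact lintegral_stoppedData_self S D N θ m
  | succ n hmn ih =>
    intro F hF
    let Q := D.Q ⊗ₖ Kernel.prodMkLeft X D.G
    -- Integrating out the new data does not involve the particle system at time `m`.
    have hstep {H : (ℕ → X × 𝓨) × ((Fin N → Fin (m + 1) → X) × (Fin N → Fin N)) → ℝ≥0∞}
        (hH : Measurable H) : ∫⁻ z, H (stoppedData N (n + 1) z, (z m).2) ∂(chainLaw S D N θ) =
        ∫⁻ z, ∫⁻ v, H (extendData n (stoppedData N n z) v, (z m).2)
          ∂(Q (stoppedData N n z n).1) ∂(chainLaw S D N θ) := by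
      let U : ((i : Finset.Iic n) → ChainState X 𝓨 N i) → ℕ → X × 𝓨 :=
        fun x i => (x ⟨min i n, Finset.mem_Iic.2 (min_le_right i n)⟩).1
      have hU : Measurable U := by fun_prop
      have h := lintegral_chainLaw_succ S D N θ n
        (G := fun b => H (extendData n (U b.1) b.2.1, (b.1 ⟨m, Finset.mem_Iic.2 hmn⟩).2))
        (hH.comp (((measurable_extendData n).comp (by fun_prop :
          Measurable fun b : ((i : Finset.Iic n) → ChainState X 𝓨 N i) × ChainState X 𝓨 N (n + 1) =>
            (U b.1, b.2.1))).prodMk (by fun_prop)))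
      simp only [stoppedData_succ]
      refine h.trans (lintegral_congr fun z => ?_)
      refine (lintegral_step S D N θ n (z n) (G := fun w =>
        H (extendData n (U (Preorder.frestrictLe n z)) w.1, (z m).2))
        (hH.comp (((measurable_extendData n).comp (by fun_prop :
          Measurable fun w : ChainState X 𝓨 N (n + 1) =>
            (U (Preorder.frestrictLe n z), w.1))).prodMk (by fun_prop)))).trans ?_
      simp only [lintegral_const, measure_univ, mul_one]
      rw [stoppedData_of_le N le_rfl]
      rfl
    have hF1 : Measurable fun b : ((ℕ → X × 𝓨) × ((Fin N → Fin (m + 1) → X) × (Fin N → Fin N))) ×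
        (X × 𝓨) => F (extendData n b.1.1 b.2, b.1.2) :=
      hF.comp (((measurable_extendData n).comp (by fun_prop :
        Measurable fun b : ((ℕ → X × 𝓨) × ((Fin N → Fin (m + 1) → X) × (Fin N → Fin N))) ×
          (X × 𝓨) => (b.1.1, b.2))).prodMk (by fun_prop))
    have hF2 : Measurable fun b : (ℕ → X × 𝓨) × ((Fin N → Fin (m + 1) → X) × (Fin N → Fin N)) =>
        ∫⁻ v, F (extendData n b.1 v, b.2) ∂(Q (b.1 n).1) :=
      Measurable.lintegral_kernel_prod_right' (κ := Q.comap
        (fun b : (ℕ → X × 𝓨) × ((Fin N → Fin (m + 1) → X) × (Fin N → Fin N)) => (b.1 n).1)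
          (by fun_prop)) hF1
    have hG : Measurable fun b : (ℕ → X × 𝓨) × ((Fin N → Fin (m + 1) → X) × (Fin N → Fin N)) =>
        ∫⁻ p, F (b.1, p) ∂(systemLaw S N θ m fun i => (b.1 i).2) :=
      Measurable.lintegral_kernel_prod_right' (κ := (systemLaw S N θ m).comap
        (fun b : (ℕ → X × 𝓨) × ((Fin N → Fin (m + 1) → X) × (Fin N → Fin N)) =>
          fun i => (b.1 i).2) (by fun_prop)) (f := fun b => F (b.1.1, b.2)) (hF.comp (by fun_prop))
    rw [hstep hF, ih hF2, hstep hG]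
    refine lintegral_congr fun z => ?_
    have hF4 : Measurable fun b : ((Fin N → Fin (m + 1) → X) × (Fin N → Fin N)) × (X × 𝓨) =>
        F (extendData n (stoppedData N n z) b.2, b.1) :=
      hF1.comp (by fun_prop : Measurable fun b : ((Fin N → Fin (m + 1) → X) × (Fin N → Fin N)) ×
        (X × 𝓨) => ((stoppedData N n z, b.1), b.2))
    refine (lintegral_lintegral_swap (μ := systemLaw S N θ m fun i => (stoppedData N n z i).2)
      (ν := Q (stoppedData N n z n).1) (f := fun (p : (Fin N → Fin (m + 1) → X) × (Fin N → Fin N))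
      (v : X × 𝓨) => F (extendData n (stoppedData N n z) v, p)) hF4.aemeasurable).trans ?_
    refine lintegral_congr fun v => ?_
    rw [systemLaw_congr S N θ (k := m) (y := fun i => (stoppedData N n z i).2)
      (y' := fun i => (extendData n (stoppedData N n z) v i).2)
      fun i hi => by simp only [extendData, if_pos (hi.trans hmn)]]

/-- Extends a finite sequence by its last element. -/
def clamp {E : Type*} (n : ℕ) (y : Fin (n + 1) → E) (i : ℕ) : E := y ⟨min i n, by omega⟩

lemma measurable_clamp (n : ℕ) : Measurable (clamp (E := 𝓨) n) := by
  unfold clamp; fun_prop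

lemma clamp_val {E : Type*} {n : ℕ} (y : Fin (n + 1) → E) (i : Fin (n + 1)) :
    clamp n y i = y i := by
  have h : min (i : ℕ) n = i := min_eq_left (Nat.lt_succ_iff.1 i.2)
  simp only [clamp, h]

omit [NeZero N] in
lemma measurable_observations (n : ℕ) : Measurable (observations (X := X) (𝓨 := 𝓨) (N := N) n) := by
  unfold observations ChainState.obs; fun_prop

instance (n : ℕ) : IsProbabilityMeasure (obsLaw S D N θ n) :=
  Measure.isProbabilityMeasure_map (measurable_observations N n).aemeasurable

/-- The conditional law of the particle system at time `m` given the observations up to time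
`n ≥ m` is `systemLaw`. -/
theorem map_observations_system {m n : ℕ} (hmn : m ≤ n) :
    (chainLaw S D N θ).map (fun z => (observations n z, (z m).2)) =
      obsLaw S D N θ n ⊗ₘ (systemLaw S N θ m).comap (clamp n) (measurable_clamp n) := by
  have hobs := measurable_observations (X := X) (𝓨 := 𝓨) N n
  have hm : Measurable fun z : Traj X 𝓨 N => (observations n z, (z m).2) :=
    hobs.prodMk (by fun_prop)
  refine Measure.ext_of_lintegral _ fun F hF => ?_
  rw [lintegral_map hF hm, Measure.lintegral_compProd hF, obsLaw,
    lintegral_map (Measurable.lintegral_kernel_prod_right' hF) hobs]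
  have e (z : Traj X 𝓨 N) :
      observations n z = fun i : Fin (n + 1) => (stoppedData N n z i).2 := by
    ext i
    rw [stoppedData_of_le N (Nat.lt_succ_iff.1 i.2)]
    rfl
  have e2 (z : Traj X 𝓨 N) : (clamp n fun i : Fin (n + 1) => (stoppedData N n z i).2) =
      fun i => (stoppedData N n z i).2 := by
    ext i
    rw [clamp, stoppedData_of_le N (min_le_right i n)]
    rfl
  simp only [Kernel.comap_apply, e, e2]
  exact lintegral_stoppedData S D N θ hmn
    (F := fun b => F (fun i : Fin (n + 1) => (b.1 i).2, b.2)) (hF.comp (by fun_prop))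

end Disintegration

/-! ### The constants of the model -/

section Constants

variable {Θ X 𝓨 : Type*} [MeasurableSpace X] [MeasurableSpace 𝓨] {M : StateSpaceModel Θ X 𝓨}

lemma toReal_μg (θ : Θ) (y : 𝓨) : (M.μg θ y).toReal = ∫ x, (M.g θ x y : ℝ) ∂M.μ := by
  rw [integral_eq_lintegral_of_nonneg_ae (ae_of_all _ fun _ => NNReal.zero_le_coe)
    (measurable_g_right y).aestronglyMeasurable]
  simp [StateSpaceModel.μg]

lemma g_le_iSup (y : 𝓨) (θ : Θ) (x : X) : (M.g θ x y : ℝ≥0∞) ≤ ⨆ θ, ⨆ x, (M.g θ x y : ℝ≥0∞) :=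
  le_iSup₂ (f := fun θ x => (M.g θ x y : ℝ≥0∞)) θ x

lemma μg_lt_top (hA : M.A1) (θ : Θ) (y : 𝓨) : M.μg θ y < ∞ := by
  refine lt_of_le_of_lt ?_ (hA.2 y).1
  calc M.μg θ y ≤ ∫⁻ _, (⨆ θ, ⨆ x, (M.g θ x y : ℝ≥0∞)) ∂M.μ :=
        lintegral_mono fun x => g_le_iSup y θ x
    _ = _ := by simp

lemma μg_pos (hA : M.A1) (θ : Θ) (y : 𝓨) : 0 < M.μg θ y :=
  (hA.2 y).2.trans_le (iInf_le _ θ)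

lemma strongMixing_of_A1 (hA : M.A1) (θ : Θ) :
    StrongMixing M θ M.sigmaMinus.toReal M.sigmaPlus.toReal := by
  obtain ⟨x₀⟩ : Nonempty X := nonempty_of_isProbabilityMeasure M.μ
  have h1 (x x' : X) : M.sigmaMinus ≤ M.q θ x x' :=
    (iInf_le _ θ).trans ((iInf_le _ x).trans (iInf_le _ x'))
  have h2 (x x' : X) : (M.q θ x x' : ℝ≥0∞) ≤ M.sigmaPlus :=
    le_trans (le_trans (le_iSup (fun x' => (M.q θ x x' : ℝ≥0∞)) x')
      (le_iSup (fun x => ⨆ x', (M.q θ x x' : ℝ≥0∞)) x))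
      (le_iSup (fun θ => ⨆ x, ⨆ x', (M.q θ x x' : ℝ≥0∞)) θ)
  have hfin : M.sigmaMinus ≠ ∞ := ((h1 x₀ x₀).trans_lt ENNReal.coe_lt_top).ne
  refine ⟨ENNReal.toReal_pos hA.1.1.ne' hfin, fun x x' => ⟨?_, ?_⟩, fun y => ?_, fun y => ?_⟩
  · simpa using ENNReal.toReal_mono ENNReal.coe_ne_top (h1 x x')
  · simpa using ENNReal.toReal_mono hA.1.2.ne (h2 x x')
  · exact ⟨_, fun x => by simpa using ENNReal.toReal_mono (hA.2 y).1.ne (g_le_iSup y θ x)⟩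
  · rw [← toReal_μg]
    exact ENNReal.toReal_pos (μg_pos hA θ y).ne' (μg_lt_top hA θ y).ne

lemma dνMinus_le (x : X) : M.dνMinus ≤ M.dν x := iInf_le _ x

lemma dνMinus_le_one : M.dνMinus ≤ 1 := by
  calc M.dνMinus = ∫⁻ _, M.dνMinus ∂M.μ := by simp
    _ ≤ ∫⁻ x, M.dν x ∂M.μ := lintegral_mono dνMinus_le
    _ = M.ν Set.univ := by
      conv_rhs => rw [M.dν_density.2, withDensity_apply _ MeasurableSet.univ, Measure.restrict_univ]
    _ = 1 := measure_univ

lemma toReal_dνMinus_le (x : X) : M.dνMinus.toReal ≤ M.dν x := by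
  simpa using ENNReal.toReal_mono ENNReal.coe_ne_top (dνMinus_le x)

lemma toReal_dνMinus_le_one : M.dνMinus.toReal ≤ 1 := by
  simpa using ENNReal.toReal_mono ENNReal.one_ne_top (dνMinus_le_one (M := M))

lemma toReal_dνMinus_pos (h : 0 < M.dνMinus) : 0 < M.dνMinus.toReal :=
  ENNReal.toReal_pos h.ne' (dνMinus_le_one.trans_lt ENNReal.one_lt_top).ne

end Constants

/-! ### Summation of the error bounds -/

lemma sum_pow_sub_mul_le {ρ κ₀ κ : ℝ} (h0 : 0 ≤ ρ) (h1 : ρ < 1) (hκ₀ : 0 ≤ κ₀) (hκ : 0 ≤ κ)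
    {i m Δ : ℕ} (hm : m ≤ i + Δ) :
    ∑ l ∈ Finset.range (m + 1), ρ ^ (i - l) * (if l = 0 then κ₀ else κ) ≤
      κ₀ + κ * (1 / (1 - ρ) + Δ) := by
  rw [Finset.sum_range_succ']
  simp only [Nat.add_eq_zero_iff, one_ne_zero, and_false, if_false, if_true, Nat.sub_zero]
  rw [← Finset.sum_mul, add_comm, mul_comm _ κ]
  have hpow (j : ℕ) : ρ ^ j ≤ 1 := pow_le_one₀ h0 h1.le
  refine add_le_add (mul_le_of_le_one_left hκ₀ (hpow i)) (mul_le_mul_of_nonneg_left ?_ hκ)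
  calc ∑ l ∈ Finset.range m, ρ ^ (i - (l + 1))
      ≤ ∑ l ∈ Finset.range (i + Δ), ρ ^ (i - (l + 1)) :=
        Finset.sum_le_sum_of_subset_of_nonneg (Finset.range_mono hm) fun _ _ _ => pow_nonneg h0 _
    _ = ∑ l ∈ Finset.range i, ρ ^ (i - 1 - l) + ∑ l ∈ Finset.range Δ, ρ ^ (i - (i + l + 1)) := by
        rw [Finset.sum_range_add]
        congr 1
        exact Finset.sum_congr rfl fun l _ => by rw [Nat.sub_sub, add_comm 1 l]
    _ = ∑ l ∈ Finset.range i, ρ ^ l + ∑ l ∈ Finset.range Δ, ρ ^ (i - (i + l + 1)) := by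
        rw [Finset.sum_range_reflect (fun l => ρ ^ l) i]
    _ ≤ 1 / (1 - ρ) + Δ := by
        refine add_le_add ?_ ?_
        · rw [geom_sum_eq h1.ne, ← neg_div_neg_eq, neg_sub, neg_sub]
          have : 0 < 1 - ρ := by linarith
          gcongr
          linarith [pow_nonneg h0 i]
        · refine (Finset.sum_le_sum fun l _ => hpow _).trans ?_
          simp

lemma sum_lag_indicator_le {c : ℝ} (hc : 0 ≤ c) (n Δ : ℕ) :
    ∑ i : Fin n, (if (i : ℕ) + Δ < n then c else 0) ≤ c * max ((n : ℝ) - Δ + 1) 0 := by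
  rw [Fin.sum_univ_eq_sum_range (fun i => if i + Δ < n then c else 0) n, ← Finset.sum_filter,
    Finset.sum_const, nsmul_eq_mul, mul_comm]
  refine mul_le_mul_of_nonneg_left ?_ hc
  have hcard : ((Finset.range n).filter fun i => i + Δ < n).card ≤ n - Δ := by
    refine (Finset.card_le_card (t := Finset.range (n - Δ)) fun i hi => ?_).trans_eq
      (Finset.card_range _)
    simp only [Finset.mem_filter, Finset.mem_range] at hi ⊢
    omega
  refine (Nat.cast_le.2 hcard).trans ?_
  rcases le_total Δ n with h | h
  · rw [Nat.cast_sub h]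
    exact le_max_of_le_left (by linarith)
  · rw [Nat.sub_eq_zero_of_le h]
    simp

/-! ### Decomposition of the estimation error -/

section Decomposition

variable {Θ X 𝓨 : Type*} [MeasurableSpace X] [MeasurableSpace 𝓨]
  {M : StateSpaceModel Θ X 𝓨} {S : Proposal M} {D : DataModel X M.lam} {N : ℕ} [NeZero N] {θ : Θ}
  {n : ℕ} {s : Fin n → (Fin (n + 1) → 𝓨) → X → X → ℝ}

omit [MeasurableSpace X] in
lemma abs_le_toReal_normS {f : X → X → ℝ} (h : normS f ≠ ∞) (x x' : X) :
    |f x x'| ≤ (normS f).toReal := by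
  have h1 : ‖f x x'‖ₑ ≤ normS f := le_iSup₂ (f := fun x x' => ‖f x x'‖ₑ) x x'
  simpa using ENNReal.toReal_mono h h1

variable (M θ s) in
/-- The smoothed value of the `i`-th term of the additive functional. -/
noncomputable def smoothedTerm (i : Fin n) (y : Fin (n + 1) → 𝓨) : ℝ :=
  tiltedMean M θ (clamp n y) (fun _ => 1) (edge (s i y) i (Nat.succ_le_of_lt i.2))

lemma pathMeasure_clamp (y : Fin (n + 1) → 𝓨) :
    pathMeasure M θ (clamp n y) n =
      (Measure.pi fun _ => M.μ).withDensity fun x => (M.pathDensity θ n y x : ℝ≥0∞) := by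
  simp only [pathMeasure, clamp_val]

lemma measurable_smoothedTerm
    (hs : ∀ k, Measurable fun b : (Fin (n + 1) → 𝓨) × X × X => s k b.1 b.2.1 b.2.2) (i : Fin n) :
    Measurable (smoothedTerm M θ s i) := by
  have h1 (y : Fin (n + 1) → 𝓨) (F : (Fin (n + 1) → X) → ℝ) :
      ∫ x, F x ∂(pathMeasure M θ (clamp n y) n) =
        ∫ x, M.pathDensity θ n y x * F x ∂(Measure.pi fun _ => M.μ) := by
    rw [pathMeasure_clamp, integral_withDensity_eq_integral_smul
      (measurable_pathDensity_right M θ n y)]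
    rfl
  have hp := (measurable_pathDensity M θ n).coe_nnreal_real
  have he : Measurable fun a : (Fin (n + 1) → 𝓨) × (Fin (n + 1) → X) =>
      edge (s i a.1) i (Nat.succ_le_of_lt i.2) a.2 :=
    (hs i).comp (by fun_prop : Measurable fun a : (Fin (n + 1) → 𝓨) × (Fin (n + 1) → X) =>
      (a.1, a.2 ⟨i, _⟩, a.2 ⟨i + 1, _⟩))
  unfold smoothedTerm tiltedMean
  simp only [h1]
  refine Measurable.div ?_ ?_
  · exact (hp.mul (measurable_const.mul he)).stronglyMeasurable.integral_prod_right'.measurable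
  · exact (hp.mul measurable_const).stronglyMeasurable.integral_prod_right'.measurable

variable {σm σp d : ℝ}

/-- The smoothing distribution is the normalized path measure. -/
lemma StrongMixing.gammaExact_eq_sum (h : StrongMixing M θ σm σp)
    (hs : ∀ k, Measurable fun b : (Fin (n + 1) → 𝓨) × X × X => s k b.1 b.2.1 b.2.2)
    {y : Fin (n + 1) → 𝓨} (hy : ∀ i, normS (s i y) ≠ ∞) :
    gammaExact M θ s y = ∑ i, smoothedTerm M θ s i y := by
  have hfin := h.isFiniteMeasure_pathMeasure (clamp n y) n
  have hsy (i : Fin n) : Measurable (Function.uncurry (s i y)) :=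
    (hs i).comp measurable_prodMk_left
  have hi (i : Fin n) : Integrable (edge (s i y) i (Nat.succ_le_of_lt i.2))
      (pathMeasure M θ (clamp n y) n) :=
    integrable_of_bdd (measurable_edge (hsy i) _) fun x => abs_le_toReal_normS (hy i) _ _
  have hadd : additive s y = fun x => ∑ i, edge (s i y) i (Nat.succ_le_of_lt i.2) x := rfl
  have hmass : ∫ _, (1 : ℝ) ∂(pathMeasure M θ (clamp n y) n) = (M.likelihood θ n y).toReal := by
    rw [integral_const, smul_eq_mul, mul_one, measureReal_def, pathMeasure_clamp,
      withDensity_apply _ MeasurableSet.univ, Measure.restrict_univ, StateSpaceModel.likelihood]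
  rw [gammaExact, StateSpaceModel.smoothing, ← pathMeasure_clamp, integral_smul_measure, hadd,
    integral_finsetSum _ fun i _ => hi i, Finset.smul_sum]
  refine Finset.sum_congr rfl fun i _ => ?_
  rw [smoothedTerm, tiltedMean, hmass]
  simp only [one_mul, ENNReal.toReal_inv, smul_eq_mul]
  rw [div_eq_inv_mul]

variable (M θ s) in
/-- The error of the `i`-th term of the fixed-lag estimator, as a function of the observations and
of the particle system at the time `m` at which the term is evaluated. -/
noncomputable def termError (i : Fin n) {m : ℕ} (him : (i : ℕ) + 1 ≤ m)
    (b : (Fin (n + 1) → 𝓨) × ((Fin N → Fin (m + 1) → X) × (Fin N → Fin N))) : ℝ :=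
  resampledMean (edge (s i b.1) i him) b.2 - smoothedTerm M θ s i b.1

omit [NeZero N] in
lemma measurable_termError
    (hs : ∀ k, Measurable fun b : (Fin (n + 1) → 𝓨) × X × X => s k b.1 b.2.1 b.2.2) (i : Fin n)
    {m : ℕ} (him : (i : ℕ) + 1 ≤ m) : Measurable (termError (N := N) M θ s i him) := by
  refine Measurable.sub ?_ ((measurable_smoothedTerm hs i).comp measurable_fst)
  refine (Finset.measurable_sum _ fun j _ => ?_).const_mul _
  have h1 : Measurable fun b : (Fin (n + 1) → 𝓨) × ((Fin N → Fin (m + 1) → X) × (Fin N → Fin N)) =>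
      b.2.1 (b.2.2 j) :=
    (measurable_apply_index N).comp (by fun_prop :
      Measurable fun b : (Fin (n + 1) → 𝓨) × ((Fin N → Fin (m + 1) → X) × (Fin N → Fin N)) =>
        (b.2.1, b.2.2 j))
  exact (hs i).comp (measurable_fst.prodMk
    (((measurable_pi_apply _).comp h1).prodMk ((measurable_pi_apply _).comp h1)))

lemma lt_min_lag {Δ : ℕ} (hΔ : 1 ≤ Δ) (i : Fin n) : (i : ℕ) + 1 ≤ min (i + Δ) n := by
  have := i.2
  omega

omit [NeZero N] in
lemma StrongMixing.gammaHat_sub_gammaExact_eq (h : StrongMixing M θ σm σp)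
    (hs : ∀ k, Measurable fun b : (Fin (n + 1) → 𝓨) × X × X => s k b.1 b.2.1 b.2.2)
    {Δ : ℕ} (hΔ : 1 ≤ Δ) {z : Traj X 𝓨 N} (hz : ∀ i, normS (s i (observations n z)) ≠ ∞) :
    gammaHat s Δ hΔ z - gammaExact M θ s (observations n z) =
      ∑ i : Fin n, termError M θ s i (lt_min_lag hΔ i)
        (observations n z, (z (min (i + Δ) n)).2) := by
  rw [h.gammaExact_eq_sum hs hz, gammaHat, Finset.mul_sum, ← Finset.sum_sub_distrib]
  rfl

end Decomposition

/-! ### Integration over the observations -/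

lemma eLpNorm_compProd_le_eLpNorm {α β : Type*} [MeasurableSpace α] [MeasurableSpace β]
    {m : Measure α} [SFinite m] {κ : Kernel α β} [IsSFiniteKernel κ] {f : α × β → ℝ}
    (hf : Measurable f) {p : ℕ} (hp : p ≠ 0) {T : α → ℝ}
    (h : ∀ᵐ a ∂m, eLpNorm (fun b => f (a, b)) p (κ a) ≤ ENNReal.ofReal (T a)) :
    eLpNorm f p (m ⊗ₘ κ) ≤ eLpNorm T p m := by
  have hp' : 0 < (p : ℝ) := by exact_mod_cast Nat.pos_of_ne_zero hp
  simp only [eLpNorm_natCast_eq _ hp] at h ⊢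
  rw [Measure.lintegral_compProd (by fun_prop)]
  refine ENNReal.rpow_le_rpow (lintegral_mono_ae ?_) (by positivity)
  filter_upwards [h] with a ha
  have := ENNReal.rpow_le_rpow (ha.trans (Real.ofReal_le_enorm _)) hp'.le
  rwa [← ENNReal.rpow_mul, one_div_mul_cancel hp'.ne', ENNReal.rpow_one,
    ENNReal.rpow_natCast] at this

/-- Minkowski's inequality for a linear combination with nonnegative coefficients. -/
lemma eLpNorm_sum_mul_le {α ι : Type*} [MeasurableSpace α] {m : Measure α} (I : Finset ι)
    {c : ι → ℝ} (hc : ∀ l, 0 ≤ c l) {f : ι → α → ℝ} (hf : ∀ l ∈ I, AEMeasurable (f l) m) {p : ℕ}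
    (hp : p ≠ 0) {A : ℝ} (hA : 0 ≤ A) (h : ∀ l ∈ I, eLpNorm (f l) p m ≤ ENNReal.ofReal A) :
    eLpNorm (fun a => ∑ l ∈ I, c l * f l a) p m ≤ ENNReal.ofReal ((∑ l ∈ I, c l) * A) := by
  have e : (fun a => ∑ l ∈ I, c l * f l a) = ∑ l ∈ I, c l • f l := by
    ext a
    simp
  rw [e]
  refine (eLpNorm_sum_le (fun l hl => ((hf l hl).const_smul (c l)).aestronglyMeasurable)
    (by exact_mod_cast Nat.one_le_iff_ne_zero.2 hp)).trans ?_
  rw [Finset.sum_mul, ENNReal.ofReal_sum_of_nonneg fun l _ => mul_nonneg (hc l) hA]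
  refine Finset.sum_le_sum fun l hl => ?_
  rw [eLpNorm_const_smul, Real.enorm_eq_ofReal (hc l), ENNReal.ofReal_mul (hc l)]
  gcongr
  exact h l hl

section Assumption

variable {α : Type*} [MeasurableSpace α] {m : Measure α} {F : α → ℝ≥0∞} {a : ℝ}

lemma ExpectationLE.ae_lt_top (h : ExpectationLE m F a) : ∀ᵐ y ∂m, F y < ∞ :=
  ae_lt_top' h.1 (h.2.trans_lt ENNReal.ofReal_lt_top).ne

lemma ExpectationLE.integrable_toReal (h : ExpectationLE m F a) :
    Integrable (fun y => (F y).toReal) m :=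
  integrable_toReal_of_lintegral_ne_top h.1 (h.2.trans_lt ENNReal.ofReal_lt_top).ne

lemma ExpectationLE.integral_toReal_le (h : ExpectationLE m F a) (ha : 0 ≤ a) :
    ∫ y, (F y).toReal ∂m ≤ a := by
  rw [integral_toReal h.1 h.ae_lt_top]
  exact ENNReal.toReal_le_of_le_ofReal ha h.2

lemma ExpectationLE.aemeasurable_toReal_of_pow {f : α → ℝ≥0∞} {p : ℕ} (hp : p ≠ 0)
    (h : ExpectationLE m (fun y => f y ^ p) a) : AEMeasurable (fun y => (f y).toReal) m := by
  have e : f = fun y => (f y ^ p) ^ (1 / (p : ℝ)) := by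
    ext y
    rw [one_div, ENNReal.pow_rpow_inv_natCast hp]
  have h1 : AEMeasurable f m := by
    rw [e]
    exact h.1.pow_const _
  exact h1.ennreal_toReal

lemma ExpectationLE.eLpNorm_toReal_le {f : α → ℝ≥0∞} {p : ℕ} (hp : p ≠ 0) (ha : 0 ≤ a)
    (h : ExpectationLE m (fun y => f y ^ p) a) :
    eLpNorm (fun y => (f y).toReal) p m ≤ ENNReal.ofReal (a ^ (1 / (p : ℝ))) := by
  rw [eLpNorm_natCast_eq _ hp, ← ENNReal.ofReal_rpow_of_nonneg ha (by positivity)]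
  refine ENNReal.rpow_le_rpow (le_trans (lintegral_mono fun y => ?_) h.2) (by positivity)
  simp only
  gcongr
  rw [Real.enorm_eq_ofReal ENNReal.toReal_nonneg]
  exact ENNReal.ofReal_toReal_le

end Assumption

/-! ### The error of one term of the estimator -/

section TermBounds

variable {Θ X 𝓨 : Type*} [MeasurableSpace X] [MeasurableSpace 𝓨]
  {M : StateSpaceModel Θ X 𝓨} {S : Proposal M} {D : DataModel X M.lam} {N : ℕ} [NeZero N] {θ : Θ}
  {n : ℕ} {s : Fin n → (Fin (n + 1) → 𝓨) → X → X → ℝ}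

variable (S θ s) in
/-- The random variable whose expectation is bounded by the assumption on the moments. -/
noncomputable def weightedNorm (p ℓ : ℕ) (i : Fin n) (l : ℕ) (y : Fin (n + 1) → 𝓨) : ℝ≥0∞ :=
  S.normW θ l (clamp n y l) ^ p * normS (s i y) ^ ℓ / M.μg θ (clamp n y l) ^ p

lemma A3.expectationLE_weightedNorm {p ℓ : ℕ} {a : ℝ} (h : A3 S D N θ s p ℓ a) (i : Fin n) {l : ℕ}
    (hl : l ≤ n) : ExpectationLE (obsLaw S D N θ n) (weightedNorm S θ s p ℓ i l) a := by
  have := h.2.1 ⟨l, Nat.lt_succ_of_le hl⟩ i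
  simp only [← clamp_val] at this
  exact this

omit [NeZero N] in
lemma weightedNorm_pow (p : ℕ) (i : Fin n) (l : ℕ) :
    weightedNorm S θ s p p i l = fun y => weightedNorm S θ s 1 1 i l y ^ p := by
  ext y
  simp only [weightedNorm, pow_one, div_eq_mul_inv, mul_pow, ENNReal.inv_pow]

variable {σm σp d : ℝ}

lemma toReal_weightedNorm (p : ℕ) (i : Fin n) (l : ℕ) (y : Fin (n + 1) → 𝓨) :
    (normS (s i y)).toReal * weightRatio S θ σm σp d l (clamp n y l) ^ p =
      ((if l = 0 then (1 / d) ^ p else (1 / σm) ^ p) * (σp / σm) ^ p) *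
        (weightedNorm S θ s p 1 i l y).toReal := by
  rw [weightedNorm, ENNReal.toReal_div, ENNReal.toReal_mul, ENNReal.toReal_pow, ENNReal.toReal_pow,
    ENNReal.toReal_pow, toReal_μg, weightRatio]
  split_ifs <;> ring

lemma A3.ae_normS_ne_top {p ℓ : ℕ} (hℓ : ℓ ≠ 0) {a : ℝ} (h : A3 S D N θ s p ℓ a) (i : Fin n) :
    ∀ᵐ y ∂(obsLaw S D N θ n), normS (s i y) ≠ ∞ := by
  filter_upwards [(h.2.2 i).ae_lt_top] with y hy
  rintro he
  simp [he, hℓ] at hy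

namespace StrongMixing

variable (h : StrongMixing M θ σm σp) (hd0 : 0 < d) (hd : ∀ x, d ≤ M.dν x) (hA : S.A2)
  (hs : ∀ k, Measurable fun b : (Fin (n + 1) → 𝓨) × X × X => s k b.1 b.2.1 b.2.2)
include h hd0 hd hA hs

/-- The `L^p` error of the `i`-th term of the estimator. -/
theorem eLpNorm_termError_le {p : ℕ} (hp : p ≠ 0) {a : ℝ} (h3 : A3 S D N θ s p p a) (i : Fin n)
    {m Δ : ℕ} (hΔ : 1 ≤ Δ) (hm : m = min (i + Δ) n) (him : (i : ℕ) + 1 ≤ m) :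
    eLpNorm (fun z => termError M θ s i him (observations n z, (z m).2)) p (chainLaw S D N θ) ≤
      ENNReal.ofReal ((2 * (if (i : ℕ) + Δ < n then (1 - σm / σp) ^ Δ else 0) +
        2 * momentConst p / √N + 4 * momentConst p / √N * (σp / σm) *
          ∑ l ∈ Finset.range (m + 1), (1 - σm / σp) ^ (i - l) *
            (if l = 0 then 1 / d else 1 / σm)) * a ^ (1 / (p : ℝ))) := by
  have hK : 0 ≤ momentConst p := zero_le_one.trans (one_le_momentConst p)
  have hρ := h.rho_nonneg
  have hσm := h.pos
  have hσp := h.σp_pos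
  have ha : 0 ≤ a ^ (1 / (p : ℝ)) := Real.rpow_nonneg h3.1 _
  have hlag : 0 ≤ if (i : ℕ) + Δ < n then (1 - σm / σp) ^ Δ else 0 := by
    split_ifs <;> positivity
  set lag := if (i : ℕ) + Δ < n then (1 - σm / σp) ^ Δ else 0 with hlagdef
  have hmn : m ≤ n := hm ▸ min_le_right _ _
  have hmeas := measurable_termError (M := M) (N := N) (θ := θ) hs i him
  have hmap : Measurable fun z : Traj X 𝓨 N => (observations n z, (z m).2) :=
    (measurable_observations N n).prodMk (by fun_prop)
  set c : ℕ → ℝ := fun l => 4 * momentConst p / √N * (σp / σm) *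
    ((1 - σm / σp) ^ (i - l) * (if l = 0 then 1 / d else 1 / σm)) with hc
  have hc0 (l : ℕ) : 0 ≤ c l := by
    simp only [hc]
    split_ifs <;> positivity
  set f : ℕ → (Fin (n + 1) → 𝓨) → ℝ := fun l y => (weightedNorm S θ s 1 1 i l y).toReal with hf
  set b : (Fin (n + 1) → 𝓨) → ℝ := fun y => (normS (s i y)).toReal with hb
  have hE (l : ℕ) (hl : l ∈ Finset.range (m + 1)) :
      ExpectationLE (obsLaw S D N θ n) (fun y => weightedNorm S θ s 1 1 i l y ^ p) a := by
    rw [← weightedNorm_pow]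
    exact h3.expectationLE_weightedNorm i (by rw [Finset.mem_range] at hl; omega)
  have hTf := eLpNorm_sum_mul_le (Finset.range (m + 1)) hc0 (f := f)
    (fun l hl => (hE l hl).aemeasurable_toReal_of_pow hp) hp ha
    (fun l hl => (hE l hl).eLpNorm_toReal_le hp h3.1)
  have hbm : AEMeasurable b (obsLaw S D N θ n) := (h3.2.2 i).aemeasurable_toReal_of_pow hp
  have hTb : eLpNorm (fun y => (2 * lag + 2 * momentConst p / √N) * b y) p (obsLaw S D N θ n) ≤
      ENNReal.ofReal ((2 * lag + 2 * momentConst p / √N) * a ^ (1 / (p : ℝ))) := by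
    have h0 : 0 ≤ 2 * lag + 2 * momentConst p / √N := by positivity
    have e : (fun y => (2 * lag + 2 * momentConst p / √N) * b y) =
      (2 * lag + 2 * momentConst p / √N) • b := rfl
    rw [e, eLpNorm_const_smul, Real.enorm_eq_ofReal h0, ENNReal.ofReal_mul h0]
    gcongr
    exact (h3.2.2 i).eLpNorm_toReal_le hp h3.1
  have hfm : AEMeasurable (fun y => ∑ l ∈ Finset.range (m + 1), c l * f l y)
      (obsLaw S D N θ n) := Finset.aemeasurable_fun_sum _ fun l hl =>
    ((hE l hl).aemeasurable_toReal_of_pow hp).const_mul _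
  calc eLpNorm (fun z => termError M θ s i him (observations n z, (z m).2)) p (chainLaw S D N θ)
      = eLpNorm (termError M θ s i him) p (obsLaw S D N θ n ⊗ₘ
          (systemLaw S N θ m).comap (clamp n) (measurable_clamp n)) := by
        rw [← map_observations_system S D N θ hmn,
          eLpNorm_map_measure hmeas.aestronglyMeasurable hmap.aemeasurable]
        rfl
    _ ≤ eLpNorm (fun y => (2 * lag + 2 * momentConst p / √N) * b y +
          ∑ l ∈ Finset.range (m + 1), c l * f l y) p (obsLaw S D N θ n) := by
        refine eLpNorm_compProd_le_eLpNorm hmeas hp ?_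
        filter_upwards [h3.ae_normS_ne_top hp i] with y hy
        have hsy : Measurable (Function.uncurry (s i y)) := (hs i).comp measurable_prodMk_left
        refine (h.eLpNorm_fixedLag_sub_le (clamp n y) hd0 hd hA (N := N)
          hsy (abs_le_toReal_normS hy) hp hΔ hm him
          (Nat.succ_le_of_lt i.2)).trans (ENNReal.ofReal_le_ofReal (le_of_eq ?_))
        have e (l : ℕ) : (1 - σm / σp) ^ (i - l) * (2 * (normS (s i y)).toReal) *
            weightRatio S θ σm σp d l (clamp n y l) =
            (1 - σm / σp) ^ (i - l) * 2 * (((if l = 0 then 1 / d else 1 / σm) * (σp / σm)) *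
              f l y) := by
          have := toReal_weightedNorm (S := S) (θ := θ) (s := s) (σm := σm) (σp := σp) (d := d)
            1 i l y
          simp only [pow_one] at this
          rw [← this]
          ring
        simp only [e, hc, Finset.mul_sum]
        rw [add_right_comm, ← hlagdef]
        congr 1
        · ring
        · exact Finset.sum_congr rfl fun l _ => by ring
    _ ≤ ENNReal.ofReal ((2 * lag + 2 * momentConst p / √N) * a ^ (1 / (p : ℝ))) +
          ENNReal.ofReal ((∑ l ∈ Finset.range (m + 1), c l) * a ^ (1 / (p : ℝ))) :=
        (eLpNorm_add_le (hbm.const_mul _).aestronglyMeasurable hfm.aestronglyMeasurable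
          (by exact_mod_cast Nat.one_le_iff_ne_zero.2 hp)).trans (add_le_add hTb hTf)
    _ = _ := by
        rw [← ENNReal.ofReal_add (by positivity)
          (mul_nonneg (Finset.sum_nonneg fun l _ => hc0 l) ha), ← add_mul, ← Finset.mul_sum]

omit hA in
lemma abs_termError_le {y : Fin (n + 1) → 𝓨} {i : Fin n} (hy : normS (s i y) ≠ ∞)
    {m : ℕ} (him : (i : ℕ) + 1 ≤ m) (q : (Fin N → Fin (m + 1) → X) × (Fin N → Fin N)) :
    |termError M θ s i him (y, q)| ≤ 2 * (normS (s i y)).toReal := by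
  have h1 : |resampledMean (edge (s i y) i him) q| ≤ (normS (s i y)).toReal :=
    abs_resampledMean_le (fun x => abs_le_toReal_normS hy _ _) q
  have hsy : Measurable (Function.uncurry (s i y)) := (hs i).comp measurable_prodMk_left
  have h2 : smoothedTerm M θ s i y ∈ Set.Icc (-(normS (s i y)).toReal) (normS (s i y)).toReal :=
    h.tiltedMean_mem hd0 hd (clamp n y) h.comparable_one
      (measurable_edge hsy _)
      fun x => abs_le.1 (abs_le_toReal_normS hy _ _)
  refine (abs_sub _ _).trans ?_
  have := abs_le.2 h2
  linarith

omit hA in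
lemma integrable_termError {p : ℕ} {a : ℝ} (h3 : A3 S D N θ s p 1 a) (i : Fin n)
    {m : ℕ} (him : (i : ℕ) + 1 ≤ m) :
    Integrable (termError M θ s i him) (obsLaw S D N θ n ⊗ₘ
      (systemLaw S N θ m).comap (clamp n) (measurable_clamp n)) := by
  set κ := (systemLaw S N θ m).comap (clamp n) (measurable_clamp n)
  have hfst : (obsLaw S D N θ n ⊗ₘ κ).map Prod.fst = obsLaw S D N θ n := Measure.fst_compProd _ _
  have hb : Integrable (fun y => (normS (s i y)).toReal) (obsLaw S D N θ n) := by
    simpa using (h3.2.2 i).integrable_toReal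
  have hb2 : Integrable (fun b => 2 * (normS (s i b.1)).toReal) (obsLaw S D N θ n ⊗ₘ κ) := by
    rw [← hfst] at hb
    exact (hb.comp_measurable measurable_fst).const_mul 2
  refine hb2.mono' (measurable_termError hs i him).aestronglyMeasurable ?_
  have hae := h3.ae_normS_ne_top one_ne_zero i
  rw [← hfst] at hae
  filter_upwards [ae_of_ae_map measurable_fst.aemeasurable hae] with b hb
  exact h.abs_termError_le hd0 hd hs hb him b.2

/-- The bias of the `i`-th term of the estimator. -/
theorem abs_integral_termError_le {a : ℝ} (h3 : A3 S D N θ s 2 1 a) (i : Fin n)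
    {m Δ : ℕ} (hΔ : 1 ≤ Δ) (hm : m = min (i + Δ) n) (him : (i : ℕ) + 1 ≤ m) :
    Integrable (fun z => termError M θ s i him (observations n z, (z m).2)) (chainLaw S D N θ) ∧
    |∫ z, termError M θ s i him (observations n z, (z m).2) ∂(chainLaw S D N θ)| ≤
      (2 * (if (i : ℕ) + Δ < n then (1 - σm / σp) ^ Δ else 0) +
        6 * momentConst 2 ^ 2 / N * (σp / σm) ^ 2 *
          ∑ l ∈ Finset.range (m + 1), (1 - σm / σp) ^ (i - l) *
            (if l = 0 then (1 / d) ^ 2 else (1 / σm) ^ 2)) * a := by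
  have hρ := h.rho_nonneg
  have hσm := h.pos
  have hσp := h.σp_pos
  have ha := h3.1
  have hlag : 0 ≤ if (i : ℕ) + Δ < n then (1 - σm / σp) ^ Δ else 0 := by
    split_ifs <;> positivity
  set lag := if (i : ℕ) + Δ < n then (1 - σm / σp) ^ Δ else 0 with hlagdef
  have hmn : m ≤ n := hm ▸ min_le_right _ _
  have hmeas := measurable_termError (M := M) (N := N) (θ := θ) hs i him
  have hmap : Measurable fun z : Traj X 𝓨 N => (observations n z, (z m).2) :=
    (measurable_observations N n).prodMk (by fun_prop)
  have hint := h.integrable_termError hd0 hd hs h3 i him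
  set c : ℕ → ℝ := fun l => 6 * momentConst 2 ^ 2 / N * (σp / σm) ^ 2 *
    ((1 - σm / σp) ^ (i - l) * (if l = 0 then (1 / d) ^ 2 else (1 / σm) ^ 2)) with hc
  have hc0 (l : ℕ) : 0 ≤ c l := by
    simp only [hc]
    split_ifs <;> positivity
  set f : ℕ → (Fin (n + 1) → 𝓨) → ℝ := fun l y => (weightedNorm S θ s 2 1 i l y).toReal with hf
  set b : (Fin (n + 1) → 𝓨) → ℝ := fun y => (normS (s i y)).toReal with hb
  have hE (l : ℕ) (hl : l ∈ Finset.range (m + 1)) :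
      ExpectationLE (obsLaw S D N θ n) (weightedNorm S θ s 2 1 i l) a :=
    h3.expectationLE_weightedNorm i (by rw [Finset.mem_range] at hl; omega)
  have hbi : Integrable b (obsLaw S D N θ n) := by simpa using (h3.2.2 i).integrable_toReal
  have hbl : ∫ y, b y ∂(obsLaw S D N θ n) ≤ a := by
    simpa using (h3.2.2 i).integral_toReal_le ha
  have hfi (l : ℕ) (hl : l ∈ Finset.range (m + 1)) :
      Integrable (fun y => c l * f l y) (obsLaw S D N θ n) :=
    (hE l hl).integrable_toReal.const_mul _
  have hT : Integrable (fun y => 2 * lag * b y + ∑ l ∈ Finset.range (m + 1), c l * f l y)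
      (obsLaw S D N θ n) := (hbi.const_mul _).add (integrable_finsetSum _ hfi)
  rw [← map_observations_system S D N θ hmn] at hint
  refine ⟨hint.comp_measurable hmap, ?_⟩
  rw [← integral_map hmap.aemeasurable hmeas.aestronglyMeasurable]
  rw [map_observations_system S D N θ hmn] at hint ⊢
  rw [Measure.integral_compProd hint, ← Real.norm_eq_abs]
  refine (norm_integral_le_of_norm_le hT ?_).trans ?_
  · filter_upwards [h3.ae_normS_ne_top one_ne_zero i] with y hy
    have hsy : Measurable (Function.uncurry (s i y)) := (hs i).comp measurable_prodMk_left
    refine (h.abs_integral_fixedLag_sub_le (clamp n y) hd0 hd hA (N := N)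
      hsy (abs_le_toReal_normS hy) hΔ hm him
      (Nat.succ_le_of_lt i.2)).trans (le_of_eq ?_)
    have e (l : ℕ) : (1 - σm / σp) ^ (i - l) * (2 * (normS (s i y)).toReal) *
        weightRatio S θ σm σp d l (clamp n y l) ^ 2 =
        (1 - σm / σp) ^ (i - l) * 2 *
          (((if l = 0 then (1 / d) ^ 2 else (1 / σm) ^ 2) * (σp / σm) ^ 2) * f l y) := by
      have := toReal_weightedNorm (S := S) (θ := θ) (s := s) (σm := σm) (σp := σp) (d := d)
        2 i l y
      rw [← this]
      ring
    simp only [e, hc, Finset.mul_sum]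
    rw [← hlagdef]
    congr 1
    · ring
    · exact Finset.sum_congr rfl fun l _ => by ring
  · rw [integral_add (hbi.const_mul _) (integrable_finsetSum _ hfi), integral_const_mul,
      integral_finsetSum _ hfi, add_mul, Finset.mul_sum, Finset.sum_mul]
    refine add_le_add (mul_le_mul_of_nonneg_left hbl (by positivity))
      (Finset.sum_le_sum fun l hl => ?_)
    rw [integral_const_mul]
    exact mul_le_mul_of_nonneg_left ((hE l hl).integral_toReal_le ha) (hc0 l)

end StrongMixing

end TermBounds

/-! ### The error bounds -/

section Main

variable {Θ X 𝓨 : Type*} [MeasurableSpace X] [MeasurableSpace 𝓨]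
  {M : StateSpaceModel Θ X 𝓨} {S : Proposal M} {D : DataModel X M.lam} {N : ℕ} [NeZero N] {θ : Θ}
  {n : ℕ} {s : Fin n → (Fin (n + 1) → 𝓨) → X → X → ℝ} {σm σp d : ℝ}

namespace StrongMixing

variable (h : StrongMixing M θ σm σp)
include h

lemma one_sub_rho_pos : 0 < 1 - (1 - σm / σp) := by
  have := div_pos h.pos h.σp_pos
  linarith

lemma gammaHat_sub_gammaExact_ae {p ℓ : ℕ} (hℓ : ℓ ≠ 0) {a : ℝ}
    (h3 : A3 S D N θ s p ℓ a)
    (hs : ∀ k, Measurable fun b : (Fin (n + 1) → 𝓨) × X × X => s k b.1 b.2.1 b.2.2)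
    {Δ : ℕ} (hΔ : 1 ≤ Δ) :
    (fun z => gammaHat s Δ hΔ z - gammaExact M θ s (observations n z)) =ᵐ[chainLaw S D N θ]
      fun z => ∑ i : Fin n, termError M θ s i (lt_min_lag hΔ i)
        (observations n z, (z (min (i + Δ) n)).2) := by
  have hae : ∀ᵐ y ∂(obsLaw S D N θ n), ∀ i, normS (s i y) ≠ ∞ :=
    ae_all_iff.2 fun i => h3.ae_normS_ne_top hℓ i
  filter_upwards [ae_of_ae_map (measurable_observations N n).aemeasurable hae] with z hz
  exact h.gammaHat_sub_gammaExact_eq hs hΔ hz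

/-- The sum over the terms of the bounds for their errors. -/
lemma sum_bound_le {κ₀ κ R t c : ℝ} (hκ₀ : 0 ≤ κ₀) (hκ : 0 ≤ κ) (hR : 0 ≤ R) (hc : 0 ≤ c)
    (n Δ : ℕ) :
    ∑ i : Fin n, (2 * (if (i : ℕ) + Δ < n then (1 - σm / σp) ^ Δ else 0) + t +
        c * R * ∑ l ∈ Finset.range (min (i + Δ) n + 1), (1 - σm / σp) ^ ((i : ℕ) - l) *
            (if l = 0 then κ₀ else κ)) ≤
      2 * (1 - σm / σp) ^ Δ * max ((n : ℝ) - Δ + 1) 0 + n * t +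
        c * R * (n * (κ₀ + κ * (1 / (1 - (1 - σm / σp)) + Δ))) := by
  have hρ := h.rho_nonneg
  have hρ1 : 1 - σm / σp < 1 := by linarith [h.one_sub_rho_pos]
  rw [Finset.sum_add_distrib, Finset.sum_add_distrib, ← Finset.mul_sum, ← Finset.mul_sum,
    mul_assoc 2]
  refine add_le_add (add_le_add ?_ (by simp)) (mul_le_mul_of_nonneg_left ?_ (mul_nonneg hc hR))
  · exact mul_le_mul_of_nonneg_left (sum_lag_indicator_le (pow_nonneg hρ _) n Δ) zero_le_two
  · refine (Finset.sum_le_sum fun (i : Fin n) _ => sum_pow_sub_mul_le hρ hρ1 hκ₀ hκ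
      (i := i) (m := min (i + Δ) n) (Δ := Δ) (min_le_left _ _)).trans ?_
    simp only [Finset.sum_const, Finset.card_univ, Fintype.card_fin, nsmul_eq_mul, le_refl]

variable (hd0 : 0 < d) (hd : ∀ x, d ≤ M.dν x) (hd1 : d ≤ 1) (hA : S.A2)
  (hs : ∀ k, Measurable fun b : (Fin (n + 1) → 𝓨) × X × X => s k b.1 b.2.1 b.2.2)
include hd0 hd hd1 hA hs

theorem eLpNorm_gammaHat_sub_le {p : ℕ} (hp : p ≠ 0) {a : ℝ} (h3 : A3 S D N θ s p p a)
    {Δ : ℕ} (hΔ : 1 ≤ Δ) :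
    MemLp (fun z => gammaHat s Δ hΔ z - gammaExact M θ s (observations n z)) p
      (chainLaw S D N θ) ∧
    eLpNorm (fun z => gammaHat s Δ hΔ z - gammaExact M θ s (observations n z)) p
      (chainLaw S D N θ) ≤ ENNReal.ofReal
        (2 * a ^ (1 / (p : ℝ)) * (1 - σm / σp) ^ Δ * max ((n : ℝ) - Δ + 1) 0 +
        4 * momentConst p * a ^ (1 / (p : ℝ)) / (√N * (1 - (1 - σm / σp))) *
          (Δ * ((n : ℝ) + 1) / σm +
            n * (1 / (σm * (1 - (1 - σm / σp))) + 1 / d ^ 2 + 1))) := by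
  have hK : 0 ≤ momentConst p := zero_le_one.trans (one_le_momentConst p)
  have hρ := h.rho_nonneg
  have hρ1 := h.one_sub_rho_pos
  have hρ2 : 1 - (1 - σm / σp) ≤ 1 := by linarith
  have hσm := h.pos
  have hσp := h.σp_pos
  have ha : 0 ≤ a ^ (1 / (p : ℝ)) := Real.rpow_nonneg h3.1 _
  have hN : (0 : ℝ) < √N := Real.sqrt_pos.2 (by exact_mod_cast Nat.pos_of_ne_zero (NeZero.ne N))
  have hae := h.gammaHat_sub_gammaExact_ae hp h3 hs hΔ
  have hmeas (i : Fin n) : Measurable fun z : Traj X 𝓨 N =>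
      termError M θ s i (lt_min_lag hΔ i) (observations n z, (z (min (i + Δ) n)).2) :=
    (measurable_termError hs i _).comp ((measurable_observations N n).prodMk (by fun_prop))
  have hle : eLpNorm (fun z => gammaHat s Δ hΔ z - gammaExact M θ s (observations n z)) p
      (chainLaw S D N θ) ≤ ENNReal.ofReal
        (2 * a ^ (1 / (p : ℝ)) * (1 - σm / σp) ^ Δ * max ((n : ℝ) - Δ + 1) 0 +
        4 * momentConst p * a ^ (1 / (p : ℝ)) / (√N * (1 - (1 - σm / σp))) *
          (Δ * ((n : ℝ) + 1) / σm +
            n * (1 / (σm * (1 - (1 - σm / σp))) + 1 / d ^ 2 + 1))) := by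
    rw [eLpNorm_congr_ae hae]
    have e : (fun z => ∑ i : Fin n, termError M θ s i (lt_min_lag hΔ i)
        (observations n z, (z (min (i + Δ) n)).2)) = ∑ i : Fin n, fun z : Traj X 𝓨 N =>
          termError M θ s i (lt_min_lag hΔ i) (observations n z, (z (min (i + Δ) n)).2) := by
      ext z
      simp
    rw [e]
    refine (eLpNorm_sum_le (fun i _ => (hmeas i).aestronglyMeasurable)
      (by exact_mod_cast Nat.one_le_iff_ne_zero.2 hp)).trans ?_
    refine (Finset.sum_le_sum fun i _ =>
      h.eLpNorm_termError_le hd0 hd hA hs hp h3 i hΔ rfl (lt_min_lag hΔ i)).trans ?_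
    rw [← ENNReal.ofReal_sum_of_nonneg]
    · refine ENNReal.ofReal_le_ofReal ?_
      rw [← Finset.sum_mul]
      refine (mul_le_mul_of_nonneg_right (h.sum_bound_le (κ₀ := 1 / d) (κ := 1 / σm)
        (by positivity) (by positivity) (by positivity) (by positivity) n Δ) ha).trans ?_
      rw [show σp / σm = 1 / (1 - (1 - σm / σp)) by rw [sub_sub_cancel, one_div_div]]
      set q := 1 - (1 - σm / σp)
      have e1 : 1 / d ≤ 1 / d ^ 2 := by
        rw [pow_two]
        exact one_div_le_one_div_of_le (mul_pos hd0 hd0) (mul_le_of_le_one_left hd0.le hd1)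
      have e2 : 2 * momentConst p / √N ≤ 4 * momentConst p / √N * (1 / q) := by
        have : 1 ≤ 1 / q := (one_le_div hρ1).2 hρ2
        calc 2 * momentConst p / √N ≤ 4 * momentConst p / √N * 1 := by
              rw [mul_one]
              gcongr
              norm_num
          _ ≤ _ := by gcongr
      have e3 : (n : ℝ) * (1 / d + 1 / σm * (1 / q + Δ)) ≤
          Δ * ((n : ℝ) + 1) / σm + n * (1 / (σm * q) + 1 / d ^ 2) := by
        have : (n : ℝ) * (1 / d + 1 / σm * (1 / q + Δ)) =
          Δ * n / σm + n * (1 / (σm * q) + 1 / d) := by field_simp; ring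
        rw [this]
        gcongr
        linarith
      calc _ ≤ (2 * (1 - σm / σp) ^ Δ * max ((n : ℝ) - Δ + 1) 0 +
            n * (4 * momentConst p / √N * (1 / q)) + 4 * momentConst p / √N * (1 / q) *
            (Δ * ((n : ℝ) + 1) / σm + n * (1 / (σm * q) + 1 / d ^ 2))) *
              a ^ (1 / (p : ℝ)) := by gcongr
        _ = _ := by field_simp; ring
    · intro i _
      have : 0 ≤ if (i : ℕ) + Δ < n then (1 - σm / σp) ^ Δ else 0 := by
        split_ifs <;> positivity
      refine mul_nonneg (add_nonneg (by positivity) (mul_nonneg (by positivity)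
        (Finset.sum_nonneg fun l _ => mul_nonneg (pow_nonneg hρ _) ?_))) ha
      split_ifs <;> positivity
  refine ⟨⟨?_, hle.trans_lt ENNReal.ofReal_lt_top⟩, hle⟩
  exact AEStronglyMeasurable.congr
    (Finset.measurable_fun_sum _ fun i _ => hmeas i).aestronglyMeasurable hae.symm

omit hd1 in
theorem abs_integral_gammaHat_sub_le {a : ℝ} (h3 : A3 S D N θ s 2 1 a) {Δ : ℕ} (hΔ : 1 ≤ Δ) :
    Integrable (fun z => gammaHat s Δ hΔ z - gammaExact M θ s (observations n z))
      (chainLaw S D N θ) ∧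
    |∫ z, (gammaHat s Δ hΔ z - gammaExact M θ s (observations n z)) ∂(chainLaw S D N θ)| ≤
        2 * a * (1 - σm / σp) ^ Δ * max ((n : ℝ) - Δ + 1) 0 +
        6 * momentConst 2 ^ 2 * a / (N * (1 - (1 - σm / σp)) ^ 2) *
          (Δ * ((n : ℝ) + 1) / σm ^ 2 +
            n * (1 / (σm ^ 2 * (1 - (1 - σm / σp))) + 1 / d ^ 2)) := by
  have hρ := h.rho_nonneg
  have hρ1 := h.one_sub_rho_pos
  have hσm := h.pos
  have hσp := h.σp_pos
  have ha := h3.1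
  have hN : (0 : ℝ) < N := by exact_mod_cast Nat.pos_of_ne_zero (NeZero.ne N)
  have hae := h.gammaHat_sub_gammaExact_ae one_ne_zero h3 hs hΔ
  have hterm (i : Fin n) :=
    h.abs_integral_termError_le hd0 hd hA hs h3 i hΔ rfl (lt_min_lag hΔ i)
  refine ⟨(integrable_finsetSum _ fun i _ => (hterm i).1).congr hae.symm, ?_⟩
  rw [integral_congr_ae hae, integral_finsetSum _ fun i _ => (hterm i).1]
  refine (Finset.abs_sum_le_sum_abs _ _).trans ?_
  refine (Finset.sum_le_sum fun i _ => (hterm i).2).trans ?_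
  rw [← Finset.sum_mul]
  have hsum := h.sum_bound_le (κ₀ := (1 / d) ^ 2) (κ := (1 / σm) ^ 2) (R := (σp / σm) ^ 2)
    (t := 0) (c := 6 * momentConst 2 ^ 2 / N)
    (by positivity) (by positivity) (by positivity) (by positivity) n Δ
  simp only [add_zero, mul_zero] at hsum
  refine (mul_le_mul_of_nonneg_right hsum ha).trans ?_
  rw [show σp / σm = 1 / (1 - (1 - σm / σp)) by rw [sub_sub_cancel, one_div_div]]
  set q := 1 - (1 - σm / σp)
  have e3 : (n : ℝ) * ((1 / d) ^ 2 + (1 / σm) ^ 2 * (1 / q + Δ)) ≤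
      Δ * ((n : ℝ) + 1) / σm ^ 2 + n * (1 / (σm ^ 2 * q) + 1 / d ^ 2) := by
    have : (n : ℝ) * ((1 / d) ^ 2 + (1 / σm) ^ 2 * (1 / q + Δ)) =
      Δ * n / σm ^ 2 + n * (1 / (σm ^ 2 * q) + 1 / d ^ 2) := by field_simp; ring
    rw [this]
    gcongr
    linarith
  calc _ ≤ (2 * (1 - σm / σp) ^ Δ * max ((n : ℝ) - Δ + 1) 0 +
        6 * momentConst 2 ^ 2 / N * (1 / q) ^ 2 *
        (Δ * ((n : ℝ) + 1) / σm ^ 2 + n * (1 / (σm ^ 2 * q) + 1 / d ^ 2))) * a := by gcongr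
    _ = _ := by field_simp

end StrongMixing

end Main
end FixedLag

theorem proposition3p4 :
    ∃ (Bp : ℕ → ℝ) (B : ℝ),
      ∀ (Θ : Type u) (X : Type v) (𝓨 : Type w) [MeasurableSpace X] [MeasurableSpace 𝓨]
        (M : StateSpaceModel Θ X 𝓨) (S : Proposal M) (D : DataModel X M.lam),
        M.A1 → S.A2 → 0 < M.dνMinus →
        ∀ (N : ℕ) [NeZero N] (θ : Θ) (n Δ : ℕ) (hΔ : 1 ≤ Δ)
          (s : Fin n → (Fin (n + 1) → 𝓨) → X → X → ℝ),
          (∀ k, Measurable fun b : (Fin (n + 1) → 𝓨) × X × X => s k b.1 b.2.1 b.2.2) →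
          (∀ (p : ℕ) (a : ℝ), 2 ≤ p → A3 S D N θ s p p a →
            MemLp (fun z => gammaHat s Δ hΔ z - gammaExact M θ s (observations n z))
              (p : ℝ≥0∞) (chainLaw S D N θ) ∧
            (∫ z, |gammaHat s Δ hΔ z - gammaExact M θ s (observations n z)| ^ p
                ∂(chainLaw S D N θ)) ^ (1 / (p : ℝ)) ≤
              2 * a ^ (1 / (p : ℝ)) * M.rho ^ Δ * max ((n : ℝ) - Δ + 1) 0 +
              Bp p * a ^ (1 / (p : ℝ)) / (√(N : ℝ) * (1 - M.rho)) *
                (Δ * ((n : ℝ) + 1) / M.sigmaMinus.toReal +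
                  n * (1 / (M.sigmaMinus.toReal * (1 - M.rho)) +
                    1 / M.dνMinus.toReal ^ 2 + 1))) ∧
          (∀ a : ℝ, A3 S D N θ s 2 1 a →
            Integrable (fun z => gammaHat s Δ hΔ z - gammaExact M θ s (observations n z))
              (chainLaw S D N θ) ∧
            |∫ z, (gammaHat s Δ hΔ z - gammaExact M θ s (observations n z))
                ∂(chainLaw S D N θ)| ≤
              2 * a * M.rho ^ Δ * max ((n : ℝ) - Δ + 1) 0 +
              B * a / (N * (1 - M.rho) ^ 2) *
                (Δ * ((n : ℝ) + 1) / M.sigmaMinus.toReal ^ 2 +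
                  n * (1 / (M.sigmaMinus.toReal ^ 2 * (1 - M.rho)) +
                    1 / M.dνMinus.toReal ^ 2))) := by
  refine ⟨fun p => 4 * momentConst p, 6 * momentConst 2 ^ 2, ?_⟩
  intro Θ X 𝓨 _ _ M S D hA1 hA2 hν N _ θ n Δ hΔ s hs
  have h := strongMixing_of_A1 hA1 θ
  have hd0 := toReal_dνMinus_pos hν
  refine ⟨fun p a hp h3 => ?_, fun a h3 => ?_⟩
  · have hp0 : p ≠ 0 := by omega
    obtain ⟨hm, hle⟩ := h.eLpNorm_gammaHat_sub_le hd0 toReal_dνMinus_le toReal_dνMinus_le_one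
      hA2 hs hp0 h3 hΔ
    refine ⟨hm, ?_⟩
    rw [hm.eLpNorm_eq_integral_rpow_norm (by exact_mod_cast hp0) (by simp)] at hle
    simp only [ENNReal.toReal_natCast, Real.rpow_natCast, Real.norm_eq_abs, ← one_div] at hle
    refine (ENNReal.ofReal_le_ofReal_iff ?_).1 hle
    have hK : 0 ≤ momentConst p := zero_le_one.trans (one_le_momentConst p)
    have hρ := h.rho_nonneg
    have hρ1 := h.one_sub_rho_pos
    have hσm := h.pos
    have ha := h3.1
    positivity
  · exact h.abs_integral_gammaHat_sub_le hd0 toReal_dνMinus_le hA2 hs h3 hΔ
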